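/- There is a deterministic algorithm for the following problem, running on a real RAM (unit-cost exact arithmetic and comparisons on real numbers, unit-cost indirect addressing, and unit-cost arithmetic on integer words of $O(\log n)$ bits). Given $n$ points $p_1,\dots,p_n$ and $n$ (unweighted, closed) axis-aligned rectangles $r_1,\dots,r_n$ in $\mathbb{R}^2$, the algorithm finds three distinct indices $i,j,k$ such that $\{p_1,\dots,p_n\}\subset r_i\cup r_j\cup r_k$, or correctly reports that no such indices exist. Its worst-case running time is $\widetilde{O}(n^{5/3})$, that is, $O(n^{5/3}(\log n)^{a})$ for some constant $a$. -/

import Mathlib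

/-! ### Rectangles and covers -/

/-- A closed axis-aligned rectangle `[xmin, xmax] × [ymin, ymax]` in the plane. -/
structure Rect where
  xmin : ℝ
  xmax : ℝ
  ymin : ℝ
  ymax : ℝ
  hx : xmin ≤ xmax
  hy : ymin ≤ ymax

/-- The set of points of a rectangle. -/
def Rect.toSet (r : Rect) : Set (ℝ × ℝ) :=
  Set.Icc r.xmin r.xmax ×ˢ Set.Icc r.ymin r.ymax

/-- `i`, `j`, `k` are (the indices of) three different rectangles of the family `R`
whose union covers the points `P`. -/
def IsThreeCover {n : ℕ} (P : Fin n → ℝ × ℝ) (R : Fin n → Rect) (i j k : Fin n) : Prop :=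
  i ≠ j ∧ i ≠ k ∧ j ≠ k ∧
    Set.range P ⊆ (R i).toSet ∪ (R j).toSet ∪ (R k).toSet

/-! ### The real RAM

A program is a fixed finite text. It works on integer variables, real variables, integer arrays
and real arrays (finitely many of each occur in a program), has unit-cost integer arithmetic on
words of logarithmically many bits, unit-cost exact arithmetic and comparisons on reals, unit-cost
indirect addressing, and no way to turn a real into an integer (no rounding) except through the
outcome of a comparison. -/

namespace RealRAM

/-- The memory of the machine: integer variables, real variables, integer arrays, real arrays.
`imem a i` is the cell with index `i` of the integer array number `a`. -/
structure State where
  ivar : ℕ → ℕ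
  rvar : ℕ → ℝ
  imem : ℕ → ℕ → ℕ
  rmem : ℕ → ℕ → ℝ

/-- Integer expressions: constants, variables, array accesses, and arithmetic (`sub` is
truncated at `0`, `div` and `mod` are integer quotient and remainder). -/
inductive IExpr where
  | const (m : ℕ)
  | var (x : ℕ)
  | load (a : ℕ) (i : IExpr)
  | add (e f : IExpr)
  | sub (e f : IExpr)
  | mul (e f : IExpr)
  | div (e f : IExpr)
  | mod (e f : IExpr)

/-- Real expressions: integer constants, variables, array accesses, and exact arithmetic. -/
inductive RExpr where
  | const (m : ℤ)
  | var (x : ℕ)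
  | load (a : ℕ) (i : IExpr)
  | add (e f : RExpr)
  | sub (e f : RExpr)
  | mul (e f : RExpr)
  | div (e f : RExpr)

/-- Tests: comparisons of integers and of reals, and their Boolean combinations. -/
inductive Test where
  | ile (e f : IExpr)
  | rle (e f : RExpr)
  | not (b : Test)
  | and (b c : Test)
  | or (b c : Test)

/-- Programs. -/
inductive Program where
  | skip
  | setI (x : ℕ) (e : IExpr)
  | setR (x : ℕ) (e : RExpr)
  | storeI (a : ℕ) (i : IExpr) (e : IExpr)
  | storeR (a : ℕ) (i : IExpr) (e : RExpr)
  | seq (p q : Program)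
  | cond (b : Test) (p q : Program)
  | loop (b : Test) (p : Program)

/-- The value of an integer expression. -/
def IExpr.eval (s : State) : IExpr → ℕ
  | .const m => m
  | .var x => s.ivar x
  | .load a i => s.imem a (i.eval s)
  | .add e f => e.eval s + f.eval s
  | .sub e f => e.eval s - f.eval s
  | .mul e f => e.eval s * f.eval s
  | .div e f => e.eval s / f.eval s
  | .mod e f => e.eval s % f.eval s

/-- The value of a real expression. -/
noncomputable def RExpr.eval (s : State) : RExpr → ℝ
  | .const m => (m : ℝ)
  | .var x => s.rvar x
  | .load a i => s.rmem a (i.eval s)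
  | .add e f => e.eval s + f.eval s
  | .sub e f => e.eval s - f.eval s
  | .mul e f => e.eval s * f.eval s
  | .div e f => e.eval s / f.eval s

/-- Whether a test succeeds. -/
def Test.Holds (s : State) : Test → Prop
  | .ile e f => e.eval s ≤ f.eval s
  | .rle e f => e.eval s ≤ f.eval s
  | .not b => ¬ b.Holds s
  | .and b c => b.Holds s ∧ c.Holds s
  | .or b c => b.Holds s ∨ c.Holds s

/-- The number of elementary operations in an integer expression. -/
def IExpr.cost : IExpr → ℕ
  | .const _ => 1
  | .var _ => 1
  | .load _ i => i.cost + 1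
  | .add e f => e.cost + f.cost + 1
  | .sub e f => e.cost + f.cost + 1
  | .mul e f => e.cost + f.cost + 1
  | .div e f => e.cost + f.cost + 1
  | .mod e f => e.cost + f.cost + 1

/-- The number of elementary operations in a real expression. -/
def RExpr.cost : RExpr → ℕ
  | .const _ => 1
  | .var _ => 1
  | .load _ i => i.cost + 1
  | .add e f => e.cost + f.cost + 1
  | .sub e f => e.cost + f.cost + 1
  | .mul e f => e.cost + f.cost + 1
  | .div e f => e.cost + f.cost + 1

/-- The number of elementary operations in a test. -/
def Test.cost : Test → ℕ
  | .ile e f => e.cost + f.cost + 1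
  | .rle e f => e.cost + f.cost + 1
  | .not b => b.cost + 1
  | .and b c => b.cost + c.cost + 1
  | .or b c => b.cost + c.cost + 1

/-- Assignment to an integer variable. -/
def State.setI (s : State) (x v : ℕ) : State :=
  { s with ivar := Function.update s.ivar x v }

/-- Assignment to a real variable. -/
noncomputable def State.setR (s : State) (x : ℕ) (v : ℝ) : State :=
  { s with rvar := Function.update s.rvar x v }

/-- Assignment to a cell of an integer array. -/
def State.storeI (s : State) (a i v : ℕ) : State :=
  { s with imem := Function.update s.imem a (Function.update (s.imem a) i v) }

/-- Assignment to a cell of a real array. -/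
noncomputable def State.storeR (s : State) (a i : ℕ) (v : ℝ) : State :=
  { s with rmem := Function.update s.rmem a (Function.update (s.rmem a) i v) }

/-- `Exec W p s t s'`: on a machine whose integer words hold the numbers `0, …, W`, the program
`p`, started in the state `s`, halts after exactly `t` elementary steps in the state `s'`.
An attempt to write an integer larger than `W` makes the machine get stuck; expressions have a
size that depends on the program only, so all intermediate values and all addresses are then
bounded by a fixed power of `W` (up to the constants in the program) as well. -/
inductive Exec (W : ℕ) : Program → State → ℕ → State → Prop where
  | skip (s : State) : Exec W .skip s 1 s
  | setI (x : ℕ) (e : IExpr) (s : State) (h : e.eval s ≤ W) :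
      Exec W (.setI x e) s (e.cost + 1) (s.setI x (e.eval s))
  | setR (x : ℕ) (e : RExpr) (s : State) :
      Exec W (.setR x e) s (e.cost + 1) (s.setR x (e.eval s))
  | storeI (a : ℕ) (i e : IExpr) (s : State) (h : e.eval s ≤ W) :
      Exec W (.storeI a i e) s (i.cost + e.cost + 1) (s.storeI a (i.eval s) (e.eval s))
  | storeR (a : ℕ) (i : IExpr) (e : RExpr) (s : State) :
      Exec W (.storeR a i e) s (i.cost + e.cost + 1) (s.storeR a (i.eval s) (e.eval s))
  | seq {p q : Program} {s s₁ s₂ : State} {t₁ t₂ : ℕ}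
      (hp : Exec W p s t₁ s₁) (hq : Exec W q s₁ t₂ s₂) :
      Exec W (.seq p q) s (t₁ + t₂) s₂
  | condTrue {b : Test} {p q : Program} {s s₁ : State} {t : ℕ}
      (hb : b.Holds s) (hp : Exec W p s t s₁) :
      Exec W (.cond b p q) s (b.cost + 1 + t) s₁
  | condFalse {b : Test} {p q : Program} {s s₁ : State} {t : ℕ}
      (hb : ¬ b.Holds s) (hq : Exec W q s t s₁) :
      Exec W (.cond b p q) s (b.cost + 1 + t) s₁
  | loopDone {b : Test} {p : Program} {s : State} (hb : ¬ b.Holds s) :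
      Exec W (.loop b p) s (b.cost + 1) s
  | loopStep {b : Test} {p : Program} {s s₁ s₂ : State} {t₁ t₂ : ℕ}
      (hb : b.Holds s) (hp : Exec W p s t₁ s₁) (hl : Exec W (.loop b p) s₁ t₂ s₂) :
      Exec W (.loop b p) s (b.cost + 1 + t₁ + t₂) s₂

end RealRAM

/-! ### Input and output conventions -/

open RealRAM in
/-- The initial memory for an instance: integer variable `0` holds `n`, the real arrays `0, 1`
hold the coordinates of the points, the real arrays `2, 3, 4, 5` hold the
`xmin, xmax, ymin, ymax` of the rectangles, and everything else is `0`. -/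
noncomputable def inputState {n : ℕ} (P : Fin n → ℝ × ℝ) (R : Fin n → Rect) : State where
  ivar x := if x = 0 then n else 0
  rvar _ := 0
  imem _ _ := 0
  rmem a i :=
    if h : i < n then
      match a with
      | 0 => (P ⟨i, h⟩).1
      | 1 => (P ⟨i, h⟩).2
      | 2 => (R ⟨i, h⟩).xmin
      | 3 => (R ⟨i, h⟩).xmax
      | 4 => (R ⟨i, h⟩).ymin
      | 5 => (R ⟨i, h⟩).ymax
      | _ => 0
    else 0

open RealRAM in
/-- The final memory is a correct answer: either integer variable `0` is `1` and the integer
variables `1, 2, 3` hold the indices of three rectangles that cover the points, or integer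
variable `0` is `0` and no three rectangles cover the points. -/
def CorrectOutput {n : ℕ} (P : Fin n → ℝ × ℝ) (R : Fin n → Rect) (s : State) : Prop :=
  (s.ivar 0 = 1 ∧ ∃ i j k : Fin n,
      s.ivar 1 = i ∧ s.ivar 2 = j ∧ s.ivar 3 = k ∧ IsThreeCover P R i j k) ∨
    (s.ivar 0 = 0 ∧ ¬ ∃ i j k : Fin n, IsThreeCover P R i j k)

/-- `T(n) = Õ(f(n))`: `T(n) = O(f(n) · (log n)^k)` for some constant `k`. -/
def IsSoftO (T : ℕ → ℝ) (f : ℕ → ℝ) : Prop :=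
  ∃ k : ℕ, Asymptotics.IsBigO Filter.atTop T (fun n => f n * Real.log n ^ k)

/-! Only the order of the coordinates matters, so points and sides are replaced by ranks. A pair of
rectangles can be checked in polylogarithmic time: the points outside both form a union of sixteen
sets, each given by two one-sided constraints; dominance tables yield the bounding box of this
union, and one more query finds a rectangle that contains the box. It remains to name `O(n^(5/3))`
pairs such that some pair is extendable whenever a cover exists. That pair need not come from the
given cover.

Sweep pairs. Given `x` and a direction `h`, consider the `y` such that `x` and `y` together contain
every point on the near side of `y`, and take one that reaches farthest. In a cover by `y`, `x`, `z`
with such a `y`, this best choice can replace `y`. So if all sweep pairs fail, then in any cover,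
for all `y`, `z` in it and all `h`, some point belongs to `z` alone and lies on the near side of `y`
(`NoCandidate.exists_own`).

Coarse pairs. The bounding box of the points has four sides and a cover three rectangles, so one of
them, `a`, touches two sides `g₁`, `g₂`; let `f₁`, `f₂` be the other two directions. Ranks are cut
into slabs of `g` consecutive numbers. For each pair of slabs, one representative `a'` that touches
`g₁`, `g₂` and reaches both slabs is tested with every `b`. If it cannot replace `a`, then a point
`p` of `a` alone lies in the same slab as a free side of `a` (`NoCandidate.touching_false`).

Slab pairs. Given `b` and directions `d`, `f`, look at the points beyond `b` in the direction `d`,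
and test `b` with every rectangle whose `f`-side is in the slab of the `f`-farthest of them. If
these fail too, the point `p` is impossible (`NoCandidate.slab_false`): the private points force `b`
and `c` to miss `p` in the same direction `d`, the slab pairs provide points beyond both `a` in the
direction `f₁` and `b`, respectively `c`, in the direction `d`, and the `d`-farthest point beyond
`a` in the direction `f₁` is then in no rectangle.

There are `O(n)` sweep pairs, `O(n * (n / g) ^ 2)` coarse pairs and `O(n * g)` slab pairs, which
balance at `g = n ^ (2 / 3)`.

The tables rest on one fact: `q < k` if and only if on some dyadic level the node of `k` directly
follows the node of `q` (`exists_div_eq`, `lt_of_div_eq`). With four keys and `L` levels, an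
insertion writes `L ^ 4` cells and a query reads `L ^ 4` cells. As memory starts out zero, the
sparse address space costs nothing. -/

namespace ThreeCover
open RealRAM

/-! ### Total correctness with a time bound -/

/-- From the state `s` the program `p` halts within `T` steps in a state satisfying `Q`. -/
def Run (W : ℕ) (p : Program) (s : State) (T : ℕ) (Q : State → Prop) : Prop :=
  ∃ t s', Exec W p s t s' ∧ t ≤ T ∧ Q s'

variable {W : ℕ} {p q : Program} {b : Test} {s : State} {T T₁ T₂ : ℕ} {Q Q₁ : State → Prop}

theorem Run.mono (h : Run W p s T₁ Q₁) (hT : T₁ ≤ T) (hQ : ∀ s', Q₁ s' → Q s') :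
    Run W p s T Q := by
  obtain ⟨t, s', he, ht, hq⟩ := h
  exact ⟨t, s', he, ht.trans hT, hQ _ hq⟩

theorem Run.skip (hQ : Q s) : Run W .skip s 1 Q := ⟨_, _, .skip s, le_rfl, hQ⟩

theorem Run.setI {x : ℕ} {e : IExpr} (h : e.eval s ≤ W) (hQ : Q (s.setI x (e.eval s))) :
    Run W (.setI x e) s (e.cost + 1) Q := ⟨_, _, .setI x e s h, le_rfl, hQ⟩

theorem Run.storeI {a : ℕ} {i e : IExpr} (h : e.eval s ≤ W)
    (hQ : Q (s.storeI a (i.eval s) (e.eval s))) :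
    Run W (.storeI a i e) s (i.cost + e.cost + 1) Q := ⟨_, _, .storeI a i e s h, le_rfl, hQ⟩

theorem Run.storeR {a : ℕ} {i : IExpr} {e : RExpr}
    (hQ : Q (s.storeR a (i.eval s) (e.eval s))) :
    Run W (.storeR a i e) s (i.cost + e.cost + 1) Q := ⟨_, _, .storeR a i e s, le_rfl, hQ⟩

theorem Run.seq (h : Run W p s T₁ fun s₁ => Run W q s₁ T₂ Q) :
    Run W (.seq p q) s (T₁ + T₂) Q := by
  obtain ⟨t, s', he, ht, t', s'', he', ht', hq⟩ := h
  exact ⟨_, _, .seq he he', add_le_add ht ht', hq⟩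

theorem Run.seq' (hp : Run W p s T₁ Q₁) (hq : ∀ s₁, Q₁ s₁ → Run W q s₁ T₂ Q) :
    Run W (.seq p q) s (T₁ + T₂) Q := Run.seq (hp.mono le_rfl hq)

theorem Run.cond (h₁ : b.Holds s → Run W p s T₁ Q) (h₂ : ¬ b.Holds s → Run W q s T₂ Q) :
    Run W (.cond b p q) s (b.cost + 1 + max T₁ T₂) Q := by
  by_cases hb : b.Holds s
  · obtain ⟨t, s', he, ht, hq⟩ := h₁ hb
    exact ⟨_, _, .condTrue hb he, by have := le_max_left T₁ T₂; omega, hq⟩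
  · obtain ⟨t, s', he, ht, hq⟩ := h₂ hb
    exact ⟨_, _, .condFalse hb he, by have := le_max_right T₁ T₂; omega, hq⟩

/-- The number `m` of rounds is fixed in advance, so an invariant indexed by the round gives
correctness, termination and the time bound at once. The induction is on the number of remaining
rounds. -/
theorem Run.loop (Inv : ℕ → State → Prop) (m : ℕ) (h0 : Inv 0 s)
    (hstep : ∀ i < m, ∀ s, Inv i s → b.Holds s ∧ Run W p s T (Inv (i + 1)))
    (hend : ∀ s, Inv m s → ¬ b.Holds s) :
    Run W (.loop b p) s (m * (T + b.cost + 1) + b.cost + 1) (Inv m) := by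
  suffices H : ∀ k ≤ m, ∀ s, Inv (m - k) s →
      Run W (.loop b p) s (k * (T + b.cost + 1) + b.cost + 1) (Inv m) from
    H m le_rfl s (by simpa using h0)
  intro k
  induction k with
  | zero => exact fun _ s hs => ⟨_, _, .loopDone (hend s hs), by simp, hs⟩
  | succ k ih =>
    intro hk s hs
    obtain ⟨hb, t, s', he, ht, hs'⟩ := hstep (m - (k + 1)) (by omega) s hs
    rw [show m - (k + 1) + 1 = m - k by omega] at hs'
    obtain ⟨t', s'', he', ht', hq⟩ := ih (by omega) s' hs'
    refine ⟨_, _, .loopStep hb he he', ?_, hq⟩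
    rw [Nat.succ_mul]; omega

/-- `for x := 0, …, e - 1 do p` -/
def forLoop (x : ℕ) (e : IExpr) (p : Program) : Program :=
  .seq (.setI x (.const 0)) (.loop (.not (.ile e (.var x)))
    (.seq p (.setI x (.add (.var x) (.const 1)))))

/-! ### Reading memory after an assignment -/

@[simp] theorem ivar_setI (s : State) (x v y : ℕ) :
    (s.setI x v).ivar y = if y = x then v else s.ivar y := by
  simp [State.setI, Function.update_apply]
@[simp] theorem imem_setI (s : State) (x v : ℕ) : (s.setI x v).imem = s.imem := rfl
@[simp] theorem rmem_setI (s : State) (x v : ℕ) : (s.setI x v).rmem = s.rmem := rfl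
@[simp] theorem ivar_storeI (s : State) (a i v : ℕ) : (s.storeI a i v).ivar = s.ivar := rfl
@[simp] theorem rmem_storeI (s : State) (a i v : ℕ) : (s.storeI a i v).rmem = s.rmem := rfl
theorem imem_storeI (s : State) (a i v a' : ℕ) : (s.storeI a i v).imem a' =
    if a' = a then Function.update (s.imem a) i v else s.imem a' := by
  simp only [State.storeI, Function.update_apply]
theorem imem_storeI_apply (s : State) (a i v a' j : ℕ) : (s.storeI a i v).imem a' j =
    if a' = a ∧ j = i then v else s.imem a' j := by
  rw [imem_storeI]; split_ifs with h1 h2 h2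
  · simp [h2.2]
  · rw [Function.update_of_ne (by tauto), h1]
  · tauto
  · rfl
@[simp] theorem ivar_storeR (s : State) (a i : ℕ) (v : ℝ) : (s.storeR a i v).ivar = s.ivar := rfl
@[simp] theorem imem_storeR (s : State) (a i : ℕ) (v : ℝ) : (s.storeR a i v).imem = s.imem := rfl
theorem rmem_storeR_apply (s : State) (a i : ℕ) (v : ℝ) (a' j : ℕ) :
    (s.storeR a i v).rmem a' j = if a' = a ∧ j = i then v else s.rmem a' j := by
  simp only [State.storeR, Function.update_apply]
  split_ifs <;> simp_all

/-- The invariant is demanded after the counter has been advanced, which suits invariants that do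
not mention `x`. The bound `e` is evaluated anew in every round, so `he` requires it to be stable,
and `m ≤ W` keeps the counter in a word. -/
theorem Run.for {x : ℕ} {e : IExpr} (Inv : ℕ → State → Prop) (m : ℕ) (hm : m ≤ W)
    (h0 : Inv 0 (s.setI x 0))
    (hstep : ∀ i < m, ∀ s, s.ivar x = i → Inv i s →
      Run W p s T fun s' => s'.ivar x = i ∧ Inv (i + 1) (s'.setI x (i + 1)))
    (he : ∀ i ≤ m, ∀ s, s.ivar x = i → Inv i s → e.eval s = m) :
    Run W (forLoop x e p) s (m * (T + e.cost + 8) + e.cost + 6)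
      (fun s' => s'.ivar x = m ∧ Inv m s') := by
  have key := Run.seq' (Run.setI (W := W) (s := s) (x := x) (e := .const 0)
      (Q := fun s' => s'.ivar x = 0 ∧ Inv 0 s') (by simp [IExpr.eval])
      (by simpa [IExpr.eval] using h0)) fun s₁ h₁ =>
    Run.loop (W := W) (b := .not (.ile e (.var x)))
      (p := .seq p (.setI x (.add (.var x) (.const 1)))) (T := T + 4)
      (fun i s => s.ivar x = i ∧ Inv i s) m h₁
      (fun i hi s hs => ⟨by
        simp only [Test.Holds, he i hi.le s hs.1 hs.2, IExpr.eval, hs.1]; omega,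
        Run.seq' (hstep i hi s hs.1 hs.2) fun s' hs' =>
          (Run.setI (by simp only [IExpr.eval, hs'.1]; omega)
            (by simpa [IExpr.eval, hs'.1] using hs'.2))⟩)
      (fun s hs => by simp [Test.Holds, he m le_rfl s hs.1 hs.2, IExpr.eval, hs.1])
  refine key.mono ?_ fun _ h => h
  simp only [Test.cost, IExpr.cost]
  have : m * (T + 4 + (e.cost + 1 + 1 + 1) + 1) = m * (T + e.cost + 8) := by ring
  omega

/-- The integer variables below `k` and the integer arrays outside `A` are the same. -/
def Same (k : ℕ) (A : Set ℕ) (s s' : State) : Prop :=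
  (∀ x < k, s'.ivar x = s.ivar x) ∧ ∀ a ∉ A, s'.imem a = s.imem a

theorem Same.refl (k : ℕ) (A : Set ℕ) (s : State) : Same k A s s :=
  ⟨fun _ _ => rfl, fun _ _ => rfl⟩

/-- The frame rule. Variables are numbered so that inner programs use higher numbers than the
programs calling them; the side conditions are then numerical and are discharged by the default
arguments. -/
theorem Same.trans {k k' k'' : ℕ} {A A' A'' : Set ℕ} {s s' s'' : State} (h : Same k A s s')
    (h' : Same k' A' s' s'') (hk : k'' ≤ k := by omega) (hk' : k'' ≤ k' := by omega)
    (hA : A ⊆ A'' := by simp) (hA' : A' ⊆ A'' := by simp) :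
    Same k'' A'' s s'' :=
  ⟨fun x hx => (h'.1 x (by omega)).trans (h.1 x (by omega)),
    fun a ha => (h'.2 a fun h => ha (hA' h)).trans (h.2 a fun h => ha (hA h))⟩

theorem Same.mono {k k' : ℕ} {A A' : Set ℕ} {s s' : State} (h : Same k A s s')
    (hk : k' ≤ k := by omega) (hA : A ⊆ A' := by simp) : Same k' A' s s' :=
  ⟨fun x hx => h.1 x (by omega), fun a ha => h.2 a fun h => ha (hA h)⟩

theorem Same.setI {k x v : ℕ} {s : State} (h : k ≤ x := by omega) {A : Set ℕ} :
    Same k A s (s.setI x v) :=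
  ⟨fun y hy => by simp [show y ≠ x by omega], fun _ _ => rfl⟩

theorem Same.then_setI {k x v : ℕ} {A : Set ℕ} {s s' : State} (hs : Same k A s s')
    (h : k ≤ x := by omega) : Same k A s (s'.setI x v) :=
  ⟨fun y hy => by simp [show y ≠ x by omega, hs.1 y hy], hs.2⟩

theorem Same.then_storeI {k a i v : ℕ} {A : Set ℕ} {s s' : State} (hs : Same k A s s')
    (h : a ∈ A := by simp) : Same k A s (s'.storeI a i v) :=
  ⟨hs.1, fun b hb => by
    rw [imem_storeI, if_neg (by rintro rfl; exact hb h)]; exact hs.2 b hb⟩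

theorem Same.comp {k : ℕ} {A : Set ℕ} {s s' s'' : State} (h : Same k A s s')
    (h' : Same k A s' s'') : Same k A s s'' := h.trans h' le_rfl le_rfl subset_rfl subset_rfl

/-- The programs `f a` for `a` in `l`, one after the other. -/
def seqList {α : Type*} (f : α → Program) : List α → Program
  | [] => .skip
  | a :: l => .seq (f a) (seqList f l)

theorem Run.seqList {α : Type*} {f : α → Program} (l : List α) (Inv : List α → State → Prop)
    (h0 : Inv [] s)
    (hstep : ∀ l' a l'', l' ++ a :: l'' = l → ∀ s, Inv l' s →
      Run W (f a) s T (Inv (l' ++ [a]))) :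
    Run W (seqList f l) s (l.length * T + 1) (Inv l) := by
  suffices H : ∀ (l₁ l₂ : List α) s, l₁ ++ l₂ = l → Inv l₁ s →
      Run W (ThreeCover.seqList f l₂) s (l₂.length * T + 1) (Inv l) from H [] l s rfl h0
  intro l₁ l₂
  induction l₂ generalizing l₁ with
  | nil => intro s hl hs; simp at hl; subst hl; exact Run.mono (Run.skip hs) (by simp) fun _ h => h
  | cons a l₂ ih =>
    intro s hl hs
    refine Run.mono (Run.seq' (hstep l₁ a l₂ hl s hs) fun s₁ h₁ =>
      ih (l₁ ++ [a]) s₁ (by simp [← hl]) h₁) ?_ fun _ h => h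
    rw [List.length_cons, Nat.succ_mul]; omega

end ThreeCover

namespace ThreeCover
open RealRAM

/-! ### Points and rectangles in rank space -/

/-- The opposite of a direction (right, left, top, bottom). -/
def opp : Fin 4 → Fin 4 := ![1, 0, 3, 2]

/-- `pos d p` tells how far the point `p` is in the direction `d`, and `ext d r` how far the
rectangle `r` extends in that direction. -/
structure Ranks (n M : ℕ) (pos ext : Fin 4 → ℕ → ℕ) : Prop where
  pos_pos : ∀ d, ∀ i < n, 0 < pos d i
  pos_lt : ∀ d, ∀ i < n, pos d i < M
  ext_pos : ∀ d, ∀ i < n, 0 < ext d i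
  ext_lt : ∀ d, ∀ i < n, ext d i < M
  opp_add : ∀ d, ∀ i < n, pos d i + pos (opp d) i = M
  ne : ∀ d, ∀ i < n, ∀ j < n, pos d i ≠ ext d j
  inj : ∀ d, ∀ i < n, ∀ j < n, ext d i = ext d j → i = j

section Cover
variable (n : ℕ) (pos ext : Fin 4 → ℕ → ℕ)

/-- The point `p` lies in the rectangle `r`. -/
def In (p r : ℕ) : Prop := ∀ d, pos d p < ext d r

/-- The three rectangles cover all points. -/
def Cover (a b c : ℕ) : Prop := ∀ p < n, In pos ext p a ∨ In pos ext p b ∨ In pos ext p c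

/-- The two rectangles can be completed to a cover by a third one. -/
def Extendable (a b : ℕ) : Prop := ∃ c < n, Cover n pos ext a b c

/-- All points that `y` does not fall short of in the direction `h` are in `y` or `x`. -/
def Prefix (h : Fin 4) (x y : ℕ) : Prop :=
  ∀ p < n, pos h p < ext h y → In pos ext p y ∨ In pos ext p x

/-- No point is further in the direction `d` than `r`. -/
def Touches (d : Fin 4) (r : ℕ) : Prop := ∀ p < n, pos d p < ext d r

/-- All pairs of rectangles that the algorithm considers fail to be extendable. -/
structure NoCandidate (g : ℕ) : Prop where
  sweep : ∀ h, ∀ x < n, ∀ y < n, Prefix n pos ext h x y →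
    ∃ y', Prefix n pos ext h x y' ∧ ext h y ≤ ext h y' ∧ ¬ Extendable n pos ext y' x
  coarse : ∀ f₁ f₂ g₁ g₂ : Fin 4, [f₁, f₂, g₁, g₂].Nodup → ∀ a < n,
    Touches n pos ext g₁ a → Touches n pos ext g₂ a → ∃ a' < n, Touches n pos ext g₁ a' ∧
      Touches n pos ext g₂ a' ∧ ext f₁ a / g ≤ ext f₁ a' / g ∧ ext f₂ a / g ≤ ext f₂ a' / g ∧
      ∀ b < n, ¬ Extendable n pos ext a' b
  slab : ∀ f d, ∀ a < n, ∀ b < n, ∀ q < n, ext d b < pos d q →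
    (∀ q' < n, ext d b < pos d q' → pos f q' ≤ pos f q) → ext f a / g = pos f q / g →
    ¬ Extendable n pos ext a b
end Cover

variable {n M g : ℕ} {pos ext : Fin 4 → ℕ → ℕ}

/-! ### A cover makes some candidate pair extendable -/

theorem Cover.swap {a b c : ℕ} (h : Cover n pos ext a b c) : Cover n pos ext a c b :=
  fun p hp => (h p hp).imp_right Or.symm

theorem Cover.rotate {a b c : ℕ} (h : Cover n pos ext a b c) : Cover n pos ext b c a :=
  fun p hp => by have := h p hp; tauto

theorem Ranks.not_in (R : Ranks n M pos ext) {p r : ℕ} (hp : p < n) (hr : r < n) :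
    ¬ In pos ext p r ↔ ∃ d, ext d r < pos d p := by
  simp only [In, not_forall, not_lt]
  exact exists_congr fun d => ⟨fun h => lt_of_le_of_ne h (R.ne d p hp r hr).symm, le_of_lt⟩

theorem Ranks.opp_lt (R : Ranks n M pos ext) {d : Fin 4} {p q : ℕ} (hp : p < n) (hq : q < n)
    (h : pos d p < pos d q) : pos (opp d) q < pos (opp d) p := by
  have := R.opp_add d p hp; have := R.opp_add d q hq; omega

theorem exists_argmax {P : ℕ → Prop} (f : ℕ → ℕ) {p : ℕ} (hp : p < n) (h : P p) :
    ∃ q < n, P q ∧ ∀ q' < n, P q' → f q' ≤ f q := by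
  classical
  obtain ⟨q, hq, hmax⟩ := ((Finset.range n).filter P).exists_max_image f ⟨p, by simp [hp, h]⟩
  simp only [Finset.mem_filter, Finset.mem_range] at hq hmax
  exact ⟨q, hq.1, hq.2, fun q' h1 h2 => hmax q' ⟨h1, h2⟩⟩

/-- Any rectangle of a cover contains a point of its own on the near side of any other one. -/
theorem NoCandidate.exists_own (N : NoCandidate n pos ext g)
    {x y z : ℕ} (hx : x < n) (hy : y < n) (hz : z < n) (hc : Cover n pos ext y x z) (h : Fin 4) :
    ∃ p < n, pos h p < ext h y ∧ ¬ In pos ext p y ∧ ¬ In pos ext p x ∧ In pos ext p z := by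
  -- Without such a point `y` meets the sweep condition. Then `y'` can replace `y`: a point that is
  -- not on the near side of `y'` is not in `y` either, so it is in `x` or `z`.
  by_contra! hcon
  obtain ⟨y', hp, hle, hne⟩ := N.sweep h x hx y hy fun p hp hlt => by
    by_contra! hn
    exact hcon p hp hlt hn.1 hn.2 (by have := hc p hp; tauto)
  refine hne ⟨z, hz, fun p hpn => ?_⟩
  by_cases hlt : pos h p < ext h y'
  · have := hp p hpn hlt; tauto
  · have : ¬ In pos ext p y := fun hin => hlt ((hin h).trans_le hle)
    have := hc p hpn; tauto

/-- The directions in which `b` and `c` can miss `p` are narrowed down until one common direction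
remains. In that direction the failed slab pairs produce a point that no rectangle contains. -/
theorem NoCandidate.slab_false (N : NoCandidate n pos ext g) (R : Ranks n M pos ext)
    {a b c : ℕ} (ha : a < n) (hb : b < n) (hc : c < n) (hcov : Cover n pos ext a b c)
    {f₁ f₂ g₁ g₂ : Fin 4} (hd : [f₁, f₂, g₁, g₂].Nodup) (h₁ : Touches n pos ext g₁ a)
    (h₂ : Touches n pos ext g₂ a) {p : ℕ} (hp : p < n) (hpa : In pos ext p a)
    (hpb : ¬ In pos ext p b) (hpc : ¬ In pos ext p c) (hs : pos f₁ p / g = ext f₁ a / g) :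
    False := by
  have cases4 : ∀ d, d = f₁ ∨ d = f₂ ∨ d = g₁ ∨ d = g₂ := by
    revert hd; clear * -; revert f₁ f₂ g₁ g₂; decide
  -- The private point of `x` on the `f'`-near side of `a` can leave `a` only in the direction `f`.
  -- So `x` reaches beyond `a` there, and hence beyond `p`.
  have free : ∀ f f', ((f = f₁ ∧ f' = f₂) ∨ (f = f₂ ∧ f' = f₁)) → ∀ x < n, ∀ y < n,
      Cover n pos ext a x y → ¬ ext f x < pos f p := by
    intro f f' hff x hx y hy hcv hlt
    obtain ⟨z, hz, hz1, hza, hzy, hzx⟩ := N.exists_own hy ha hx hcv.swap f'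
    obtain ⟨d, hd'⟩ := (R.not_in hz ha).1 hza
    have : d = f := by
      rcases cases4 d with rfl | rfl | rfl | rfl
      · rcases hff with ⟨rfl, rfl⟩ | ⟨rfl, rfl⟩
        · rfl
        · omega
      · rcases hff with ⟨rfl, rfl⟩ | ⟨rfl, rfl⟩
        · omega
        · rfl
      · have := h₁ z hz; omega
      · have := h₂ z hz; omega
    subst this
    have := hzx d; have := hpa d; omega
  -- The `f₁`-farthest point beyond `x` is at least as far as `p`, so its slab is not below that of
  -- `a`. Equality would make `a`, `x` a slab pair, which `y` completes; hence the point is strictly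
  -- beyond `a`.
  have key : ∀ d, ∀ x < n, ∀ y < n, Cover n pos ext a x y → ext d x < pos d p →
      ∃ q < n, ext f₁ a < pos f₁ q ∧ ext d x < pos d q := by
    intro d x hx y hy hcv hlt
    obtain ⟨q, hq, hq1, hq2⟩ := exists_argmax (P := fun q => ext d x < pos d q) (pos f₁) hp hlt
    refine ⟨q, hq, ?_, hq1⟩
    have h3 : ext f₁ a / g ≠ pos f₁ q / g :=
      fun h => N.slab f₁ d a ha x hx q hq hq1 hq2 h ⟨y, hy, hcv⟩
    by_contra! hle
    exact h3 (le_antisymm (hs ▸ Nat.div_le_div_right (hq2 p hp hlt)) (Nat.div_le_div_right hle))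
  -- The point from `key` would be beyond `a` in the direction `f₁`, hence farther than the private
  -- point of `x` on the near side of `a`. In the opposite direction it is then within the reach of
  -- `x`.
  have notopp : ∀ x < n, ∀ y < n, Cover n pos ext a x y →
      ¬ ext (opp f₁) x < pos (opp f₁) p := by
    intro x hx y hy hcv hlt
    obtain ⟨q, hq, hq1, hq2⟩ := key _ x hx y hy hcv hlt
    obtain ⟨z, hz, hz1, hza, hzy, hzx⟩ := N.exists_own hy ha hx hcv.swap f₁
    have := R.opp_lt hz hq (hz1.trans hq1)
    have := hzx (opp f₁); omega
  obtain ⟨d, hdb⟩ := (R.not_in hp hb).1 hpb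
  obtain ⟨e, hec⟩ := (R.not_in hp hc).1 hpc
  have hd1 : d ≠ f₁ := by rintro rfl; exact free _ _ (.inl ⟨rfl, rfl⟩) b hb c hc hcov hdb
  have hd2 : d ≠ f₂ := by rintro rfl; exact free _ _ (.inr ⟨rfl, rfl⟩) b hb c hc hcov hdb
  have he1 : e ≠ f₁ := by rintro rfl; exact free _ _ (.inl ⟨rfl, rfl⟩) c hc b hb hcov.swap hec
  have he2 : e ≠ f₂ := by rintro rfl; exact free _ _ (.inr ⟨rfl, rfl⟩) c hc b hb hcov.swap hec
  have hd3 : d ≠ opp f₁ := by rintro rfl; exact notopp b hb c hc hcov hdb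
  have he3 : e ≠ opp f₁ := by rintro rfl; exact notopp c hc b hb hcov.swap hec
  -- The private point of `b` on the near side of `c` would have to be on both sides of `p`.
  have hde : e ≠ opp d := by
    rintro rfl
    obtain ⟨z, hz, hz1, _, _, hzb⟩ := N.exists_own ha hc hb hcov.rotate.rotate (opp d)
    have := R.opp_lt hz hp ((hzb d).trans hdb)
    omega
  -- If `f₂` is opposite to `f₁`, the two remaining directions are opposite to each other and `hde`
  -- applies; otherwise only one direction remains.
  have : d = e := by
    revert hd hd1 hd2 he1 he2 hd3 he3 hde; clear * -; revert f₁ f₂ g₁ g₂ d e; decide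
  subst this
  obtain ⟨q, hq, hq1, hq2⟩ := key _ b hb c hc hcov hdb
  obtain ⟨q', hq', hq1', hq2'⟩ := key _ c hc b hb hcov.swap hec
  -- This point is outside `a` because of `f₁`. It is at least as far as `q` and `q'` in the
  -- direction `d`, hence outside `b` and `c`.
  obtain ⟨z, hz, hz1, hz2⟩ := exists_argmax (P := fun q => ext f₁ a < pos f₁ q) (pos d) hq hq1
  have := hz2 q hq hq1
  have := hz2 q' hq' hq1'
  rcases hcov z hz with h | h | h
  · have := h f₁; omega
  · have := h d; omega
  · have := h d; omega

/-- A point lost by passing from `a` to its representative `a'` lies between their sides in a free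
direction. As `a'` reaches the slab of `a` there, the point is in the slab of the side of `a`, which
`NoCandidate.slab_false` excludes. -/
theorem NoCandidate.touching_false (N : NoCandidate n pos ext g) (R : Ranks n M pos ext)
    {a b c : ℕ} (ha : a < n) (hb : b < n) (hc : c < n) (hcov : Cover n pos ext a b c)
    {f₁ f₂ g₁ g₂ : Fin 4} (hd : [f₁, f₂, g₁, g₂].Nodup) (h₁ : Touches n pos ext g₁ a)
    (h₂ : Touches n pos ext g₂ a) : False := by
  obtain ⟨a', ha', t₁, t₂, s₁, s₂, hne⟩ := N.coarse f₁ f₂ g₁ g₂ hd a ha h₁ h₂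
  have : ¬ Cover n pos ext a' b c := fun h => hne b hb ⟨c, hc, h⟩
  simp only [Cover, not_forall, not_or] at this
  obtain ⟨p, hp, hpa', hpb, hpc⟩ := this
  have hpa : In pos ext p a := by have := hcov p hp; tauto
  obtain ⟨d, hd'⟩ := (R.not_in hp ha').1 hpa'
  have cases4 : d = f₁ ∨ d = f₂ ∨ d = g₁ ∨ d = g₂ := by
    revert hd; clear * -; revert d f₁ f₂ g₁ g₂; decide
  rcases cases4 with rfl | rfl | rfl | rfl
  · exact N.slab_false R ha hb hc hcov hd h₁ h₂ hp hpa hpb hpc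
      (le_antisymm (Nat.div_le_div_right (hpa _).le) (s₁.trans (Nat.div_le_div_right hd'.le)))
  · refine N.slab_false R ha hb hc hcov (f₂ := f₁) ?_ h₁ h₂ hp hpa hpb hpc
      (le_antisymm (Nat.div_le_div_right (hpa _).le) (s₂.trans (Nat.div_le_div_right hd'.le)))
    revert hd; clear * -; revert d f₁ g₁ g₂; decide
  · have := t₁ p hp; omega
  · have := t₂ p hp; omega

/-- If no candidate pair is extendable, then there is no cover by three rectangles. -/
theorem NoCandidate.not_cover (N : NoCandidate n pos ext g) (R : Ranks n M pos ext)
    {a b c : ℕ} (ha : a < n) (hb : b < n) (hc : c < n) : ¬ Cover n pos ext a b c := by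
  intro hcov
  have touch : ∀ d, ∃ i : Fin 3, Touches n pos ext d (![a, b, c] i) := by
    intro d
    obtain ⟨q, hq, -, hmax⟩ := exists_argmax (P := fun _ => True) (pos d) ha trivial
    rcases hcov q hq with h | h | h
    · exact ⟨0, fun p hp => (hmax p hp trivial).trans_lt (h d)⟩
    · exact ⟨1, fun p hp => (hmax p hp trivial).trans_lt (h d)⟩
    · exact ⟨2, fun p hp => (hmax p hp trivial).trans_lt (h d)⟩
  choose t ht using touch
  -- Pigeonhole: four sides of the bounding box, three rectangles.
  obtain ⟨d, d', hne, heq⟩ := Fintype.exists_ne_map_eq_of_card_lt t (by decide)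
  obtain ⟨f₁, f₂, hf⟩ : ∃ f₁ f₂, [f₁, f₂, d, d'].Nodup := by
    revert hne; clear * -; revert d d'; decide
  have h₁ := ht d
  have h₂ := ht d'
  rw [← heq] at h₂
  revert h₁ h₂
  generalize t d = i
  fin_cases i
  · exact fun h₁ h₂ => N.touching_false R ha hb hc hcov hf h₁ h₂
  · exact fun h₁ h₂ => N.touching_false R hb hc ha hcov.rotate hf h₁ h₂
  · exact fun h₁ h₂ => N.touching_false R hc ha hb hcov.rotate.rotate hf h₁ h₂

end ThreeCover

namespace ThreeCover
open RealRAM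

/-! ### Four-dimensional dominance tables -/

/-- The address of the cell for the level tuple number `c` and the node tuple `v`. -/
def addr (S c : ℕ) (v : Fin 4 → ℕ) : ℕ := (((c * S + v 0) * S + v 1) * S + v 2) * S + v 3

theorem mul_add_inj {S a b a' b' : ℕ} (hb : b < S) (hb' : b' < S)
    (h : a * S + b = a' * S + b') : a = a' ∧ b = b' := by
  have h1 : (a * S + b) / S = a := by
    rw [mul_comm, Nat.mul_add_div (by omega), Nat.div_eq_of_lt hb, add_zero]
  have h2 : (a' * S + b') / S = a' := by
    rw [mul_comm, Nat.mul_add_div (by omega), Nat.div_eq_of_lt hb', add_zero]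
  have : a = a' := by rw [← h1, ← h2, h]
  subst this
  exact ⟨rfl, by omega⟩

/-- The node numbers are digits in base `S`, so different cells never collide. -/
theorem addr_inj {S c c' : ℕ} {v v' : Fin 4 → ℕ} (hv : ∀ i, v i < S) (hv' : ∀ i, v' i < S) :
    addr S c v = addr S c' v' ↔ c' = c ∧ v' = v := by
  refine ⟨fun h => ?_, by rintro ⟨rfl, rfl⟩; rfl⟩
  obtain ⟨h, h3⟩ := mul_add_inj (hv 3) (hv' 3) h
  obtain ⟨h, h2⟩ := mul_add_inj (hv 2) (hv' 2) h
  obtain ⟨h, h1⟩ := mul_add_inj (hv 1) (hv' 1) h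
  obtain ⟨h, h0⟩ := mul_add_inj (hv 0) (hv' 0) h
  exact ⟨h.symm, by funext i; fin_cases i <;> simp_all⟩

/-- The level in coordinate `i` of the level tuple number `c`. -/
def level (L c : ℕ) (i : Fin 4) : ℕ := c / L ^ (i : ℕ) % L

/-- The dyadic nodes that contain the keys `k`, on the levels of the tuple number `c`. -/
def node (L : ℕ) (k : Fin 4 → ℕ) (c : ℕ) (i : Fin 4) : ℕ := k i / 2 ^ level L c i

theorem node_le (L : ℕ) (k : Fin 4 → ℕ) (c : ℕ) (i : Fin 4) : node L k c i ≤ k i :=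
  Nat.div_le_self _ _

/-- The levels are the base `L` digits of `c`, so a single loop over `c < L ^ 4` visits every tuple
of levels. -/
theorem exists_levels {L : ℕ} (l : Fin 4 → ℕ) (hl : ∀ i, l i < L) :
    ∃ c < L ^ 4, ∀ i, level L c i = l i := by
  have h0 := hl 0
  have h1 := hl 1
  have h2 := hl 2
  have h3 := hl 3
  have hL : 0 < L := by omega
  have e1 : (l 0 + L * (l 1 + L * (l 2 + L * l 3))) / L = l 1 + L * (l 2 + L * l 3) := by
    rw [Nat.add_mul_div_left _ _ hL, Nat.div_eq_of_lt h0, zero_add]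
  have e2 : (l 1 + L * (l 2 + L * l 3)) / L = l 2 + L * l 3 := by
    rw [Nat.add_mul_div_left _ _ hL, Nat.div_eq_of_lt h1, zero_add]
  have e3 : (l 2 + L * l 3) / L = l 3 := by
    rw [Nat.add_mul_div_left _ _ hL, Nat.div_eq_of_lt h2, zero_add]
  refine ⟨l 0 + L * (l 1 + L * (l 2 + L * l 3)), ?_, fun i => ?_⟩
  · have a1 : l 2 + L * l 3 < L * L := by nlinarith
    have a2 : l 1 + L * (l 2 + L * l 3) < L * (L * L) := by nlinarith
    have : L ^ 4 = L * (L * (L * L)) := by ring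
    nlinarith
  · unfold level
    fin_cases i
    · simp [Nat.mod_eq_of_lt h0]
    · simp [e1, Nat.mod_eq_of_lt h1]
    · simp [pow_succ, ← Nat.div_div_eq_div_mul, e1, e2, Nat.mod_eq_of_lt h2]
    · simp [pow_succ, ← Nat.div_div_eq_div_mul, e1, e2, e3, Nat.mod_eq_of_lt h3]

theorem lt_of_div_eq {q k m : ℕ} (h : k / m = q / m + 1) : q < k := by
  by_contra! hle
  have := Nat.div_le_div_right (c := m) hle
  omega

/-- Halve both numbers as long as the halves differ. When the next halving would make them equal,
they are consecutive. -/
theorem exists_div_eq : ∀ {L q k : ℕ}, q < k → k < 2 ^ L →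
    ∃ l < L, k / 2 ^ l = q / 2 ^ l + 1 := by
  intro L
  induction L with
  | zero => intro q k h1 h2; simp at h2; omega
  | succ L ih =>
    intro q k h1 h2
    rcases Nat.lt_or_ge (q / 2) (k / 2) with h | h
    · obtain ⟨l, hl, he⟩ := ih h (by rw [pow_succ] at h2; omega)
      refine ⟨l + 1, by omega, ?_⟩
      rwa [Nat.div_div_eq_div_mul, Nat.div_div_eq_div_mul, ← pow_succ'] at he
    · exact ⟨0, by omega, by simp; omega⟩

/-- `res` is the largest value `val j` for `j < m` with `P j`, or `0` if there is none. -/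
def IsMax (m : ℕ) (P : ℕ → Prop) (val : ℕ → ℕ) (res : ℕ) : Prop :=
  (∀ j < m, P j → val j ≤ res) ∧ (res = 0 ∨ ∃ j < m, P j ∧ val j = res)

/-- The table `t` contains the first `m` items of the family with keys `key` and values `val`. -/
structure Tab (L S m : ℕ) (key : ℕ → Fin 4 → ℕ) (val : ℕ → ℕ) (t : ℕ → ℕ) : Prop where
  lower : ∀ j < m, ∀ c < L ^ 4, val j ≤ t (addr S c (node L (key j) c))
  upper : ∀ c < L ^ 4, ∀ v : Fin 4 → ℕ, (∀ i, v i < S) →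
    t (addr S c v) = 0 ∨ ∃ j < m, val j = t (addr S c v) ∧ v = node L (key j) c

theorem Tab.zero (L S : ℕ) (key : ℕ → Fin 4 → ℕ) (val : ℕ → ℕ) :
    Tab L S 0 key val (fun _ => 0) := ⟨by simp, by simp⟩

theorem Tab.succ {L S m : ℕ} {key : ℕ → Fin 4 → ℕ} {val : ℕ → ℕ} {t t' : ℕ → ℕ}
    (h : Tab L S m key val t) (hk : ∀ j ≤ m, ∀ i, key j i < S)
    (ht : ∀ c < L ^ 4, ∀ v : Fin 4 → ℕ, (∀ i, v i < S) → t' (addr S c v) =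
      if v = node L (key m) c then max (t (addr S c v)) (val m) else t (addr S c v)) :
    Tab L S (m + 1) key val t' := by
  constructor
  · intro j hj c hc
    rw [ht c hc _ fun i => (node_le _ _ _ _).trans_lt (hk j (by omega) i)]
    rcases Nat.lt_succ_iff_lt_or_eq.1 hj with hj | rfl
    · have := h.lower j hj c hc
      split_ifs
      · exact le_max_of_le_left this
      · exact this
    · rw [if_pos rfl]; exact le_max_right _ _
  · intro c hc v hv
    rw [ht c hc v hv]
    split_ifs with heq
    · rcases le_total (t (addr S c v)) (val m) with hle | hle
      · rw [max_eq_right hle]; exact .inr ⟨m, by omega, rfl, heq⟩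
      · rw [max_eq_left hle]
        exact (h.upper c hc v hv).imp_right fun ⟨j, hj, h1⟩ => ⟨j, by omega, h1⟩
    · exact (h.upper c hc v hv).imp_right fun ⟨j, hj, h1⟩ => ⟨j, by omega, h1⟩

/-- Choosing a level for each coordinate by `exists_div_eq` shows that every dominating item is seen
in some cell, and `lt_of_div_eq` shows that nothing else is. An item may be seen on several levels,
which does not affect a maximum. -/
theorem Tab.isMax {L S m : ℕ} {key : ℕ → Fin 4 → ℕ} {val : ℕ → ℕ} {t : ℕ → ℕ}
    (h : Tab L S m key val t) (hk : ∀ j < m, ∀ i, key j i < 2 ^ L) {q : Fin 4 → ℕ}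
    (hq : ∀ i, q i + 1 < S) {res : ℕ}
    (hres : IsMax (L ^ 4) (fun _ => True)
      (fun c => t (addr S c fun i => node L q c i + 1)) res) :
    IsMax m (fun j => ∀ i, q i < key j i) val res := by
  constructor
  · intro j hj hlt
    choose l hl he using fun i => exists_div_eq (hlt i) (hk j hj i)
    obtain ⟨c, hc, hlev⟩ := exists_levels l hl
    refine (h.lower j hj c hc).trans ?_
    have : node L (key j) c = fun i => node L q c i + 1 := by
      funext i; simp only [node, hlev, he]
    rw [this]
    exact hres.1 c hc trivial
  · rcases hres.2 with h0 | ⟨c, hc, -, he⟩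
    · exact .inl h0
    rcases h.upper c hc _ fun i => (Nat.succ_le_succ (node_le L q c i)).trans_lt (hq i) with h0 | h0
    · exact .inl (he.symm.trans h0)
    · obtain ⟨j, hj, hv, hn⟩ := h0
      exact .inr ⟨j, hj, fun i => lt_of_div_eq (congrFun hn i).symm, hv.trans he⟩

/-! ### The table programs -/

/-- The sizes that occur, on a machine with integers up to `W`. -/
structure Sizes (W n L g : ℕ) : Prop where
  n_pos : 0 < n
  lt_pow : 3 * n + 1 < 2 ^ L
  L_le : L ≤ 3 * n + 1
  g_pos : 0 < g
  g_le : g ≤ n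
  le_W : (3 * n + 3) ^ 5 ≤ W

theorem Sizes.L_pos {W n L g : ℕ} (z : Sizes W n L g) : 0 < L := by
  rcases Nat.eq_zero_or_pos L with rfl | h
  · have := z.lt_pow; simp at this
  · exact h

theorem Sizes.pow_le_W {W n L g : ℕ} (z : Sizes W n L g) {j : ℕ} (hj : j ≤ 5) :
    (3 * n + 3) ^ j ≤ W := (Nat.pow_le_pow_right (by omega) hj).trans z.le_W

theorem Sizes.L4_le {W n L g : ℕ} (z : Sizes W n L g) : L ^ 4 ≤ W :=
  (Nat.pow_le_pow_left (z.L_le.trans (by omega)) 4).trans (z.pow_le_W (by omega))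

theorem Sizes.S_le {W n L g : ℕ} (z : Sizes W n L g) : 3 * n + 3 ≤ W := by
  simpa using z.pow_le_W (j := 1) (by omega)

/-- The variables and arrays that are computed once. -/
structure Consts (n L g : ℕ) (s : State) : Prop where
  v4 : s.ivar 4 = n
  v5 : s.ivar 5 = 3 * n + 1
  v6 : s.ivar 6 = L
  v7 : s.ivar 7 = L ^ 4
  v8 : s.ivar 8 = 3 * n + 3
  v9 : s.ivar 9 = g
  v10 : s.ivar 10 = 3 * n / g + 1
  pw : ∀ l < L, s.imem 22 l = 2 ^ l

theorem Consts.same {n L g k : ℕ} {A : Set ℕ} {s s' : State} (h : Consts n L g s)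
    (hs : Same k A s s') (hk : 11 ≤ k := by omega) (hA : 22 ∉ A := by simp) :
    Consts n L g s' := by
  constructor
  · rw [hs.1 _ (by omega), h.v4]
  · rw [hs.1 _ (by omega), h.v5]
  · rw [hs.1 _ (by omega), h.v6]
  · rw [hs.1 _ (by omega), h.v7]
  · rw [hs.1 _ (by omega), h.v8]
  · rw [hs.1 _ (by omega), h.v9]
  · rw [hs.1 _ (by omega), h.v10]
  · rw [hs.2 _ hA]; exact h.pw

/-- `L ^ j` as an expression. -/
def powE : ℕ → IExpr
  | 0 => .const 1
  | j + 1 => .mul (powE j) (.var 6)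

theorem eval_powE (s : State) (j : ℕ) : (powE j).eval s = s.ivar 6 ^ j := by
  induction j with
  | zero => rfl
  | succ j ih => simp [powE, IExpr.eval, ih, pow_succ]

/-- The node in coordinate `i` for the key in variable `40 + i` and the tuple number in `45`. -/
def nodeE (i : ℕ) : IExpr :=
  .div (.var (40 + i)) (.load 22 (.mod (.div (.var 45) (powE i)) (.var 6)))

/-- The address for given node expressions. -/
def addrE (v : ℕ → IExpr) : IExpr :=
  .add (.mul (.add (.mul (.add (.mul (.add (.mul (.var 45) (.var 8)) (v 0)) (.var 8)) (v 1))
    (.var 8)) (v 2)) (.var 8)) (v 3)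

/-- The keys in the variables `40, …, 43`. -/
def keys (s : State) (i : Fin 4) : ℕ := s.ivar (40 + i)

theorem eval_nodeE {n L g : ℕ} {s : State} (h : Consts n L g s) (hL : 0 < L) (i : Fin 4) :
    (nodeE i).eval s = node L (keys s) (s.ivar 45) i := by
  simp only [nodeE, IExpr.eval, eval_powE, h.v6, node, level, keys]
  rw [h.pw _ (Nat.mod_lt _ hL)]

theorem eval_addrE {n L g : ℕ} {s : State} (h : Consts n L g s) (hL : 0 < L) :
    (addrE nodeE).eval s = addr (3 * n + 3) (s.ivar 45) (node L (keys s) (s.ivar 45)) := by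
  have e0 := eval_nodeE h hL 0
  have e1 := eval_nodeE h hL 1
  have e2 := eval_nodeE h hL 2
  have e3 := eval_nodeE h hL 3
  simp only [Fin.val_zero, Fin.val_one, Fin.val_two,
    show ((3 : Fin 4) : ℕ) = 3 from rfl] at e0 e1 e2 e3
  simp only [addrE, IExpr.eval, e0, e1, e2, e3, h.v8, addr]

theorem eval_addrE_succ {n L g : ℕ} {s : State} (h : Consts n L g s) (hL : 0 < L) :
    (addrE fun i => .add (nodeE i) (.const 1)).eval s =
      addr (3 * n + 3) (s.ivar 45) fun i => node L (keys s) (s.ivar 45) i + 1 := by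
  have e0 := eval_nodeE h hL 0
  have e1 := eval_nodeE h hL 1
  have e2 := eval_nodeE h hL 2
  have e3 := eval_nodeE h hL 3
  simp only [Fin.val_zero, Fin.val_one, Fin.val_two,
    show ((3 : Fin 4) : ℕ) = 3 from rfl] at e0 e1 e2 e3
  simp only [addrE, IExpr.eval, e0, e1, e2, e3, h.v8, addr]

/-- Insert the item with keys in `40, …, 43` and value in `44`. -/
def insertP (tbl : ℕ) : Program :=
  forLoop 45 (.var 7) (.cond (.ile (.load tbl (addrE nodeE)) (.var 44))
    (.storeI tbl (addrE nodeE) (.var 44)) .skip)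

/-- The largest value of an item whose keys exceed those in `40, …, 43`, into variable `46`. -/
def queryP (tbl : ℕ) : Program :=
  .seq (.setI 46 (.const 0)) (forLoop 45 (.var 7)
    (.cond (.ile (.load tbl (addrE fun i => .add (nodeE i) (.const 1))) (.var 46)) .skip
      (.setI 46 (.load tbl (addrE fun i => .add (nodeE i) (.const 1))))))

/-- A bound for the time of a table operation. -/
def opT (L : ℕ) : ℕ := L ^ 4 * 200 + 200

theorem keys_same {s s' : State} {A : Set ℕ} (h : Same 45 A s s') : keys s' = keys s := by
  funext i; exact h.1 _ (by omega)

/-- Addresses are only evaluated, never stored, so the word size restricts the stored values alone.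
Cells never written keep the initial `0`, which `Tab` reads as empty. -/
theorem run_insertP {W n L g m tbl : ℕ} (z : Sizes W n L g) {s : State} (hC : Consts n L g s)
    (htbl : 22 ≠ tbl) {key : ℕ → Fin 4 → ℕ} {val : ℕ → ℕ}
    (hT : Tab L (3 * n + 3) m key val (s.imem tbl)) (hk : ∀ j ≤ m, ∀ i, key j i < 3 * n + 3)
    (hkey : keys s = key m) (hval : s.ivar 44 = val m) (hvW : val m ≤ W) :
    Run W (insertP tbl) s (opT L) fun s' => Same 45 {tbl} s s' ∧
      Tab L (3 * n + 3) (m + 1) key val (s'.imem tbl) := by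
  have hlt : ∀ c i, node L (key m) c i < 3 * n + 3 :=
    fun c i => (node_le _ _ _ _).trans_lt (hk m le_rfl i)
  refine Run.mono (Run.for (T := 150) (fun c s' => Same 45 {tbl} s s' ∧
    ∀ c' < L ^ 4, ∀ v : Fin 4 → ℕ, (∀ i, v i < 3 * n + 3) → s'.imem tbl (addr (3 * n + 3) c' v) =
      if c' < c ∧ v = node L (key m) c' then max (s.imem tbl (addr (3 * n + 3) c' v)) (val m)
      else s.imem tbl (addr (3 * n + 3) c' v)) (L ^ 4) z.L4_le ?_ ?_ ?_) ?_ ?_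
  · exact ⟨Same.setI, by simp⟩
  · rintro c hc s' hcs ⟨hs, ht⟩
    have hC' := hC.same hs (by omega) (by simpa using htbl)
    have ha := eval_addrE hC' z.L_pos
    rw [hcs, keys_same hs, hkey] at ha
    have h44 : s'.ivar 44 = val m := (hs.1 _ (by omega)).trans hval
    have hold : s'.imem tbl (addr (3 * n + 3) c (node L (key m) c)) =
        s.imem tbl (addr (3 * n + 3) c (node L (key m) c)) := by
      rw [ht c hc _ (hlt c)]; simp
    refine Run.mono (Run.cond (fun hb => Run.storeI ?_ ?_) fun hb => Run.skip ?_) ?_ fun _ h => h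
    · simpa only [IExpr.eval, h44]
    · simp only [Test.Holds, IExpr.eval, ha, h44, hold] at hb
      simp only [ha, IExpr.eval, h44]
      refine ⟨by simpa using hcs, hs.then_storeI.then_setI, fun c' hc' v hv => ?_⟩
      · simp only [imem_setI, imem_storeI_apply, true_and]
        simp only [addr_inj hv (hlt c)]
        by_cases h : c = c' ∧ node L (key m) c = v
        · obtain ⟨rfl, rfl⟩ := h
          simp [max_eq_right hb]
        · rw [if_neg h, ht c' hc' v hv]
          refine if_congr ⟨fun h' => ⟨by omega, h'.2⟩, fun h' => ⟨?_, h'.2⟩⟩ rfl rfl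
          rcases Nat.lt_succ_iff_lt_or_eq.1 h'.1 with h1 | rfl
          · exact h1
          · exact absurd ⟨rfl, h'.2.symm⟩ h
    · simp only [Test.Holds, IExpr.eval, ha, h44, hold, not_le] at hb
      refine ⟨hcs, hs.then_setI, fun c' hc' v hv => ?_⟩
      simp only [imem_setI]
      rw [ht c' hc' v hv]
      by_cases h : c' = c ∧ v = node L (key m) c'
      · obtain ⟨rfl, rfl⟩ := h
        simp [max_eq_left hb.le]
      · refine if_congr ⟨fun h' => ⟨by omega, h'.2⟩, fun h' => ⟨?_, h'.2⟩⟩ rfl rfl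
        rcases Nat.lt_succ_iff_lt_or_eq.1 h'.1 with h1 | rfl
        · exact h1
        · exact absurd ⟨rfl, h'.2⟩ h
    · simp [Test.cost, IExpr.cost, addrE, nodeE, powE]
  · rintro c _ s' _ ⟨hs, _⟩
    exact (hC.same hs (by omega) (by simpa using htbl)).v7
  · simp only [IExpr.cost, opT]; omega
  · rintro s' ⟨_, hs, ht⟩
    refine ⟨hs, hT.succ hk fun c hc v hv => ?_⟩
    rw [ht c hc v hv]
    simp [hc]

theorem run_queryP {W n L g m tbl : ℕ} (z : Sizes W n L g) {s : State} (hC : Consts n L g s)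
    {key : ℕ → Fin 4 → ℕ} {val : ℕ → ℕ}
    (hT : Tab L (3 * n + 3) m key val (s.imem tbl)) (hk : ∀ j < m, ∀ i, key j i ≤ 3 * n + 1)
    (hvW : ∀ j < m, val j ≤ W) (hq : ∀ i, keys s i ≤ 3 * n + 1) :
    Run W (queryP tbl) s (opT L) fun s' => Same 45 ∅ s s' ∧
      IsMax m (fun j => ∀ i, keys s i < key j i) val (s'.ivar 46) := by
  have hq' : ∀ i, keys s i + 1 < 3 * n + 3 := fun i => by have := hq i; omega
  set T := fun c => s.imem tbl (addr (3 * n + 3) c fun i => node L (keys s) c i + 1) with hTdef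
  -- Every cell is `0` or the value of an item, so copying it to variable `46` stays within a word.
  have hTW : ∀ c < L ^ 4, T c ≤ W := by
    intro c hc
    rcases hT.upper c hc _ fun i => (Nat.succ_le_succ (node_le L (keys s) c i)).trans_lt (hq' i)
      with h0 | ⟨j, hj, hv, -⟩
    · exact h0.le.trans (Nat.zero_le _)
    · exact hv.symm.le.trans (hvW j hj)
  refine Run.mono (Run.seq' (Run.setI (Q := fun s' => Same 45 ∅ s s' ∧ s'.ivar 46 = 0) ?_ ?_)
    fun s₁ h₁ => (Run.for (T := 150) (fun c s' => Same 45 ∅ s s' ∧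
      (∀ c' < c, T c' ≤ s'.ivar 46) ∧ (s'.ivar 46 = 0 ∨ ∃ c' < L ^ 4, T c' = s'.ivar 46))
      (L ^ 4) z.L4_le ?_ ?_ ?_)) ?_ ?_
  · simp [IExpr.eval]
  · exact ⟨Same.setI, by simp [IExpr.eval]⟩
  · exact ⟨h₁.1.then_setI, by simp, by simp [h₁.2]⟩
  · rintro c hc s' hcs ⟨hs, hle, hex⟩
    have ha := eval_addrE_succ (hC.same hs (by omega)) z.L_pos
    rw [hcs, keys_same hs] at ha
    have hl : (IExpr.load tbl (addrE fun i => .add (nodeE i) (.const 1))).eval s' = T c := by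
      simp only [IExpr.eval, ha, hTdef, hs.2 tbl (by simp)]
    refine Run.mono (Run.cond (fun hb => Run.skip ?_) fun hb => Run.setI ?_ ?_) ?_ fun _ h => h
    · simp only [Test.Holds, hl] at hb
      refine ⟨hcs, hs.then_setI, fun c' hc' => ?_, by simpa using hex⟩
      rcases Nat.lt_succ_iff_lt_or_eq.1 hc' with h1 | rfl
      · simpa using hle c' h1
      · simpa [IExpr.eval] using hb
    · rw [hl]; exact hTW c hc
    · rw [hl]
      simp only [Test.Holds, hl] at hb
      simp only [IExpr.eval, not_le] at hb
      refine ⟨by simpa using hcs, hs.then_setI.then_setI,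
        fun c' hc' => ?_, .inr ⟨c, hc, by simp⟩⟩
      rcases Nat.lt_succ_iff_lt_or_eq.1 hc' with h1 | rfl
      · simpa using (hle c' h1).trans hb.le
      · simp
    · simp [Test.cost, IExpr.cost, addrE, nodeE, powE]
  · rintro c _ s' _ ⟨hs, _⟩
    exact (hC.same hs (by omega)).v7
  · simp only [IExpr.cost, opT]; omega
  · rintro s' ⟨_, hs, hle, hex⟩
    exact ⟨hs, hT.isMax (fun j hj i => (hk j hj i).trans_lt z.lt_pow) hq'
      ⟨fun c hc _ => hle c hc, hex.imp_right fun ⟨c, hc, he⟩ => ⟨c, hc, trivial, he⟩⟩⟩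

end ThreeCover

namespace ThreeCover
open RealRAM

/-! ### Bounding boxes of the uncovered points -/

/-- The largest value `val j` for `j < m` with `P j`, or `0`. -/
noncomputable def mx (m : ℕ) (P : ℕ → Prop) (val : ℕ → ℕ) : ℕ := by
  classical exact ((Finset.range m).filter P).sup val

/-- Links what the programs establish, `IsMax`, to a function that can occur inside keys. -/
theorem IsMax.eq_mx {m : ℕ} {P : ℕ → Prop} {val : ℕ → ℕ} {res : ℕ} (h : IsMax m P val res) :
    res = mx m P val := by
  classical
  unfold mx
  refine le_antisymm ?_ (Finset.sup_le fun j hj => h.1 j (by simp_all) (by simp_all))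
  rcases h.2 with rfl | ⟨j, hj, hP, rfl⟩
  · exact Nat.zero_le _
  · exact Finset.le_sup (f := val) (by simp [hj, hP])

/-- The maximum over no items is `0`, hence the condition `0 < t`; for extents it is
`Ranks.ext_pos`. -/
theorem mx_lt {m : ℕ} {P : ℕ → Prop} {val : ℕ → ℕ} {t : ℕ} (ht : 0 < t) :
    mx m P val < t ↔ ∀ j < m, P j → val j < t := by
  classical
  unfold mx
  rw [Finset.sup_lt_iff (by simpa using ht)]
  simp

theorem mx_congr {m : ℕ} {P P' : ℕ → Prop} {val : ℕ → ℕ} (h : ∀ j < m, P j ↔ P' j) :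
    mx m P val = mx m P' val := by
  classical
  unfold mx
  congr 1
  exact Finset.filter_congr fun j hj => h j (by simpa using hj)

/-- Overlaps are harmless for a maximum, so a region may be presented as any union of quadrants. -/
theorem IsMax.union {m : ℕ} {P P' : ℕ → Prop} {val : ℕ → ℕ} {a b : ℕ} (ha : IsMax m P val a)
    (hb : IsMax m P' val b) : IsMax m (fun j => P j ∨ P' j) val (max a b) := by
  refine ⟨fun j hj h => ?_, ?_⟩
  · rcases h with h | h
    · exact le_max_of_le_left (ha.1 j hj h)
    · exact le_max_of_le_right (hb.1 j hj h)
  · rcases le_total a b with h | h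
    · rw [max_eq_right h]
      exact hb.2.imp_right fun ⟨j, hj, h1, h2⟩ => ⟨j, hj, .inr h1, h2⟩
    · rw [max_eq_left h]
      exact ha.2.imp_right fun ⟨j, hj, h1, h2⟩ => ⟨j, hj, .inl h1, h2⟩

theorem IsMax.congr {m : ℕ} {P P' : ℕ → Prop} {val : ℕ → ℕ} {a : ℕ} (h : IsMax m P val a)
    (hP : ∀ j < m, P j ↔ P' j) : IsMax m P' val a :=
  ⟨fun j hj hj' => h.1 j hj ((hP j hj).2 hj'),
    h.2.imp_right fun ⟨j, hj, h1, h2⟩ => ⟨j, hj, (hP j hj).1 h1, h2⟩⟩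

/-- The array with the point table for constraints in the directions `d`, `e` and values in the
direction `f`. -/
def ptTbl (d e f : Fin 4) : ℕ := 100 + (16 * d + 4 * e + f)

/-- The keys of the points in a point table. -/
def ptKey (pos : Fin 4 → ℕ → ℕ) (d e : Fin 4) (j : ℕ) : Fin 4 → ℕ := ![pos d j, pos e j, 1, 1]

/-- The point tables are complete. -/
def PointTabs (n L : ℕ) (pos : Fin 4 → ℕ → ℕ) (s : State) : Prop :=
  ∀ d e f, Tab L (3 * n + 3) n (ptKey pos d e) (pos f) (s.imem (ptTbl d e f))

theorem PointTabs.same {n L k : ℕ} {pos : Fin 4 → ℕ → ℕ} {A : Set ℕ} {s s' : State}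
    (h : PointTabs n L pos s) (hs : Same k A s s') (hA : ∀ a ∈ A, 164 ≤ a := by intro a h; simp at h <;> omega) :
    PointTabs n L pos s' := by
  intro d e f
  rw [hs.2 _ fun ha => by have := hA _ ha; unfold ptTbl at this; omega]
  exact h d e f

/-- A pair of half-plane constraints: two directions and expressions for the thresholds. -/
structure Quad where
  d : Fin 4
  e : Fin 4
  x : IExpr
  y : IExpr

/-- The point `p` exceeds the thresholds of the constraints. -/
def Quad.Beyond (pos : Fin 4 → ℕ → ℕ) (s : State) (c : Quad) (p : ℕ) : Prop :=
  c.x.eval s < pos c.d p ∧ c.y.eval s < pos c.e p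

/-- Update the maximum in variable `34 + f` for one pair of constraints. -/
def quadP (f : Fin 4) (c : Quad) : Program :=
  .seq (.setI 40 c.x) (.seq (.setI 41 c.y) (.seq (.setI 42 (.const 0)) (.seq (.setI 43 (.const 0))
    (.seq (queryP (ptTbl c.d c.e f)) (.cond (.ile (.var 46) (.var (34 + f))) .skip
      (.setI (34 + f) (.var 46)))))))

/-- The maxima in all four directions over the points that satisfy one of the pairs of
constraints, into the variables `34, …, 37`. -/
def bboxP (cs : List Quad) : Program :=
  seqList (fun f : Fin 4 => .seq (.setI (34 + f) (.const 0)) (seqList (quadP f) cs)) [0, 1, 2, 3]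

/-- The thresholds of `c` are meaningful and do not depend on scratch variables. -/
structure Quad.Ok (n : ℕ) (s : State) (c : Quad) : Prop where
  x_cost : c.x.cost ≤ 10
  y_cost : c.y.cost ≤ 10
  x_le : c.x.eval s ≤ 3 * n + 1
  y_le : c.y.eval s ≤ 3 * n + 1
  x_same : ∀ s', Same 34 ∅ s s' → c.x.eval s' = c.x.eval s
  y_same : ∀ s', Same 34 ∅ s s' → c.y.eval s' = c.y.eval s

variable {W n L g : ℕ} {pos ext : Fin 4 → ℕ → ℕ}

theorem run_quadP (z : Sizes W n L g) (R : Ranks n (3 * n + 1) pos ext) {s : State}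
    (hC : Consts n L g s) (hP : PointTabs n L pos s) {c : Quad} (hc : c.Ok n s) {s₁ : State}
    (hs : Same 34 ∅ s s₁) {f : Fin 4} {P : ℕ → Prop} (hm : IsMax n P (pos f) (s₁.ivar (34 + f))) :
    Run W (quadP f c) s₁ (opT L + 50) fun s' => (∀ x : ℕ, x < 40 → x ≠ 34 + (f : ℕ) → s'.ivar x = s₁.ivar x) ∧
      (s'.imem = s₁.imem) ∧ IsMax n (fun p => P p ∨ c.Beyond pos s p) (pos f)
        (s'.ivar (34 + f)) := by
  have hS := z.S_le
  have hposW : ∀ j < n, pos f j ≤ W := fun j hj => by have := R.pos_lt f j hj; omega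
  set s₂ := (((s₁.setI 40 (c.x.eval s)).setI 41 (c.y.eval s)).setI 42 0).setI 43 0 with hs₂
  have hs12 : Same 40 ∅ s₁ s₂ := (((Same.setI).then_setI).then_setI).then_setI
  have hk : keys s₂ = ![c.x.eval s, c.y.eval s, 0, 0] := by
    funext i; fin_cases i <;> simp [keys, hs₂]
  have hs2 : Same 34 ∅ s s₂ := hs.trans hs12
  refine Run.mono (Run.seq (Run.setI ?_ (Run.seq (Run.setI ?_ (Run.seq (Run.setI ?_
    (Run.seq (Run.setI ?_ (Run.seq' (T₁ := opT L) (T₂ := 15)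
      (Q₁ := fun s' => Same 45 ∅ s₂ s' ∧ IsMax n (c.Beyond pos s) (pos f) (s'.ivar 46))
      ?_ fun s' h' => Run.mono (Run.cond (fun hb => Run.skip ?_) fun hb => Run.setI ?_ ?_) ?_
        fun _ h => h)))))))))
    ?_ fun _ h => h
  · rw [hc.x_same _ hs]; have := hc.x_le; omega
  · rw [hc.y_same _ (hs.then_setI)]; have := hc.y_le; omega
  · simp [IExpr.eval]
  · simp [IExpr.eval]
  · simp only [IExpr.eval]
    rw [hc.y_same _ (hs.then_setI), hc.x_same _ hs]
    refine Run.mono (run_queryP z (hC.same hs2) (m := n) (key := ptKey pos c.d c.e) (val := pos f)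
      ?_ ?_ hposW ?_) le_rfl fun s' h' => ⟨h'.1, h'.2.congr fun p hp => ?_⟩
    · exact hP.same hs2 (by simp) c.d c.e f
    · intro j hj i
      have h1 := R.pos_lt c.d j hj
      have h2 := R.pos_lt c.e j hj
      fin_cases i <;> simp [ptKey] <;> omega
    · rw [hk]
      have h1 := hc.x_le
      have h2 := hc.y_le
      intro i; fin_cases i <;> simp <;> omega
    -- The last two key comparisons read `0 < 1`, so the table acts as a two-dimensional one.
    · rw [hk, Fin.forall_fin_succ, Fin.forall_fin_succ, Fin.forall_fin_two]
      simp [ptKey, Quad.Beyond]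
  · have h34 : s'.ivar (34 + f) = s₁.ivar (34 + f) := by
      rw [h'.1.1 _ (by omega), hs12.1 _ (by omega)]
    have := hm.union h'.2
    simp only [Test.Holds, IExpr.eval, h34] at hb
    rw [max_eq_left hb, ← h34] at this
    refine ⟨fun x hx _ => ?_, ?_, this⟩
    · rw [h'.1.1 _ (by omega), hs12.1 _ (by omega)]
    · funext a; rw [h'.1.2 a (by simp), hs12.2 a (by simp)]
  · rcases h'.2.2 with h0 | ⟨j, hj, -, he⟩
    · simp [IExpr.eval, h0]
    · simpa [IExpr.eval, ← he] using hposW j hj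
  · have h34 : s'.ivar (34 + f) = s₁.ivar (34 + f) := by
      rw [h'.1.1 _ (by omega), hs12.1 _ (by omega)]
    have := hm.union h'.2
    simp only [Test.Holds, IExpr.eval, h34, not_le] at hb
    rw [max_eq_right hb.le] at this
    refine ⟨fun x hx hne => ?_, ?_, by simpa [IExpr.eval] using this⟩
    · rw [ivar_setI, if_neg hne, h'.1.1 _ (by omega), hs12.1 _ (by omega)]
    · funext a; rw [imem_setI, h'.1.2 a (by simp), hs12.2 a (by simp)]
  · simp [Test.cost, IExpr.cost]
  · have h1 := hc.x_cost
    have h2 := hc.y_cost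
    simp only [IExpr.cost]; omega

/-- A bound for the time of `bboxP`. -/
def bboxT (L m : ℕ) : ℕ := 4 * (m * (opT L + 50) + 10) + 1

theorem run_bboxP (z : Sizes W n L g) (R : Ranks n (3 * n + 1) pos ext) {s : State}
    (hC : Consts n L g s) (hP : PointTabs n L pos s) {cs : List Quad} (hc : ∀ c ∈ cs, c.Ok n s) :
    Run W (bboxP cs) s (bboxT L cs.length) fun s' => Same 34 ∅ s s' ∧
      ∀ f : Fin 4, s'.ivar (34 + f) = mx n (fun p => ∃ c ∈ cs, c.Beyond pos s p) (pos f) := by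
  refine Run.mono (Run.seqList (T := cs.length * (opT L + 50) + 10) [0, 1, 2, 3]
    (fun l' s' => Same 34 ∅ s s' ∧ ∀ f ∈ l', s'.ivar (34 + (f : Fin 4)) =
      mx n (fun p => ∃ c ∈ cs, c.Beyond pos s p) (pos f)) ⟨Same.refl _ _ _, by simp⟩ ?_) ?_ ?_
  · rintro l f - - s₁ ⟨hs₁, hl⟩
    refine Run.mono (Run.seq' (Run.setI (Q := fun s' => s'.ivar (34 + f) = 0 ∧
      (∀ x < 40, x ≠ 34 + (f : ℕ) → s'.ivar x = s₁.ivar x) ∧ s'.imem = s₁.imem) ?_ ?_)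
      fun s₂ h₂ => Run.seqList (T := opT L + 50) cs (fun l' s' =>
        (∀ x < 40, x ≠ 34 + (f : ℕ) → s'.ivar x = s₁.ivar x) ∧ s'.imem = s₁.imem ∧
        IsMax n (fun p => ∃ c ∈ l', c.Beyond pos s p) (pos f) (s'.ivar (34 + f))) ?_ ?_) ?_ ?_
    · simp [IExpr.eval]
    · exact ⟨by simp [IExpr.eval], fun x _ hx => by simp [hx], rfl⟩
    · exact ⟨h₂.2.1, h₂.2.2, by simp [IsMax, h₂.1]⟩
    · rintro l' c l'' hcl s₃ ⟨ha, hb, hm⟩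
      have : Same 34 ∅ s s₃ := hs₁.comp ⟨fun x hx => ha x (by omega) (by omega), fun a _ => by
        rw [hb]⟩
      refine Run.mono (run_quadP z R hC hP (hc c (by simp [← hcl])) this hm) le_rfl fun s' h' =>
        ⟨fun x hx hne => (h'.1 x hx hne).trans (ha x hx hne), h'.2.1.trans hb,
          h'.2.2.congr fun p hp => ?_⟩
      simp [or_and_right, exists_or]
    · simp only [IExpr.cost]; omega
    · rintro s' ⟨ha, hb, hm⟩
      refine ⟨hs₁.comp ⟨fun x hx => ha x (by omega) (by omega), fun a _ => by rw [hb]⟩, ?_⟩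
      intro f' hf'
      by_cases hff : f' = f
      · subst hff; exact hm.eq_mx
      · rw [ha _ (by omega) (by omega)]
        exact hl f' (by simpa [hff] using hf')
  · simp [bboxT]
  · rintro s' ⟨hs, hl⟩
    exact ⟨hs, fun f => hl f (by fin_cases f <;> simp)⟩

/-! ### Building tables -/

/-- Insert an item for each index `j < n`; `setup` computes its keys and its value. -/
def buildP (tbl : ℕ) (setup : Program) : Program :=
  forLoop 20 (.var 4) (.seq setup (insertP tbl))

theorem run_buildP (z : Sizes W n L g) {s : State} (hC : Consts n L g s) {tbl T : ℕ}
    (htbl : 100 ≤ tbl) (h0 : s.imem tbl = fun _ => 0) {setup : Program}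
    {key : ℕ → Fin 4 → ℕ} {val : ℕ → ℕ} (hk : ∀ j < n, ∀ i, key j i ≤ 3 * n + 1)
    (hv : ∀ j < n, val j ≤ W)
    (hset : ∀ j < n, ∀ s', s'.ivar 20 = j → Same 20 {tbl} s s' → Run W setup s' T fun s'' =>
      Same 21 ∅ s' s'' ∧ keys s'' = key j ∧ s''.ivar 44 = val j) :
    Run W (buildP tbl setup) s (n * (T + opT L + 9) + 7) fun s' => Same 20 {tbl} s s' ∧
      Tab L (3 * n + 3) n key val (s'.imem tbl) := by
  have hS := z.S_le
  have hne : (22 : ℕ) ∉ ({tbl} : Set ℕ) := by simp; omega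
  refine Run.mono (Run.for (T := T + opT L) (fun j s' => Same 20 {tbl} s s' ∧
    Tab L (3 * n + 3) j key val (s'.imem tbl)) n (by omega) ?_ ?_ ?_) ?_ fun s' h => h.2
  · exact ⟨Same.setI, by rw [imem_setI, h0]; exact Tab.zero _ _ _ _⟩
  · rintro j hj s₁ hjs ⟨hs, ht⟩
    refine Run.seq' (hset j hj s₁ hjs hs) fun s₂ ⟨hs₂, hkey, hval⟩ => ?_
    have hs' : Same 20 {tbl} s s₂ := hs.trans hs₂
    refine Run.mono (run_insertP (m := j) z (hC.same hs' (by omega) hne) (by omega)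
      (by rwa [hs₂.2 tbl (by simp)]) (fun i hi k => ?_) hkey hval (hv j hj)) le_rfl
      fun s₃ h₃ => ⟨?_, (hs'.trans h₃.1).then_setI, h₃.2⟩
    · have := hk i (by omega) k; omega
    · rw [h₃.1.1 _ (by omega), hs₂.1 _ (by omega), hjs]
  · rintro j - s₁ - ⟨hs, -⟩
    exact (hC.same hs (by omega) hne).v4
  · simp only [IExpr.cost]; ring_nf; omega

end ThreeCover

namespace ThreeCover
open RealRAM

/-! ### Checking a pair of rectangles -/

/-- Set the key registers and the value register. -/
def setKeys (k : Fin 4 → IExpr) (v : IExpr) : Program :=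
  .seq (.setI 40 (k 0)) (.seq (.setI 41 (k 1)) (.seq (.setI 42 (k 2)) (.seq (.setI 43 (k 3))
    (.setI 44 v))))

variable {W n L g : ℕ} {pos ext : Fin 4 → ℕ → ℕ}

theorem run_setKeys {s : State} {k : Fin 4 → IExpr} {v : IExpr} {K : Fin 4 → ℕ} {V : ℕ}
    (hK : ∀ i, K i ≤ W) (hV : V ≤ W) (hk : ∀ i, ∀ s', Same 40 ∅ s s' → (k i).eval s' = K i)
    (hv : ∀ s', Same 40 ∅ s s' → v.eval s' = V) (hkc : ∀ i, (k i).cost ≤ 12) (hvc : v.cost ≤ 12) :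
    Run W (setKeys k v) s 65 fun s' => Same 40 ∅ s s' ∧ keys s' = K ∧ s'.ivar 44 = V := by
  have a1 : Same 40 ∅ s (s.setI 40 (K 0)) := Same.setI
  have a2 := a1.then_setI (x := 41) (v := K 1)
  have a3 := a2.then_setI (x := 42) (v := K 2)
  have a4 := a3.then_setI (x := 43) (v := K 3)
  have e0 := hk 0 s (Same.refl _ _ _)
  have e1 := hk 1 _ a1
  have e2 := hk 2 _ a2
  have e3 := hk 3 _ a3
  have e4 := hv _ a4
  refine Run.mono (Run.seq (Run.setI ?_ (Run.seq (Run.setI ?_ (Run.seq (Run.setI ?_ (Run.seq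
    (Run.setI ?_ (Run.setI ?_ (Q := fun s' => Same 40 ∅ s s' ∧ keys s' = K ∧ s'.ivar 44 = V)
    ?_))))))))) ?_ fun _ h => h
  · rw [e0]; exact hK 0
  · rw [e0, e1]; exact hK 1
  · rw [e0, e1, e2]; exact hK 2
  · rw [e0, e1, e2, e3]; exact hK 3
  · rw [e0, e1, e2, e3, e4]; exact hV
  · rw [e0, e1, e2, e3, e4]
    refine ⟨a4.then_setI, ?_, by simp⟩
    funext i; fin_cases i <;> simp [keys]
  · have := hkc 0
    have := hkc 1
    have := hkc 2
    have := hkc 3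
    omega

/-- The constants together with the ranks of the points and of the sides of the rectangles. -/
structure Env (n L g : ℕ) (pos ext : Fin 4 → ℕ → ℕ) (s : State) : Prop
    extends Consts n L g s where
  posA : ∀ d : Fin 4, ∀ i < n, s.imem (10 + d) i = pos d i
  extA : ∀ d : Fin 4, ∀ i < n, s.imem (14 + d) i = ext d i
  invA : ∀ d : Fin 4, ∀ i < n, s.imem (18 + d) (ext d i) = i + 1
  inv_le : ∀ d : Fin 4, ∀ k, s.imem (18 + d) k ≤ n

theorem Env.same {k : ℕ} {A : Set ℕ} {s s' : State} (h : Env n L g pos ext s)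
    (hs : Same k A s s') (hk : 11 ≤ k := by omega) (hA : ∀ a ∈ A, 100 ≤ a := by intro a h; simp at h <;> omega) :
    Env n L g pos ext s' := by
  have hA' : ∀ a < 100, s'.imem a = s.imem a := fun a ha => hs.2 a fun h => by
    have := hA a h; omega
  refine ⟨h.toConsts.same hs hk fun h => by have := hA _ h; omega, ?_, ?_, ?_, ?_⟩
  · intro d; rw [hA' _ (by omega)]; exact h.posA d
  · intro d; rw [hA' _ (by omega)]; exact h.extA d
  · intro d; rw [hA' _ (by omega)]; exact h.invA d
  · intro d; rw [hA' _ (by omega)]; exact h.inv_le d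

/-- The keys of the rectangle `y` in the table for sweeps in the direction `h`. -/
noncomputable def sweepKey (n : ℕ) (pos ext : Fin 4 → ℕ → ℕ) (h : Fin 4) (y : ℕ) (e : Fin 4) : ℕ :=
  3 * n + 1 - mx n (fun p => pos h p < ext h y ∧ ¬ In pos ext p y) (pos e)

/-- The keys of the rectangle `j` in the table of representatives. -/
def coarseKey (g : ℕ) (ext : Fin 4 → ℕ → ℕ) (f₁ f₂ g₁ g₂ : Fin 4) (j : ℕ) : Fin 4 → ℕ :=
  ![ext f₁ j / g + 1, ext f₂ j / g + 1, ext g₁ j, ext g₂ j]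

/-- The array with the table of representatives. -/
def coarseTbl (f₁ f₂ g₁ g₂ : Fin 4) : ℕ := 210 + (64 * f₁ + 16 * f₂ + 4 * g₁ + g₂)

/-- All tables are complete. -/
structure Ready (n L g : ℕ) (pos ext : Fin 4 → ℕ → ℕ) (s : State) : Prop where
  env : Env n L g pos ext s
  pts : PointTabs n L pos s
  rects : Tab L (3 * n + 3) n (fun j d => ext d j) (fun j => j + 1) (s.imem 200)
  sweep : ∀ h : Fin 4, Tab L (3 * n + 3) n (sweepKey n pos ext h)
    (fun y => ext h y * n + y + 1) (s.imem (201 + h))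
  coarse : ∀ f₁ f₂ g₁ g₂ : Fin 4, Tab L (3 * n + 3) n (coarseKey g ext f₁ f₂ g₁ g₂)
    (fun j => j + 1) (s.imem (coarseTbl f₁ f₂ g₁ g₂))

theorem Ready.same {k : ℕ} {s s' : State} (h : Ready n L g pos ext s)
    (hs : Same k ∅ s s') (hk : 11 ≤ k := by omega) : Ready n L g pos ext s' := by
  have : ∀ a, s'.imem a = s.imem a := fun a => hs.2 a (by simp)
  refine ⟨h.env.same hs, h.pts.same hs, ?_, ?_, ?_⟩
  · rw [this]; exact h.rects
  · intro d; rw [this]; exact h.sweep d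
  · intro f₁ f₂ g₁ g₂; rw [this]; exact h.coarse f₁ f₂ g₁ g₂

/-- If a cover has been found, then it is stored in the variables `31, 32, 33`. -/
def Good (n : ℕ) (pos ext : Fin 4 → ℕ → ℕ) (s : State) : Prop :=
  s.ivar 30 = 0 ∨ s.ivar 30 = 1 ∧ s.ivar 31 < n ∧ s.ivar 32 < n ∧ s.ivar 33 < n ∧
    Cover n pos ext (s.ivar 31) (s.ivar 32) (s.ivar 33)

theorem Good.congr {s s' : State} (h : Good n pos ext s) {A : Set ℕ} (hs : Same 34 A s s') :
    Good n pos ext s' := by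
  unfold Good
  rw [hs.1 30 (by omega), hs.1 31 (by omega), hs.1 32 (by omega), hs.1 33 (by omega)]
  exact h

theorem Good.setI {s : State} (h : Good n pos ext s) {x v : ℕ} (hx : x < 30 := by omega) :
    Good n pos ext (s.setI x v) := by
  unfold Good at h ⊢
  simpa [show 30 ≠ x by omega, show 31 ≠ x by omega, show 32 ≠ x by omega,
    show 33 ≠ x by omega] using h

/-- A part of the search has been executed, which finds a cover if `P` holds. -/
structure Step (n : ℕ) (pos ext : Fin 4 → ℕ → ℕ) (k : ℕ) (P : Prop) (s s' : State) : Prop where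
  good : Good n pos ext s'
  same : Same k ∅ s s'
  keep : s.ivar 30 = 1 → s'.ivar 30 = 1
  found : P → s'.ivar 30 = 1

/-- A cover once found is never given up, by `keep`, so the success conditions of consecutive parts
combine to a disjunction. -/
theorem Step.comp {k k₁ k₂ : ℕ} {P Q : Prop} {s s' s'' : State} (h : Step n pos ext k₁ P s s')
    (h' : Step n pos ext k₂ Q s' s'') (h₁ : k ≤ k₁ := by omega) (h₂ : k ≤ k₂ := by omega) :
    Step n pos ext k (P ∨ Q) s s'' :=
  ⟨h'.good, h.same.trans h'.same, fun h1 => h'.keep (h.keep h1),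
    fun h1 => h1.elim (fun h1 => h'.keep (h.found h1)) h'.found⟩

theorem Step.imp {k k' : ℕ} {P Q : Prop} {s s' : State} (h : Step n pos ext k P s s')
    (hk : k' ≤ k) (hQ : Q → P) : Step n pos ext k' Q s s' :=
  ⟨h.good, h.same.mono, h.keep, fun hq => h.found (hQ hq)⟩

theorem Step.of_same {k k' : ℕ} {s s' : State} (h : Good n pos ext s) (hs : Same k ∅ s s')
    (hk : 34 ≤ k := by omega) (hk' : k' ≤ k := by omega) : Step n pos ext k' False s s' :=
  ⟨h.congr (A := ∅) (hs.mono (k' := 34)), hs.mono, fun h1 => by rwa [hs.1 30 (by omega)],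
    fun h => h.elim⟩

theorem Step.of_setI {k x v : ℕ} {s : State} (h : Good n pos ext s) (hk : k ≤ x := by omega)
    (hx : x < 30 := by omega) : Step n pos ext k False s (s.setI x v) :=
  ⟨h.setI, Same.setI, fun h1 => by simpa [show 30 ≠ x by omega] using h1, fun h => h.elim⟩

theorem run_search {s : State} (hG : Good n pos ext s) {x m T : ℕ} {e : IExpr} {body : Program}
    (hx : x < 30) (hm : m ≤ W) (P : ℕ → Prop)
    (he : ∀ s', Same x ∅ s s' → e.eval s' = m)
    (hb : ∀ i < m, ∀ s', Same x ∅ s s' → s'.ivar x = i → Good n pos ext s' →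
      Run W body s' T (Step n pos ext (x + 1) (P i) s')) :
    Run W (forLoop x e body) s (m * (T + e.cost + 8) + e.cost + 6)
      (Step n pos ext x (∃ i < m, P i) s) := by
  refine Run.mono (Run.for (T := T) (fun i s' => Step n pos ext x (∃ j < i, P j) s s') m hm
    ?_ ?_ ?_) le_rfl fun s' h => h.2
  · exact (Step.of_setI hG).imp le_rfl (by simp)
  · intro i hi s' his h
    refine Run.mono (hb i hi s' h.same his h.good) le_rfl fun s'' h' =>
      ⟨(h'.same.1 x (by omega)).trans his, ?_⟩
    refine ((h.comp h' (k := x)).comp (Step.of_setI (k := x) h'.good) (k := x)).imp le_rfl ?_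
    rintro ⟨j, hj, hP⟩
    rcases Nat.lt_succ_iff_lt_or_eq.1 hj with h1 | rfl
    · exact .inl (.inl ⟨j, h1, hP⟩)
    · exact .inl (.inr hP)
  · exact fun i _ s' _ h => he s' h.same

/-- The constraints whose union is the complement of the rectangles in variables `28`, `29`. -/
def checkQuads : List Quad :=
  (List.finRange 4 ×ˢ List.finRange 4).map fun de =>
    ⟨de.1, de.2, .load (14 + de.1) (.var 28), .load (14 + de.2) (.var 29)⟩

/-- Look for a rectangle that completes those in variables `28` and `29` to a cover. -/
def checkP : Program :=
  .seq (bboxP checkQuads) (.seq (setKeys (fun i => .var (34 + i)) (.const 0)) (.seq (queryP 200)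
    (.cond (.ile (.const 1) (.var 46)) (.seq (.setI 30 (.const 1)) (.seq (.setI 31 (.var 28))
      (.seq (.setI 32 (.var 29)) (.setI 33 (.sub (.var 46) (.const 1)))))) .skip)))

/-- A bound for the time of `checkP`. -/
def checkT (L : ℕ) : ℕ := bboxT L 16 + opT L + 100

theorem eval_load_same {s s' : State} {k a x : ℕ} (h : Same k ∅ s s') (hx : x < k := by omega) :
    (IExpr.load a (.var x)).eval s' = (IExpr.load a (.var x)).eval s := by
  simp only [IExpr.eval, h.1 x hx, h.2 a (Set.notMem_empty _)]

theorem Ranks.mx_le (R : Ranks n (3 * n + 1) pos ext) (P : ℕ → Prop) (d : Fin 4) :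
    mx n P (pos d) ≤ 3 * n := by
  have := (mx_lt (m := n) (P := P) (val := pos d) (t := 3 * n + 1) (by omega)).2
    fun j hj _ => R.pos_lt d j hj
  omega

/-- A third rectangle completes the pair exactly if it contains the bounding box of the points
outside both. `hbey` writes these points as a union of quadrants and `hcov` is the criterion. If no
point is left, all maxima are `0` and every rectangle qualifies. -/
theorem run_checkP (z : Sizes W n L g) (R : Ranks n (3 * n + 1) pos ext) {s : State}
    (hR : Ready n L g pos ext s) (hG : Good n pos ext s) {a b : ℕ} (ha : s.ivar 28 = a)
    (hb : s.ivar 29 = b) (han : a < n) (hbn : b < n) :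
    Run W checkP s (checkT L) (Step n pos ext 30 (Extendable n pos ext a b) s) := by
  have hS := z.S_le
  have hbey : ∀ p < n, (∃ c ∈ checkQuads, c.Beyond pos s p) ↔
      ¬ In pos ext p a ∧ ¬ In pos ext p b := by
    intro p hp
    rw [R.not_in hp han, R.not_in hp hbn]
    simp only [checkQuads, List.mem_map, List.mem_product, List.mem_finRange, true_and,
      Prod.exists, Quad.Beyond, ↓existsAndEq, IExpr.eval, ha, hb, hR.env.extA _ a han,
      hR.env.extA _ b hbn, and_self, exists_and_left, exists_and_right]
  have hok : ∀ c ∈ checkQuads, c.Ok n s := by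
    intro c hc
    simp only [checkQuads, List.mem_map, List.mem_product, List.mem_finRange, true_and,
      Prod.exists] at hc
    obtain ⟨d, e, rfl⟩ := hc
    have h1 := R.ext_lt d a han
    have h2 := R.ext_lt e b hbn
    refine ⟨by simp [IExpr.cost], by simp [IExpr.cost], ?_, ?_, fun s' h => eval_load_same h,
      fun s' h => eval_load_same h⟩
    · simp only [IExpr.eval, ha, hR.env.extA d a han]; omega
    · simp only [IExpr.eval, hb, hR.env.extA e b hbn]; omega
  set P := fun p => ¬ In pos ext p a ∧ ¬ In pos ext p b with hP
  have hcov : ∀ c < n, (∀ d, mx n P (pos d) < ext d c) ↔ Cover n pos ext a b c := by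
    intro c hc
    simp only [mx_lt (R.ext_pos _ c hc)]
    refine ⟨fun h p hp => ?_, fun h d p hp hPp => ?_⟩
    · by_cases h1 : In pos ext p a
      · exact .inl h1
      by_cases h2 : In pos ext p b
      · exact .inr (.inl h2)
      exact .inr (.inr fun d => h d p hp ⟨h1, h2⟩)
    · rcases h p hp with h1 | h1 | h1
      · exact absurd h1 hPp.1
      · exact absurd h1 hPp.2
      · exact h1 d
  have hmx := fun d => R.mx_le P d
  refine Run.mono (Run.seq' (run_bboxP z R hR.env.toConsts hR.pts hok) fun s₁ h₁ =>
    Run.seq' (run_setKeys (K := fun d => mx n P (pos d)) (V := 0)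
      (fun d => by have := hmx d; omega) (Nat.zero_le _) (fun d s' h' => ?_) (fun s' _ => rfl)
      (by simp [IExpr.cost]) (by simp [IExpr.cost])) fun s₂ h₂ => ?_) (?_ : _ + (65 + (opT L + 30)) ≤ _)
      fun _ h => h
  · simp only [IExpr.eval]
    rw [h'.1 _ (by omega), h₁.2 d]
    exact mx_congr hbey
  · have hs₂ : Same 34 ∅ s s₂ := h₁.1.trans h₂.1
    refine Run.seq' (Q₁ := fun s' => Same 34 ∅ s s' ∧
      IsMax n (fun c => Cover n pos ext a b c) (fun c => c + 1) (s'.ivar 46))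
      (Run.mono (run_queryP z (hR.env.toConsts.same hs₂) (m := n)
      (key := fun j d => ext d j) (val := fun j => j + 1) ?_ ?_ ?_ ?_) le_rfl
      fun s₃ h₃ => ⟨hs₂.trans h₃.1, h₃.2.congr fun c hc => ?_⟩) fun s₃ h₃ => ?_
    · rw [hs₂.2 _ (by simp)]; exact hR.rects
    · exact fun j hj i => (R.ext_lt i j hj).le
    · intro j hj; omega
    · intro i; rw [h₂.2.1]; have := hmx i; simp only; omega
    · rw [h₂.2.1]; exact hcov c hc
    · obtain ⟨hs₃, hmax⟩ := h₃
      refine Run.mono (Run.cond (T₁ := 14) (T₂ := 1) (fun hb => ?_) fun hb => Run.skip ?_) ?_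
        fun _ h => h
      -- Stored values are indices plus one, so a positive answer names a rectangle and `0` means
      -- that there is none.
      · simp only [Test.Holds, IExpr.eval] at hb
        rcases hmax.2 with h0 | ⟨c, hc, hcc, hce⟩
        · omega
        simp only at hce
        refine Run.mono (Run.seq (Run.setI ?_ (Run.seq (Run.setI ?_ (Run.seq (Run.setI ?_
          (Run.setI ?_ (Q := Step n pos ext 30 (Extendable n pos ext a b) s) ?_))))))) ?_
          fun _ h => h
        · simp [IExpr.eval]; omega
        · simp only [IExpr.eval, ivar_setI, if_neg (show 28 ≠ 30 by omega),
            hs₃.1 28 (by omega)]; omega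
        · simp only [IExpr.eval, ivar_setI, if_neg (show 29 ≠ 30 by omega),
            if_neg (show 29 ≠ 31 by omega), hs₃.1 29 (by omega)]; omega
        · simp [IExpr.eval]; omega
        · refine ⟨.inr ?_, (hs₃.mono (k' := 30)).then_setI.then_setI.then_setI.then_setI,
            fun _ => by simp [IExpr.eval], fun _ => by simp [IExpr.eval]⟩
          simp [IExpr.eval, hs₃.1 28 (by omega), hs₃.1 29 (by omega), ha, ‹s.ivar 29 = b›, han,
            hbn, ← hce, hc, hcc]
        · simp [IExpr.cost]
      · simp only [Test.Holds, IExpr.eval, not_le, Nat.lt_one_iff] at hb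
        refine ⟨hG.congr hs₃, hs₃.mono, fun h => by rwa [hs₃.1 30 (by omega)], ?_⟩
        rintro ⟨c, hc, hcc⟩
        have := hmax.1 c hc hcc
        simp only at this; omega
      · simp [Test.cost, IExpr.cost]
  · simp only [checkT, show checkQuads.length = 16 from rfl]; omega

end ThreeCover

namespace ThreeCover
open RealRAM

/-! ### Preprocessing -/

variable {W n L g : ℕ} {pos ext : Fin 4 → ℕ → ℕ}

/-- Injectivity of `tbl` ensures that no table overwrites another and that each array is still zero
when its turn comes. -/
theorem run_builds (z : Sizes W n L g) {s : State} (hC : Consts n L g s) {ι : Type*}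
    {tbl : ι → ℕ} (hinj : tbl.Injective) (htbl : ∀ i, 100 ≤ tbl i)
    (h0 : ∀ i, s.imem (tbl i) = fun _ => 0) {T : ℕ} {setup : ι → Program}
    {key : ι → ℕ → Fin 4 → ℕ} {val : ι → ℕ → ℕ} (hk : ∀ i, ∀ j < n, ∀ e, key i j e ≤ 3 * n + 1)
    (hv : ∀ i, ∀ j < n, val i j ≤ W)
    (hset : ∀ i, ∀ j < n, ∀ s', s'.ivar 20 = j → Same 20 (Set.range tbl) s s' →
      Run W (setup i) s' T fun s'' =>
        Same 21 ∅ s' s'' ∧ keys s'' = key i j ∧ s''.ivar 44 = val i j)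
    (l : List ι) (hl : l.Nodup) :
    Run W (seqList (fun i => buildP (tbl i) (setup i)) l) s
      (l.length * (n * (T + opT L + 9) + 7) + 1) fun s' => Same 20 (Set.range tbl) s s' ∧
        ∀ i ∈ l, Tab L (3 * n + 3) n (key i) (val i) (s'.imem (tbl i)) := by
  refine Run.mono (Run.seqList (T := n * (T + opT L + 9) + 7) l
    (fun l' s' => Same 20 (Set.range tbl) s s' ∧
      (∀ i, i ∉ l' → s'.imem (tbl i) = s.imem (tbl i)) ∧
      ∀ i ∈ l', Tab L (3 * n + 3) n (key i) (val i) (s'.imem (tbl i)))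
    ⟨Same.refl _ _ _, by simp, by simp⟩ ?_) le_rfl fun s' h => ⟨h.1, h.2.2⟩
  rintro l' i l'' rfl s₁ ⟨hs, hno, hyes⟩
  have hi : i ∉ l' := fun h => (List.nodup_append.1 hl).2.2 i h i (by simp) rfl
  have hsub : ({tbl i} : Set ℕ) ⊆ Set.range tbl := by simp
  refine Run.mono (run_buildP z (hC.same hs (by omega) ?_) (htbl i) ((hno i hi).trans (h0 i))
    (hk i) (hv i) fun j hj s₂ hj₂ hs₂ => hset i j hj s₂ hj₂
      (hs.trans hs₂ le_rfl le_rfl subset_rfl hsub)) le_rfl fun s₂ h₂ =>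
        ⟨hs.trans h₂.1 le_rfl le_rfl subset_rfl hsub, fun i' hi' => ?_, fun i' hi' => ?_⟩
  · rintro ⟨i, hi⟩; have := htbl i; omega
  · rw [← hno i' fun h => hi' (by simp [h])]
    exact h₂.1.2 _ fun h => hi' (by simp [hinj h])
  · by_cases h : i' = i
    · subst h; exact h₂.2
    · rw [h₂.1.2 _ fun h' => h (hinj h')]
      exact hyes i' (by simpa [h] using hi')

/-- Build the point tables. -/
def pointTabsP : Program :=
  seqList (fun i : Fin 4 × Fin 4 × Fin 4 => buildP (ptTbl i.1 i.2.1 i.2.2)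
    (setKeys ![.load (10 + i.1) (.var 20), .load (10 + i.2.1) (.var 20), .const 1, .const 1]
      (.load (10 + i.2.2) (.var 20)))) (List.finRange 4 ×ˢ (List.finRange 4 ×ˢ List.finRange 4))

theorem run_pointTabsP (z : Sizes W n L g) (R : Ranks n (3 * n + 1) pos ext) {s : State}
    (hE : Env n L g pos ext s) (h0 : ∀ a ≥ 100, s.imem a = fun _ => 0) :
    Run W pointTabsP s (64 * (n * (65 + opT L + 9) + 7) + 1) fun s' =>
      Same 20 {a | 100 ≤ a ∧ a < 164} s s' ∧ PointTabs n L pos s' := by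
  have hS := z.S_le
  have hmem : Set.range (fun i : Fin 4 × Fin 4 × Fin 4 => ptTbl i.1 i.2.1 i.2.2) ⊆
      {a | 100 ≤ a ∧ a < 164} := by
    rintro _ ⟨i, rfl⟩; simp only [ptTbl, Set.mem_ofPred_eq]; omega
  refine Run.mono (run_builds z hE.toConsts (ι := Fin 4 × Fin 4 × Fin 4)
    (tbl := fun i => ptTbl i.1 i.2.1 i.2.2) ?_
    (fun i => (hmem ⟨i, rfl⟩).1) (fun i => h0 _ (hmem ⟨i, rfl⟩).1) (T := 65)
    (key := fun i => ptKey pos i.1 i.2.1) (val := fun i => pos i.2.2) ?_ ?_ ?_ _ ?_) ?_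
    fun s' h => ⟨h.1.mono le_rfl hmem, fun d e f => h.2 (d, e, f) (by simp)⟩
  · rintro ⟨d, e, f⟩ ⟨d', e', f'⟩ h
    simp only [ptTbl] at h
    simp only [Prod.mk.injEq, Fin.ext_iff]; omega
  · intro i j hj e
    have h1 := R.pos_lt i.1 j hj
    have h2 := R.pos_lt i.2.1 j hj
    fin_cases e <;> simp [ptKey] <;> omega
  · intro i j hj
    have h1 := R.pos_lt i.2.2 j hj
    omega
  · rintro ⟨d, e, f⟩ j hj s' hjs hs
    have hE' := hE.same hs (hA := fun a ha => (hmem ha).1)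
    have hld : ∀ d : Fin 4, ∀ s'', Same 40 ∅ s' s'' →
        (IExpr.load (10 + d) (.var 20)).eval s'' = pos d j := fun d s'' h => by
      rw [eval_load_same h]; simp only [IExpr.eval, hjs, hE'.posA d j hj]
    have h1 := R.pos_lt d j hj
    have h2 := R.pos_lt e j hj
    have h3 := R.pos_lt f j hj
    refine Run.mono (run_setKeys (K := ptKey pos d e j) (V := pos f j) ?_ (by omega) ?_ (hld f) ?_
      (by simp [IExpr.cost])) le_rfl fun s'' h => ⟨h.1.mono, h.2⟩
    · intro i; fin_cases i <;> simp [ptKey] <;> omega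
    · intro i s'' h
      fin_cases i
      · exact hld d s'' h
      · exact hld e s'' h
      · rfl
      · rfl
    · intro i; fin_cases i <;> simp [IExpr.cost]
  · exact (List.nodup_finRange 4).product ((List.nodup_finRange 4).product (List.nodup_finRange 4))
  · simp [List.length_product]

/-- Build the table of all rectangles. -/
def rectTabP : Program :=
  buildP 200 (setKeys (fun d => .load (14 + d) (.var 20)) (.add (.var 20) (.const 1)))

theorem run_rectTabP (z : Sizes W n L g) (R : Ranks n (3 * n + 1) pos ext) {s : State}
    (hE : Env n L g pos ext s) (h0 : s.imem 200 = fun _ => 0) :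
    Run W rectTabP s (n * (65 + opT L + 9) + 7) fun s' => Same 20 {200} s s' ∧
      Tab L (3 * n + 3) n (fun j d => ext d j) (fun j => j + 1) (s'.imem 200) := by
  have hS := z.S_le
  refine run_buildP z hE.toConsts (by omega) h0 (fun j hj i => (R.ext_lt i j hj).le)
    (fun j hj => by omega) fun j hj s' hjs hs => ?_
  have hE' := hE.same hs
  refine Run.mono (run_setKeys (K := fun d => ext d j) (V := j + 1)
    (fun d => by have := R.ext_lt d j hj; omega) (by omega) (fun d s'' h => ?_) (fun s'' h => ?_)
    (by simp [IExpr.cost]) (by simp [IExpr.cost])) le_rfl fun s'' h => ⟨h.1.mono, h.2⟩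
  · rw [eval_load_same h]; simp only [IExpr.eval, hjs, hE'.extA d j hj]
  · simp only [IExpr.eval, h.1 20 (by omega), hjs]

/-- The constraints whose union consists of the points outside the rectangle in variable `20`
that it does not fall short of in the direction `h`. -/
def sweepQuads (h : Fin 4) : List Quad :=
  (List.finRange 4).map fun d =>
    ⟨d, opp h, .load (14 + d) (.var 20), .sub (.var 5) (.load (14 + h) (.var 20))⟩

/-- Build the tables for sweeps. -/
def sweepTabsP : Program :=
  seqList (fun h : Fin 4 => buildP (201 + h) (.seq (bboxP (sweepQuads h))
    (setKeys (fun e => .sub (.var 5) (.var (34 + e)))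
      (.add (.add (.mul (.load (14 + h) (.var 20)) (.var 4)) (.var 20)) (.const 1)))))
    (List.finRange 4)

/-- The value packs the extent, which decides comparisons, with the index, which is the remainder
modulo `n` once the added `1` is removed. The `1` separates values from the empty cell `0`. -/
theorem Sizes.sweepVal_le (z : Sizes W n L g) (R : Ranks n (3 * n + 1) pos ext) (h : Fin 4) {y : ℕ}
    (hy : y < n) : ext h y * n + y + 1 ≤ W := by
  have := z.pow_le_W (j := 2) (by omega)
  have := R.ext_lt h y hy
  nlinarith

theorem run_sweepTabsP (z : Sizes W n L g) (R : Ranks n (3 * n + 1) pos ext) {s : State}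
    (hE : Env n L g pos ext s) (hP : PointTabs n L pos s)
    (h0 : ∀ a ≥ 201, s.imem a = fun _ => 0) :
    Run W sweepTabsP s (4 * (n * (bboxT L 4 + 65 + opT L + 9) + 7) + 1) fun s' =>
      Same 20 {a | 201 ≤ a ∧ a < 205} s s' ∧ ∀ h : Fin 4, Tab L (3 * n + 3) n
        (sweepKey n pos ext h) (fun y => ext h y * n + y + 1) (s'.imem (201 + h)) := by
  have hS := z.S_le
  have hmem : Set.range (fun h : Fin 4 => 201 + (h : ℕ)) ⊆ {a | 201 ≤ a ∧ a < 205} := by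
    rintro _ ⟨i, rfl⟩; simp only [Set.mem_ofPred_eq]; omega
  refine Run.mono (run_builds z hE.toConsts (tbl := fun h : Fin 4 => 201 + (h : ℕ)) ?_
    (fun i => by omega) (fun i => h0 _ (by omega)) (T := bboxT L 4 + 65)
    (key := sweepKey n pos ext) (val := fun h y => ext h y * n + y + 1) ?_ ?_ ?_ _
    (List.nodup_finRange 4)) ?_
    fun s' h => ⟨h.1.mono le_rfl hmem, fun d => h.2 d (by simp)⟩
  · intro h h' heq; simp only at heq; omega
  · intro h j _ e; simp only [sweepKey]; omega
  · exact fun h j hj => z.sweepVal_le R h hj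
  · intro h j hj s' hjs hs
    have hE' := hE.same hs (hA := fun a ha => by have := (hmem ha).1; omega)
    have hP' := hP.same hs (hA := fun a ha => by have := (hmem ha).1; omega)
    -- The upper bound on `pos h p` is a lower bound on the opposite position, because the two add
    -- up to `3 * n + 1`.
    have hm : ∀ p < n, (∃ c ∈ sweepQuads h, c.Beyond pos s' p) ↔
        pos h p < ext h j ∧ ¬ In pos ext p j := by
      intro p hp
      rw [R.not_in hp hj]
      have h1 := R.opp_add h p hp
      have h2 := R.ext_lt h j hj
      simp only [sweepQuads, List.mem_map, List.mem_finRange, true_and, Quad.Beyond,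
        exists_exists_eq_and, IExpr.eval, hjs, hE'.extA _ j hj, hE'.v5]
      constructor
      · rintro ⟨d, h3, h4⟩; exact ⟨by omega, d, h3⟩
      · rintro ⟨h4, d, h3⟩; exact ⟨d, h3, by omega⟩
    have hok : ∀ c ∈ sweepQuads h, c.Ok n s' := by
      intro c hc
      simp only [sweepQuads, List.mem_map, List.mem_finRange, true_and] at hc
      obtain ⟨d, rfl⟩ := hc
      have h1 := R.ext_lt d j hj
      refine ⟨by simp [IExpr.cost], by simp [IExpr.cost], ?_, ?_, fun s'' h' => eval_load_same h',
        fun s'' h' => ?_⟩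
      · simp only [IExpr.eval, hjs, hE'.extA d j hj]; omega
      · simp only [IExpr.eval, hE'.v5]; omega
      · simp only [IExpr.eval, h'.1 20 (by omega), h'.1 5 (by omega), h'.2 _ (Set.notMem_empty _)]
    refine Run.seq' (run_bboxP z R hE'.toConsts hP' hok) fun s₁ h₁ =>
      (run_setKeys (K := sweepKey n pos ext h j) (V := ext h j * n + j + 1) (fun e => ?_)
      (z.sweepVal_le R h hj) (fun e s'' h' => ?_) (fun s'' h' => ?_) (by simp [IExpr.cost])
      (by simp [IExpr.cost])).mono le_rfl fun s'' h'' =>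
        ⟨(h₁.1.mono (k' := 21) (A' := ∅)).comp h''.1.mono, h''.2⟩
    · simp only [sweepKey]; omega
    · simp only [IExpr.eval, h'.1 5 (by omega), h₁.1.1 5 (by omega), hE'.v5,
        h'.1 (34 + e) (by omega), h₁.2 e, sweepKey]
      rw [mx_congr hm]
    · simp only [IExpr.eval, h'.1 20 (by omega), h₁.1.1 20 (by omega), hjs, h'.1 4 (by omega),
        h₁.1.1 4 (by omega), hE'.v4, h'.2 _ (Set.notMem_empty _), h₁.1.2 _ (Set.notMem_empty _),
        hE'.extA h j hj]
  · simp

/-- Build the tables of representatives. -/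
def coarseTabsP : Program :=
  seqList (fun i : Fin 4 × Fin 4 × Fin 4 × Fin 4 => buildP (coarseTbl i.1 i.2.1 i.2.2.1 i.2.2.2)
    (setKeys ![.add (.div (.load (14 + i.1) (.var 20)) (.var 9)) (.const 1),
      .add (.div (.load (14 + i.2.1) (.var 20)) (.var 9)) (.const 1),
      .load (14 + i.2.2.1) (.var 20), .load (14 + i.2.2.2) (.var 20)]
      (.add (.var 20) (.const 1))))
    (List.finRange 4 ×ˢ (List.finRange 4 ×ˢ (List.finRange 4 ×ˢ List.finRange 4)))

theorem run_coarseTabsP (z : Sizes W n L g) (R : Ranks n (3 * n + 1) pos ext) {s : State}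
    (hE : Env n L g pos ext s) (h0 : ∀ a ≥ 210, s.imem a = fun _ => 0) :
    Run W coarseTabsP s (256 * (n * (65 + opT L + 9) + 7) + 1) fun s' =>
      Same 20 {a | 210 ≤ a} s s' ∧ ∀ f₁ f₂ g₁ g₂ : Fin 4, Tab L (3 * n + 3) n
        (coarseKey g ext f₁ f₂ g₁ g₂) (fun j => j + 1) (s'.imem (coarseTbl f₁ f₂ g₁ g₂)) := by
  have hS := z.S_le
  have hmem : Set.range (fun i : Fin 4 × Fin 4 × Fin 4 × Fin 4 =>
      coarseTbl i.1 i.2.1 i.2.2.1 i.2.2.2) ⊆ {a | 210 ≤ a} := by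
    rintro _ ⟨i, rfl⟩; simp only [coarseTbl, Set.mem_ofPred_eq]; omega
  have hkey : ∀ i : Fin 4 × Fin 4 × Fin 4 × Fin 4, ∀ j < n, ∀ e,
      coarseKey g ext i.1 i.2.1 i.2.2.1 i.2.2.2 j e ≤ 3 * n + 1 := by
    intro i j hj e
    have h1 := R.ext_lt i.1 j hj
    have h2 := R.ext_lt i.2.1 j hj
    have h3 := R.ext_lt i.2.2.1 j hj
    have h4 := R.ext_lt i.2.2.2 j hj
    have h5 := Nat.div_le_self (ext i.1 j) g
    have h6 := Nat.div_le_self (ext i.2.1 j) g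
    fin_cases e <;> simp [coarseKey] <;> omega
  refine Run.mono (run_builds z hE.toConsts (ι := Fin 4 × Fin 4 × Fin 4 × Fin 4)
    (tbl := fun i => coarseTbl i.1 i.2.1 i.2.2.1 i.2.2.2) ?_
    (fun i => by unfold coarseTbl; omega) (fun i => h0 _ (hmem ⟨i, rfl⟩)) (T := 65)
    (key := fun i => coarseKey g ext i.1 i.2.1 i.2.2.1 i.2.2.2) (val := fun _ j => j + 1)
    hkey ?_ ?_ _ ?_) ?_
    fun s' h => ⟨h.1.mono le_rfl hmem, fun d e f f' => h.2 (d, e, f, f') (by simp)⟩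
  · rintro ⟨d, e, f, f'⟩ ⟨d', e', f₁, f₁'⟩ h
    simp only [coarseTbl] at h
    simp only [Prod.mk.injEq, Fin.ext_iff]; omega
  · intro i j hj
    omega
  · rintro ⟨f₁, f₂, g₁, g₂⟩ j hj s' hjs hs
    have hE' := hE.same hs (hA := fun a ha => by have := hmem ha; simp at this; omega)
    have hld : ∀ d : Fin 4, ∀ s'', Same 40 ∅ s' s'' →
        (IExpr.load (14 + d) (.var 20)).eval s'' = ext d j := fun d s'' h => by
      rw [eval_load_same h]; simp only [IExpr.eval, hjs, hE'.extA d j hj]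
    have hdiv : ∀ d : Fin 4, ∀ s'', Same 40 ∅ s' s'' →
        (IExpr.add (.div (.load (14 + d) (.var 20)) (.var 9)) (.const 1)).eval s'' =
          ext d j / g + 1 := fun d s'' h => by
      simp only [IExpr.eval, h.1 20 (by omega), hjs, h.2 _ (Set.notMem_empty _), hE'.extA d j hj,
        h.1 9 (by omega), hE'.v9]
    refine Run.mono (run_setKeys (K := coarseKey g ext f₁ f₂ g₁ g₂ j) (V := j + 1) ?_ (by omega)
      ?_ (fun s'' h => by simp only [IExpr.eval, h.1 20 (by omega), hjs]) ?_
      (by simp [IExpr.cost])) le_rfl fun s'' h => ⟨h.1.mono, h.2⟩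
    · intro e; have := hkey (f₁, f₂, g₁, g₂) j hj e; simp only at this; omega
    · intro i s'' h
      fin_cases i
      · exact hdiv f₁ s'' h
      · exact hdiv f₂ s'' h
      · exact hld g₁ s'' h
      · exact hld g₂ s'' h
    · intro i; fin_cases i <;> simp [IExpr.cost]
  · exact (List.nodup_finRange 4).product ((List.nodup_finRange 4).product
      ((List.nodup_finRange 4).product (List.nodup_finRange 4)))
  · simp [List.length_product]

/-- Build all tables. -/
def tabsP : Program := .seq pointTabsP (.seq rectTabP (.seq sweepTabsP coarseTabsP))

/-- A bound for the time of `tabsP`. -/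
def tabsT (n L : ℕ) : ℕ := 325 * (n * (bboxT L 4 + opT L + 74) + 8)

theorem run_tabsP (z : Sizes W n L g) (R : Ranks n (3 * n + 1) pos ext) {s : State}
    (hE : Env n L g pos ext s) (h0 : ∀ a ≥ 100, s.imem a = fun _ => 0) :
    Run W tabsP s (tabsT n L) (Ready n L g pos ext) := by
  refine Run.mono (Run.seq' (run_pointTabsP z R hE h0) fun s₁ ⟨h₁, hP⟩ =>
    Run.seq' (run_rectTabP z R (hE.same h₁) ?_) fun s₂ ⟨h₂, hr⟩ =>
    Run.seq' (run_sweepTabsP z R ((hE.same h₁).same h₂) (hP.same h₂) ?_) fun s₃ ⟨h₃, hs⟩ =>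
    Run.mono (run_coarseTabsP z R (((hE.same h₁).same h₂).same h₃) ?_) le_rfl fun s₄ ⟨h₄, hc⟩ =>
    ⟨(((hE.same h₁).same h₂).same h₃).same h₄, ((hP.same h₂).same h₃).same h₄, ?_, ?_, hc⟩) ?_
    fun _ h => h
  · rw [h₁.2 _ (by simp)]; exact h0 _ (by omega)
  · intro a ha
    rw [h₂.2 _ (by simp; omega), h₁.2 _ (by simp; omega)]; exact h0 _ (by omega)
  · intro a ha
    rw [h₃.2 _ (by simp; omega), h₂.2 _ (by simp; omega), h₁.2 _ (by simp; omega)]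
    exact h0 _ (by omega)
  · have h1 : n * (65 + opT L + 9) ≤ n * (bboxT L 4 + opT L + 74) :=
      Nat.mul_le_mul_left _ (by omega)
    have h2 : n * (bboxT L 4 + 65 + opT L + 9) ≤ n * (bboxT L 4 + opT L + 74) :=
      Nat.mul_le_mul_left _ (by omega)
    unfold tabsT
    omega
  · rw [h₄.2 _ (by simp), h₃.2 _ (by simp)]; exact hr
  · intro h; rw [h₄.2 _ (by simp; omega)]; exact hs h

end ThreeCover

namespace ThreeCover
open RealRAM

/-! ### The search -/

variable {W n L g : ℕ} {pos ext : Fin 4 → ℕ → ℕ}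

/-- Check the pair of rectangles given by two expressions. -/
def tryP (ea eb : IExpr) : Program := .seq (.setI 28 ea) (.seq (.setI 29 eb) checkP)

theorem run_tryP (z : Sizes W n L g) (R : Ranks n (3 * n + 1) pos ext) {s : State}
    (hR : Ready n L g pos ext s) (hG : Good n pos ext s) {ea eb : IExpr} {a b : ℕ}
    (ha : ea.eval s = a) (hb : eb.eval (s.setI 28 a) = b) (han : a < n) (hbn : b < n)
    (hac : ea.cost ≤ 10) (hbc : eb.cost ≤ 10) :
    Run W (tryP ea eb) s (checkT L + 22) (Step n pos ext 28 (Extendable n pos ext a b) s) := by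
  have hS := z.S_le
  have h1 : Step n pos ext 28 False s ((s.setI 28 a).setI 29 b) :=
    ((Step.of_setI hG (k := 28)).comp (Step.of_setI hG.setI (k := 28)) (k := 28)).imp le_rfl (by simp)
  refine Run.mono (Run.seq (Run.setI (by omega) (Run.seq (T₂ := checkT L) (Run.setI ?_ ?_)))) ?_
    fun _ h => h
  · rw [ha, hb]; omega
  · rw [ha, hb]
    exact Run.mono (run_checkP z R (hR.same h1.same) h1.good (a := a) (b := b) (by simp) (by simp)
      han hbn) le_rfl fun s' h => (h1.comp h (k := 28)).imp le_rfl .inr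
  · omega

theorem run_steps {ι : Type*} {f : ι → Program} {T : ℕ} {P : ι → Prop} {s : State}
    (hG : Good n pos ext s) {k : ℕ} (l : List ι)
    (h : ∀ i ∈ l, ∀ s', Same k ∅ s s' → Good n pos ext s' →
      Run W (f i) s' T (Step n pos ext k (P i) s')) :
    Run W (seqList f l) s (l.length * T + 1) (Step n pos ext k (∃ i ∈ l, P i) s) := by
  refine Run.seqList l (fun l' s' => Step n pos ext k (∃ i ∈ l', P i) s s')
    ⟨hG, Same.refl _ _ _, id, by simp⟩ fun l' i l'' hl s' hs => ?_
  refine Run.mono (h i (by simp [← hl]) s' hs.same hs.good) le_rfl fun s'' h' =>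
    (hs.comp h' (k := k)).imp le_rfl ?_
  rintro ⟨j, hj, hP⟩
  rcases List.mem_append.1 hj with hj | hj
  · exact .inl ⟨j, hj, hP⟩
  · exact .inr (by simp at hj; exact hj ▸ hP)

/-- For each rectangle try the best partner for a sweep in the direction `h`. -/
def sweepP (h : Fin 4) : Program :=
  forLoop 20 (.var 4) (.seq
    (setKeys (fun e => .sub (.var 5) (.load (14 + e) (.var 20))) (.const 0))
    (.seq (queryP (201 + h)) (.cond (.ile (.const 1) (.var 46))
      (tryP (.mod (.sub (.var 46) (.const 1)) (.var 4)) (.var 20)) .skip)))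

/-- Tables only ask for keys above thresholds, whereas here the box of the near-side points missed
by `y` must stay below the extents of `x`. Reflecting both at `3 * n + 1` turns the inequality
around. -/
theorem Ranks.sweepKey_iff (R : Ranks n (3 * n + 1) pos ext) (h : Fin 4) {x y : ℕ} (hx : x < n) :
    (∀ e, 3 * n + 1 - ext e x < sweepKey n pos ext h y e) ↔ Prefix n pos ext h x y := by
  have : ∀ e, 3 * n + 1 - ext e x < sweepKey n pos ext h y e ↔
      mx n (fun p => pos h p < ext h y ∧ ¬ In pos ext p y) (pos e) < ext e x := by
    intro e
    have h1 := R.ext_lt e x hx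
    have h2 := R.mx_le (fun p => pos h p < ext h y ∧ ¬ In pos ext p y) e
    simp only [sweepKey]; omega
  simp only [this, mx_lt (R.ext_pos _ x hx)]
  refine ⟨fun H p hp hlt => ?_, fun H e p hp hP => ?_⟩
  · by_cases hin : In pos ext p y
    · exact .inl hin
    · exact .inr fun e => H e p hp ⟨hlt, hin⟩
  · exact (H p hp hP.1).resolve_left hP.2 e

/-- The sweep condition of `NoCandidate` for one rectangle. -/
def SweepOk (n : ℕ) (pos ext : Fin 4 → ℕ → ℕ) (h : Fin 4) (x : ℕ) : Prop :=
  ∀ y < n, Prefix n pos ext h x y →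
    ∃ y', Prefix n pos ext h x y' ∧ ext h y ≤ ext h y' ∧ ¬ Extendable n pos ext y' x

theorem run_sweepP (z : Sizes W n L g) (R : Ranks n (3 * n + 1) pos ext) {s : State}
    (hR : Ready n L g pos ext s) (hG : Good n pos ext s) (h : Fin 4) :
    Run W (sweepP h) s (n * (opT L + checkT L + 110) + 10)
      (Step n pos ext 20 (∃ x < n, ¬ SweepOk n pos ext h x) s) := by
  have hS := z.S_le
  refine Run.mono (run_search hG (m := n) (T := opT L + checkT L + 100) (by omega) (by omega)
    (fun x => ¬ SweepOk n pos ext h x) (fun s' hs => ?_) fun x hx s' hs hxs hG' => ?_) ?_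
    fun _ h => h
  · simp only [IExpr.eval, hs.1 4 (by omega), hR.env.v4]
  · have hR' := hR.same hs
    refine Run.mono (Run.seq' (run_setKeys (K := fun e => 3 * n + 1 - ext e x) (V := 0)
      (fun e => by omega) (by omega) (fun e s₁ h₁ => ?_) (fun _ _ => rfl) (by simp [IExpr.cost])
      (by simp [IExpr.cost])) fun s₁ ⟨h₁, hk, _⟩ => Run.seq' (run_queryP z
      (hR'.env.toConsts.same h₁) (m := n) (key := sweepKey n pos ext h)
      (val := fun y => ext h y * n + y + 1) ?_ ?_ (fun y hy => z.sweepVal_le R h hy) ?_)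
      fun s₂ ⟨h₂, hmax⟩ => Run.cond (T₁ := checkT L + 22) (T₂ := 1) (fun hb => ?_)
        fun hb => Run.skip ?_) ?_ fun _ h => h
    · simp only [IExpr.eval, h₁.1 5 (by omega), h₁.1 20 (by omega), hxs, hR'.env.v5,
        h₁.2 _ (Set.notMem_empty _), hR'.env.extA e x hx]
    · rw [h₁.2 _ (Set.notMem_empty _)]; exact hR'.sweep h
    · intro y _ e; simp only [sweepKey]; omega
    · intro e; rw [hk]; simp only; omega
    · have hs₂ : Same 40 ∅ s' s₂ := h₁.trans h₂
      rw [hk] at hmax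
      replace hmax := hmax.congr fun y _ => R.sweepKey_iff h hx
      simp only [Test.Holds, IExpr.eval] at hb
      rcases hmax.2 with h0 | ⟨y, hy, hpre, hval⟩
      · omega
      have hst := Step.of_same hG' hs₂ (k' := 28)
      refine Run.mono (run_tryP z R (hR'.same hs₂) hst.good (a := y) (b := x) ?_ ?_ hy hx
        (by simp [IExpr.cost]) (by simp [IExpr.cost])) le_rfl fun s₃ h₃ =>
        (hst.comp h₃ (k := 21)).imp le_rfl fun hno => .inr ?_
      · simp only [IExpr.eval, ← hval, hs₂.1 4 (by omega), hR'.env.v4]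
        rw [Nat.add_sub_cancel, mul_comm, Nat.mul_add_mod, Nat.mod_eq_of_lt hy]
      · simp [IExpr.eval, hs₂.1 20 (by omega), hxs]
      · by_contra hne
        refine hno fun y' hy' hpre' => ⟨y, hpre, ?_, hne⟩
        have := hmax.1 y' hy' hpre'
        simp only [← hval] at this
        by_contra! hlt
        -- Indices are below `n`, so a larger extent outweighs any index.
        have : ext h y * n + n ≤ ext h y' * n := by nlinarith
        omega
    · simp only [Test.Holds, IExpr.eval, not_le, Nat.lt_one_iff] at hb
      refine (Step.of_same hG' (h₁.trans h₂ : Same 40 ∅ s' s₂) (k' := 21)).imp le_rfl fun hno => ?_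
      refine hno fun y hy hpre => ?_
      have := hmax.1 y hy (by rw [hk]; exact (R.sweepKey_iff h hx).2 hpre)
      simp only at this; omega
    · simp only [Test.cost, IExpr.cost]; omega
  · simp only [IExpr.cost]; ring_nf; omega

/-- Try a representative of the rectangles that reach the slabs with numbers in the variables `22`
and `23` in the directions `f₁`, `f₂`, and touch the bounding box in the directions `g₁`, `g₂`. -/
def coarseCellP (f₁ f₂ g₁ g₂ : Fin 4) : Program :=
  .seq (setKeys ![.var 22, .var 23, .var 20, .var 21] (.const 0))
    (.seq (queryP (coarseTbl f₁ f₂ g₁ g₂)) (.cond (.ile (.const 1) (.var 46))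
      (.seq (.setI 24 (.sub (.var 46) (.const 1)))
        (forLoop 25 (.var 4) (tryP (.var 24) (.var 25)))) .skip))

/-- Try a representative for each pair of slabs. -/
def coarseP (f₁ f₂ g₁ g₂ : Fin 4) : Program :=
  .seq (bboxP [⟨0, 0, .const 0, .const 0⟩]) (.seq (.setI 20 (.var (34 + g₁)))
    (.seq (.setI 21 (.var (34 + g₂))) (forLoop 22 (.var 10) (forLoop 23 (.var 10)
      (coarseCellP f₁ f₂ g₁ g₂)))))

/-- The coarse condition of `NoCandidate` for one pair of slabs. -/
def CoarseOk (n g : ℕ) (pos ext : Fin 4 → ℕ → ℕ) (f₁ f₂ g₁ g₂ : Fin 4) (i j : ℕ) : Prop :=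
  ∀ a < n, Touches n pos ext g₁ a → Touches n pos ext g₂ a → ext f₁ a / g = i → ext f₂ a / g = j →
    ∃ a' < n, Touches n pos ext g₁ a' ∧ Touches n pos ext g₂ a' ∧ i ≤ ext f₁ a' / g ∧
      j ≤ ext f₂ a' / g ∧ ∀ b < n, ¬ Extendable n pos ext a' b

/-- Any representative will do: if no `b` makes it extendable, it is itself the witness `a'` in
`CoarseOk`. If the table has none, `CoarseOk` holds vacuously. -/
theorem run_coarseCellP (z : Sizes W n L g) (R : Ranks n (3 * n + 1) pos ext) {s : State}
    (hR : Ready n L g pos ext s) (hG : Good n pos ext s) {f₁ f₂ g₁ g₂ : Fin 4} {i j : ℕ}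
    (h₂₀ : s.ivar 20 = mx n (fun _ => True) (pos g₁))
    (h₂₁ : s.ivar 21 = mx n (fun _ => True) (pos g₂)) (h₂₂ : s.ivar 22 = i) (h₂₃ : s.ivar 23 = j)
    (hi : i ≤ 3 * n + 1) (hj : j ≤ 3 * n + 1) :
    Run W (coarseCellP f₁ f₂ g₁ g₂) s (opT L + n * (checkT L + 40) + 109)
      (Step n pos ext 24 (¬ CoarseOk n g pos ext f₁ f₂ g₁ g₂ i j) s) := by
  have hS := z.S_le
  set m₁ := mx n (fun _ => True) (pos g₁) with hm₁
  set m₂ := mx n (fun _ => True) (pos g₂) with hm₂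
  have hm₁' : m₁ ≤ 3 * n := R.mx_le _ g₁
  have hm₂' : m₂ ≤ 3 * n := R.mx_le _ g₂
  -- The `+ 1` in the first two keys turns strict comparisons into `≤` between slab numbers;
  -- exceeding the farthest point in the last two is `Touches`.
  have hiff : ∀ a < n, (∀ e, ![i, j, m₁, m₂] e < coarseKey g ext f₁ f₂ g₁ g₂ a e) ↔
      i ≤ ext f₁ a / g ∧ j ≤ ext f₂ a / g ∧ Touches n pos ext g₁ a ∧ Touches n pos ext g₂ a := by
    intro a ha
    rw [Fin.forall_fin_succ, Fin.forall_fin_succ, Fin.forall_fin_two]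
    simp [coarseKey, hm₁, hm₂, mx_lt (R.ext_pos _ a ha), Touches]
  refine Run.mono (Run.seq' (run_setKeys (K := ![i, j, m₁, m₂]) (V := 0) ?_ (by omega)
    ?_ (fun _ _ => rfl) ?_ (by simp [IExpr.cost])) fun s₁ ⟨h₁, hk, _⟩ => Run.seq' (run_queryP z
    (hR.env.toConsts.same h₁) (m := n) (key := coarseKey g ext f₁ f₂ g₁ g₂)
    (val := fun y => y + 1) ?_ ?_ (fun y hy => by omega) ?_) fun s₂ ⟨h₂, hmax⟩ => Run.cond
      (T₁ := n * (checkT L + 40) + 20) (T₂ := 1) (fun hb => ?_) fun hb => Run.skip ?_) ?_ fun _ h => h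
  · intro e; fin_cases e <;> simp <;> omega
  · intro e s' h'
    fin_cases e <;> simp [IExpr.eval, h'.1, h₂₀, h₂₁, h₂₂, h₂₃]
  · intro e; fin_cases e <;> simp [IExpr.cost]
  · rw [h₁.2 _ (Set.notMem_empty _)]; exact hR.coarse f₁ f₂ g₁ g₂
  · intro a ha e
    have h1 := R.ext_lt f₁ a ha
    have h2 := R.ext_lt f₂ a ha
    have h3 := R.ext_lt g₁ a ha
    have h4 := R.ext_lt g₂ a ha
    have h5 := Nat.div_le_self (ext f₁ a) g
    have h6 := Nat.div_le_self (ext f₂ a) g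
    fin_cases e <;> simp [coarseKey] <;> omega
  · intro e; rw [hk]; fin_cases e <;> simp <;> omega
  · have hs₂ : Same 40 ∅ s s₂ := h₁.trans h₂
    rw [hk] at hmax
    replace hmax := hmax.congr fun y hy => hiff y hy
    simp only [Test.Holds, IExpr.eval] at hb
    rcases hmax.2 with h0 | ⟨a, ha, hpre, hval⟩
    · omega
    simp only at hval
    have hst := Step.of_same hG hs₂ (k' := 24)
    have ea : (IExpr.sub (.var 46) (.const 1)).eval s₂ = a := by
      simp only [IExpr.eval]; omega
    refine Run.mono (Run.seq (T₂ := n * (checkT L + 40) + 10)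
      (Run.setI (by rw [ea]; omega) ?_)) ?_ fun _ h => h
    · rw [ea]
      have hst' := hst.comp (Step.of_setI hst.good (x := 24) (v := a) (k := 24)) (k := 24)
      refine Run.mono (run_search hst'.good (m := n) (T := checkT L + 22) (by omega) (by omega)
        (fun b => Extendable n pos ext a b) (fun s' hs => ?_) fun b hb s₄ hs₄ hb₄ hG₄ =>
        Run.mono (run_tryP z R (hR.same (hst'.same.trans hs₄ (k'' := 24) (A'' := ∅))) hG₄ (a := a)
          (b := b) ?_ ?_ ha hb (by simp [IExpr.cost]) (by simp [IExpr.cost])) le_rfl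
          fun s₅ h₅ => h₅.imp (by omega) id) ?_ fun s₆ h₆ => ?_
      · simp only [IExpr.eval, hs.1 4 (by omega), hst'.same.1 4 (by omega), hR.env.v4]
      · simp [IExpr.eval, hs₄.1 24 (by omega)]
      · simp [IExpr.eval, hb₄]
      · simp only [IExpr.cost]; ring_nf; omega
      · refine (hst'.comp h₆ (k := 24)).imp le_rfl fun hno => .inr ?_
        by_contra hne
        push Not at hne
        exact hno fun _ _ _ _ _ _ => ⟨a, ha, hpre.2.2.1, hpre.2.2.2, hpre.1, hpre.2.1, hne⟩
    · simp only [IExpr.cost]; omega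
  · simp only [Test.Holds, IExpr.eval, not_le, Nat.lt_one_iff] at hb
    refine (Step.of_same hG (h₁.trans h₂ : Same 40 ∅ s s₂) (k' := 24)).imp le_rfl fun hno => ?_
    refine hno fun a ha t₁ t₂ h1 h2 => ?_
    have := hmax.1 a ha (by rw [hk]; exact (hiff a ha).2 ⟨h1.ge, h2.ge, t₁, t₂⟩)
    simp only at this; omega
  · simp only [Test.cost, IExpr.cost]; omega

/-- A bound for the time of `coarseP`. -/
def coarseT (n L r : ℕ) : ℕ :=
  bboxT L 1 + r * (r * (opT L + n * (checkT L + 40) + 120) + 20) + 20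

theorem run_coarseP (z : Sizes W n L g) (R : Ranks n (3 * n + 1) pos ext) {s : State}
    (hR : Ready n L g pos ext s) (hG : Good n pos ext s) (f₁ f₂ g₁ g₂ : Fin 4) :
    Run W (coarseP f₁ f₂ g₁ g₂) s (coarseT n L (3 * n / g + 1))
      (Step n pos ext 20 (∃ i < 3 * n / g + 1, ∃ j < 3 * n / g + 1,
        ¬ CoarseOk n g pos ext f₁ f₂ g₁ g₂ i j) s) := by
  have hS := z.S_le
  have hn := z.n_pos
  set r := 3 * n / g + 1 with hr
  have hr' : r ≤ 3 * n + 1 := by have := Nat.div_le_self (3 * n) g; omega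
  have hm := fun d => R.mx_le (fun _ => True) d
  refine Run.mono (Run.seq' (run_bboxP z R hR.env.toConsts hR.pts
    (cs := [⟨0, 0, .const 0, .const 0⟩]) ?_) fun s₁ ⟨h₁, hmx⟩ =>
    Run.seq (T₂ := 2 + (r * (r * (opT L + n * (checkT L + 40) + 120) + 16) + 7))
      (Run.setI ?_ (Run.seq (Run.setI ?_ ?_)))) ?_ fun _ h => h
  · simp only [List.mem_singleton, forall_eq]
    exact ⟨by simp [IExpr.cost], by simp [IExpr.cost], by simp [IExpr.eval], by simp [IExpr.eval],
      fun _ _ => rfl, fun _ _ => rfl⟩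
  · simp only [IExpr.eval, hmx]; exact (R.mx_le _ _).trans (by omega)
  · simp only [IExpr.eval, ivar_setI, if_neg (show 34 + (g₂ : ℕ) ≠ 20 by omega), hmx]
    exact (R.mx_le _ _).trans (by omega)
  · have hmx' : ∀ f : Fin 4, s₁.ivar (34 + f) = mx n (fun _ => True) (pos f) := fun f => by
      rw [hmx f]
      -- Positions are positive, so the quadrant with thresholds `0` contains all points.
      exact mx_congr fun p hp => by simp [Quad.Beyond, IExpr.eval, R.pos_pos 0 p hp]
    simp only [IExpr.eval, ivar_setI, if_neg (show 34 + (g₂ : ℕ) ≠ 20 by omega), hmx']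
    have hst := Step.of_same hG h₁ (k' := 20)
    have hst₁ := hst.comp (Step.of_setI hst.good (x := 20) (v := mx n (fun _ => True) (pos g₁))
      (k := 20)) (k := 20)
    have hst₂ := hst₁.comp (Step.of_setI hst₁.good (x := 21)
      (v := mx n (fun _ => True) (pos g₂)) (k := 20)) (k := 20)
    refine Run.mono (run_search hst₂.good (m := r)
      (T := r * (opT L + n * (checkT L + 40) + 120) + 7) (by omega) (by omega)
      (fun i => ∃ j < r, ¬ CoarseOk n g pos ext f₁ f₂ g₁ g₂ i j) ?_ fun i hi s₂ h₂ hi₂ hG₂ =>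
      Run.mono (run_search hG₂ (m := r) (T := opT L + n * (checkT L + 40) + 109) (by omega)
        (by omega) (fun j => ¬ CoarseOk n g pos ext f₁ f₂ g₁ g₂ i j) ?_
        fun j hj s₃ h₃ hj₃ hG₃ => ?_) ?_ fun _ h => h) ?_ fun s₄ h₄ => ?_
    · intro s' hs
      simp only [IExpr.eval, hs.1 10 (by omega), hst₂.same.1 10 (by omega), hR.env.v10, ← hr]
    · intro s' hs
      simp only [IExpr.eval, hs.1 10 (by omega), h₂.1 10 (by omega), hst₂.same.1 10 (by omega),
        hR.env.v10, ← hr]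
    · refine run_coarseCellP z R (hR.same (hst₂.same.trans (h₂.trans h₃ (k'' := 22) (A'' := ∅))
        (k'' := 20) (A'' := ∅))) hG₃ ?_ ?_ ?_ hj₃ (by omega) (by omega)
      · simp [h₃.1 20 (by omega), h₂.1 20 (by omega)]
      · simp [h₃.1 21 (by omega), h₂.1 21 (by omega)]
      · rw [h₃.1 22 (by omega), hi₂]
    · simp only [IExpr.cost]; ring_nf; omega
    · simp only [IExpr.cost]; ring_nf; omega
    · exact (hst₂.comp h₄ (k := 20)).imp le_rfl .inr
  · simp only [IExpr.cost, coarseT, List.length_singleton]; ring_nf; omega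

/-- For each rectangle `b`, try the rectangles that end, in the direction `f`, in the same slab as
the points further than `b` in the direction `d`. -/
def slabP (f d : Fin 4) : Program :=
  forLoop 20 (.var 4) (.seq
    (bboxP [⟨d, d, .load (14 + d) (.var 20), .load (14 + d) (.var 20)⟩])
    (.seq (.setI 21 (.mul (.div (.var (34 + f)) (.var 9)) (.var 9)))
      (forLoop 22 (.var 9) (.seq (.setI 23 (.load (18 + f) (.add (.var 21) (.var 22))))
        (.cond (.ile (.const 1) (.var 23)) (tryP (.sub (.var 23) (.const 1)) (.var 20)) .skip)))))

/-- The slab condition of `NoCandidate` for one rectangle. -/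
def SlabOk (n g : ℕ) (pos ext : Fin 4 → ℕ → ℕ) (f d : Fin 4) (b : ℕ) : Prop :=
  ∀ a < n, ext f a / g = mx n (fun p => ext d b < pos d p) (pos f) / g → ¬ Extendable n pos ext a b

/-- A bound for the time of `slabP`. -/
def slabT (n L g : ℕ) : ℕ := n * (bboxT L 1 + g * (checkT L + 70) + 60) + 10

/-- A slab has `g` ranks and each is the extent of at most one rectangle, so the inverse array lists
the rectangles ending in the slab in `g` steps. -/
theorem run_slabP (z : Sizes W n L g) (R : Ranks n (3 * n + 1) pos ext) {s : State}
    (hR : Ready n L g pos ext s) (hG : Good n pos ext s) (f d : Fin 4) :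
    Run W (slabP f d) s (slabT n L g)
      (Step n pos ext 20 (∃ b < n, ¬ SlabOk n g pos ext f d b) s) := by
  have hS := z.S_le
  have hgn := z.g_le
  refine Run.mono (run_search hG (m := n) (T := bboxT L 1 + g * (checkT L + 70) + 50) (by omega) (by omega)
    (fun b => ¬ SlabOk n g pos ext f d b) (fun s' hs => ?_) fun b hb s₁ h₁ hb₁ hG₁ => ?_) ?_
    fun _ h => h
  · simp only [IExpr.eval, hs.1 4 (by omega), hR.env.v4]
  · have hR₁ := hR.same h₁
    have hext := R.ext_lt d b hb
    set κ := mx n (fun p => ext d b < pos d p) (pos f) with hκ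
    have hκle : κ ≤ 3 * n := R.mx_le _ f
    have hev : (IExpr.load (14 + d) (.var 20)).eval s₁ = ext d b := by
      simp only [IExpr.eval, hb₁, hR₁.env.extA d b hb]
    have hv : ∀ s₂, Same 34 ∅ s₁ s₂ → (∀ f : Fin 4, s₂.ivar (34 + f) = mx n (fun p => ∃ c ∈
        [(⟨d, d, .load (14 + d) (.var 20), .load (14 + d) (.var 20)⟩ : Quad)],
          c.Beyond pos s₁ p) (pos f)) →
        (IExpr.mul (.div (.var (34 + f)) (.var 9)) (.var 9)).eval s₂ = κ / g * g := by
      intro s₂ h₂ hmx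
      have h34 : s₂.ivar (34 + f) = κ := by
        rw [hmx f]
        refine mx_congr fun p hp => ?_
        simp only [List.mem_singleton, Quad.Beyond, exists_eq_left, hev, and_self]
      simp only [IExpr.eval, h34, h₂.1 9 (by omega), hR₁.env.v9]
    have hκW : κ / g * g ≤ W := (Nat.div_mul_le_self κ g).trans (by omega)
    refine Run.mono (Run.seq' (run_bboxP z R hR₁.env.toConsts hR₁.pts (cs := [⟨d, d,
      .load (14 + d) (.var 20), .load (14 + d) (.var 20)⟩]) ?_) fun s₂ ⟨h₂, hmx⟩ =>
      Run.seq (T₂ := g * (checkT L + 70) + 7) (Run.setI (by rwa [hv s₂ h₂ hmx]) ?_)) ?_ fun _ h => h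
    · simp only [List.mem_singleton, forall_eq]
      exact ⟨by simp [IExpr.cost], by simp [IExpr.cost], by rw [hev]; omega, by rw [hev]; omega,
        fun _ h => eval_load_same h, fun _ h => eval_load_same h⟩
    · rw [hv s₂ h₂ hmx]
      have hst := Step.of_same hG₁ h₂ (k' := 21)
      have hst₁ := hst.comp (Step.of_setI hst.good (x := 21) (v := κ / g * g) (k := 21)) (k := 21)
      refine Run.mono (run_search hst₁.good (m := g) (T := checkT L + 60) (by omega) (by omega)
        (fun k => ∃ a < n, ext f a = κ / g * g + k ∧ Extendable n pos ext a b) (fun s' hs => ?_)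
        fun k hk s₃ h₃ hk₃ hG₃ => ?_) ?_ fun s₄ h₄ => (hst₁.comp h₄ (k := 21)).imp le_rfl ?_
      · simp only [IExpr.eval, hs.1 9 (by omega), hst₁.same.1 9 (by omega), hR₁.env.v9]
      · have hs₃ : Same 21 ∅ s₁ s₃ := hst₁.same.trans h₃
        have hR₃ := hR₁.same hs₃
        set w := s₃.imem (18 + f) (κ / g * g + k) with hw
        have hwn : w ≤ n := hR₃.env.inv_le f _
        have hld : (IExpr.load (18 + f) (.add (.var 21) (.var 22))).eval s₃ = w := by
          simp [IExpr.eval, h₃.1 21 (by omega), hk₃, hw]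
        have hst₃ := Step.of_setI hG₃ (x := 23) (v := w) (k := 23)
        refine Run.mono (Run.seq (T₂ := checkT L + 30) (Run.setI (by rw [hld]; omega) ?_)) ?_
          fun _ h => h
        · rw [hld]
          refine Run.mono (Run.cond (T₁ := checkT L + 22) (T₂ := 1) (fun hb' => ?_)
            fun hb' => Run.skip ?_) ?_ fun _ h => h
          · simp [Test.Holds, IExpr.eval] at hb'
            refine Run.mono (run_tryP z R (hR₃.same hst₃.same) hst₃.good (a := w - 1) (b := b)
              (by simp [IExpr.eval]) ?_ (by omega) hb (by simp [IExpr.cost])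
              (by simp [IExpr.cost])) le_rfl fun s₄ h₄ => (hst₃.comp h₄ (k := 23)).imp le_rfl ?_
            · simp [IExpr.eval, hs₃.1 20 (by omega), hb₁]
            · rintro ⟨a, ha, hea, hext⟩
              have := hR₃.env.invA f a ha
              rw [hea, ← hw] at this
              right
              rwa [this, Nat.add_sub_cancel]
          -- The entry `0` means that no rectangle ends at this rank, since entries of rectangles
          -- are indices plus one.
          · simp [Test.Holds, IExpr.eval] at hb'
            refine hst₃.imp le_rfl ?_
            rintro ⟨a, ha, hea, hext⟩
            have := hR₃.env.invA f a ha
            rw [hea, ← hw] at this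
            omega
          · simp only [Test.cost, IExpr.cost]; omega
        · simp only [IExpr.cost]; omega
      · simp only [IExpr.cost]; ring_nf; omega
      · intro hno
        right
        by_contra hne
        refine hno fun a ha heq hext => hne ⟨ext f a % g, Nat.mod_lt _ z.g_pos, a, ha, ?_, hext⟩
        rw [← heq, Nat.div_add_mod']
    · simp only [List.length_singleton, IExpr.cost]; omega
  · simp only [IExpr.cost, slabT]; ring_nf; omega

/-- The whole search. -/
def searchP : Program :=
  .seq (seqList sweepP (List.finRange 4)) (.seq
    (seqList (fun i : Fin 4 × Fin 4 × Fin 4 × Fin 4 => coarseP i.1 i.2.1 i.2.2.1 i.2.2.2)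
      (List.finRange 4 ×ˢ (List.finRange 4 ×ˢ (List.finRange 4 ×ˢ List.finRange 4))))
    (seqList (fun i : Fin 4 × Fin 4 => slabP i.1 i.2) (List.finRange 4 ×ˢ List.finRange 4)))

/-- A bound for the time of `searchP`. -/
def searchT (n L g : ℕ) : ℕ :=
  4 * (n * (opT L + checkT L + 110) + 10) + 256 * coarseT n L (3 * n / g + 1) +
    16 * slabT n L g + 3

/-- After the search, a cover has been found unless there is none. -/
theorem run_searchP (z : Sizes W n L g) (R : Ranks n (3 * n + 1) pos ext) {s : State}
    (hR : Ready n L g pos ext s) (hG : Good n pos ext s) :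
    Run W searchP s (searchT n L g) fun s' => Good n pos ext s' ∧
      ((∃ a < n, ∃ b < n, ∃ c < n, Cover n pos ext a b c) → s'.ivar 30 = 1) := by
  refine Run.mono (Run.seq' (run_steps hG (k := 20) _ fun h _ s' hs hG' =>
    run_sweepP z R (hR.same hs) hG' h) fun s₁ h₁ => Run.seq' (run_steps h₁.good (k := 20) _
    fun i _ s' hs hG' => run_coarseP z R (hR.same (h₁.same.trans hs (k'' := 20) (A'' := ∅))) hG'
      i.1 i.2.1 i.2.2.1 i.2.2.2) fun s₂ h₂ => Run.mono (run_steps h₂.good (k := 20) _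
    fun i _ s' hs hG' => run_slabP z R (hR.same ((h₁.same.trans h₂.same (k'' := 20)
      (A'' := ∅)).trans hs (k'' := 20) (A'' := ∅))) hG' i.1 i.2) le_rfl fun s₃ h₃ =>
    ⟨h₃.good, ?_⟩) ?_ fun _ h => h
  · simp [List.length_product, searchT]; omega
  · rintro ⟨a, ha, b, hb, c, hc, hcov⟩
    by_contra hne
    have hall := fun h => hne (((h₁.comp h₂ (k := 20)).comp h₃ (k := 20)).found h)
    rw [imp_false] at hall
    push Not at hall
    obtain ⟨⟨hs, hco⟩, hsl⟩ := hall
    refine NoCandidate.not_cover (g := g) ⟨fun h x hx => ?_, fun f₁ f₂ g₁ g₂ _ a ha t₁ t₂ => ?_,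
      fun f d a ha b hb q hq hq1 hq2 hq3 => ?_⟩ R ha hb hc hcov
    · exact hs h (by simp) x hx
    · have := hco (f₁, f₂, g₁, g₂) (by simp) (ext f₁ a / g) ?_ (ext f₂ a / g) ?_
      · exact this a ha t₁ t₂ rfl rfl
      · have := R.ext_lt f₁ a ha
        exact Nat.lt_succ_of_le (Nat.div_le_div_right (by omega))
      · have := R.ext_lt f₂ a ha
        exact Nat.lt_succ_of_le (Nat.div_le_div_right (by omega))
    · refine hsl (f, d) (by simp) b hb a ha ?_
      have hmax : IsMax n (fun p => ext d b < pos d p) (pos f) (pos f q) :=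
        ⟨hq2, .inr ⟨q, hq, hq1, rfl⟩⟩
      rw [hq3, hmax.eq_mx]

end ThreeCover

namespace ThreeCover
open RealRAM

/-! ### Ranks in finite sets -/

section Rank
variable {α : Type*} [LinearOrder α] {κ : ℕ → α}

/-- The number of elements of `S` with a smaller value than `x`. -/
def rankIn (κ : ℕ → α) (S : Finset ℕ) (x : ℕ) : ℕ := (S.filter fun j => κ j < κ x).card

theorem rankIn_lt_card {S : Finset ℕ} {x : ℕ} (hx : x ∈ S) : rankIn κ S x < S.card :=
  Finset.card_lt_card ⟨Finset.filter_subset _ _, fun h => by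
    have := Finset.mem_filter.1 (h hx); exact lt_irrefl _ this.2⟩

theorem lt_iff_rankIn_lt {S : Finset ℕ} {x y : ℕ} (hx : x ∈ S) :
    κ x < κ y ↔ rankIn κ S x < rankIn κ S y := by
  constructor
  · intro h
    refine Finset.card_lt_card ⟨fun j hj => ?_, fun hs => ?_⟩
    · rw [Finset.mem_filter] at hj ⊢
      exact ⟨hj.1, hj.2.trans h⟩
    · have := Finset.mem_filter.1 (hs (Finset.mem_filter.2 ⟨hx, h⟩))
      exact lt_irrefl _ this.2
  · contrapose!
    intro h
    refine Finset.card_le_card fun j hj => ?_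
    rw [Finset.mem_filter] at hj ⊢
    exact ⟨hj.1, hj.2.trans_le h⟩

theorem rankIn_inj (hκ : Function.Injective κ) {S : Finset ℕ} {x y : ℕ} (hx : x ∈ S) (hy : y ∈ S)
    (h : rankIn κ S x = rankIn κ S y) : x = y := by
  rcases lt_trichotomy (κ x) (κ y) with h' | h' | h'
  · have := (lt_iff_rankIn_lt hx).1 h'; omega
  · exact hκ h'
  · have := (lt_iff_rankIn_lt hy).1 h'; omega

/-- Ranks inject `S` into the numbers below its cardinality; by counting they fill them. -/
theorem exists_rankIn_eq (hκ : Function.Injective κ) {S : Finset ℕ} {k : ℕ} (hk : k < S.card) :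
    ∃ x ∈ S, rankIn κ S x = k := by
  have := Finset.surjOn_of_injOn_of_card_le (s := S) (t := Finset.range S.card) (rankIn κ S)
    (fun x hx => by simpa using rankIn_lt_card (κ := κ) hx)
    (fun x hx y hy h => rankIn_inj hκ hx hy h) (by simp)
  simpa using this (by simpa using hk : k ∈ (Finset.range S.card : Set ℕ))

/-- The numbers below `N` with quotient `q` by `w`. -/
def block (N w q : ℕ) : Finset ℕ := (Finset.range N).filter fun j => j / w = q

theorem mem_block {N w q j : ℕ} : j ∈ block N w q ↔ j < N ∧ j / w = q := by simp [block]

/-- The other half of the next larger block. -/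
def sibling (q : ℕ) : ℕ := q + 1 - 2 * (q % 2)

/-- The truncated subtractions cover the last block, cut off at `N`, and blocks starting beyond `N`,
which are empty. -/
theorem card_block {N w q : ℕ} (hw : 0 < w) : (block N w q).card = w - (q * w + w - N) := by
  have : block N w q = Finset.Ico (q * w) (q * w + (w - (q * w + w - N))) := by
    ext j
    rw [mem_block, Finset.mem_Ico, Nat.div_eq_iff hw]
    omega
  rw [this]; simp

/-- The double block is the disjoint union of a block and its sibling, and a rank counts smaller
elements. So sorted blocks can be merged with one binary search per item. -/
theorem rankIn_block_double {N w i : ℕ} :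
    rankIn κ (block N (w * 2) (i / (w * 2))) i =
      rankIn κ (block N w (i / w)) i + rankIn κ (block N w (sibling (i / w))) i := by
  unfold rankIn
  rw [← Finset.card_union_of_disjoint]
  · congr 1
    ext j
    simp only [Finset.mem_union, Finset.mem_filter, mem_block, sibling,
      ← Nat.div_div_eq_div_mul]
    have : j / w / 2 = i / w / 2 ↔ j / w = i / w ∨ j / w = i / w + 1 - 2 * (i / w % 2) := by
      generalize j / w = a
      generalize i / w = b
      omega
    rw [this]; tauto
  · rw [Finset.disjoint_left]
    intro j hj hj'
    simp only [Finset.mem_filter, mem_block, sibling] at hj hj'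
    omega

theorem rankIn_block_lt {N w i : ℕ} (hw : 0 < w) (hi : i < N) :
    rankIn κ (block N w (i / w)) i < w := by
  have := rankIn_lt_card (κ := κ) (mem_block.2 ⟨hi, rfl⟩ : i ∈ block N w (i / w))
  rw [card_block hw] at this
  omega

/-- The position of `i` when all blocks of length `w` are sorted. -/
def place (κ : ℕ → α) (N w i : ℕ) : ℕ := i / w * w + rankIn κ (block N w (i / w)) i

/-- Ranks within a block are below `w`, so the quotient of the place by `w` recovers the block, and
the rank then recovers the item. -/
theorem place_inj (hκ : Function.Injective κ) {N w i j : ℕ} (hw : 0 < w) (hi : i < N) (hj : j < N)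
    (h : place κ N w i = place κ N w j) : i = j := by
  unfold place at h
  have h1 := rankIn_block_lt (κ := κ) hw hi
  have h2 := rankIn_block_lt (κ := κ) hw hj
  have e : i / w = j / w := by
    have := congrArg (fun t => t / w) h
    beta_reduce at this
    rwa [Nat.mul_comm, Nat.mul_add_div hw, Nat.div_eq_of_lt h1, Nat.mul_comm,
      Nat.mul_add_div hw, Nat.div_eq_of_lt h2] at this
  rw [e] at h
  exact rankIn_inj hκ (mem_block.2 ⟨hi, e⟩) (mem_block.2 ⟨hj, rfl⟩) (by omega)

theorem rankIn_block_one {N i : ℕ} : rankIn κ (block N 1 (i / 1)) i = 0 := by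
  have := rankIn_lt_card (κ := κ) (S := block N 1 (i / 1)) (x := i)
  unfold rankIn
  rw [Finset.card_eq_zero, Finset.filter_eq_empty_iff]
  intro j hj
  rw [mem_block, Nat.div_one, Nat.div_one] at hj
  rw [hj.2]; exact lt_irrefl _

end Rank

/-! ### Sorting -/

/-- Items are ordered by their values, and by their numbers when the values are equal. -/
noncomputable def sortKey (V : ℕ → ℝ) (i : ℕ) : ℝ ×ₗ ℕ := toLex (V i, i)

theorem sortKey_injective (V : ℕ → ℝ) : Function.Injective (sortKey V) := fun i j h => by
  have := congrArg (fun x => (ofLex x).2) h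
  simpa [sortKey] using this

theorem sortKey_lt {V : ℕ → ℝ} {i j : ℕ} :
    sortKey V i < sortKey V j ↔ V i < V j ∨ V i = V j ∧ i < j := by
  simp [sortKey, Prod.Lex.toLex_lt_toLex]

/-- The item `e` comes before the item `f`. -/
def beforeE (e f : IExpr) : Test :=
  .or (.not (.rle (.load 6 f) (.load 6 e))) (.and (.rle (.load 6 e) (.load 6 f))
    (.not (.ile f e)))

theorem holds_beforeE {V : ℕ → ℝ} {s : State} (hV : s.rmem 6 = V) {e f : IExpr} :
    (beforeE e f).Holds s ↔ sortKey V (e.eval s) < sortKey V (f.eval s) := by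
  simp only [beforeE, Test.Holds, RExpr.eval, hV, sortKey_lt, not_le]
  constructor
  · rintro (h | ⟨h, h'⟩)
    · exact .inl h
    · rcases h.lt_or_eq with h | h
      · exact .inl h
      · exact .inr ⟨h, h'⟩
  · rintro (h | ⟨h, h'⟩)
    · exact .inl h
    · exact .inr ⟨h.le, h'⟩

/-- One step of the binary search for the item in variable `21` in the sorted block of length
`26` that starts at `22`. -/
def bitP : Program :=
  .seq (.setI 25 (.add (.var 24) (.load 22 (.sub (.sub (.var 6) (.const 1)) (.var 23)))))
    (.cond (.and (.ile (.var 25) (.var 26))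
        (beforeE (.load 25 (.sub (.add (.var 22) (.var 25)) (.const 1))) (.var 21)))
      (.setI 24 (.var 25)) .skip)

/-- Binary search. -/
def bsearchP : Program := .seq (.setI 24 (.const 0)) (forLoop 23 (.var 6) bitP)

variable {W n L g : ℕ}

/-- The rank `C` is determined bit by bit from the top: after `j` rounds it lies in an interval of
length `2 ^ (L - j)` that starts at variable `24`. `hpw` keeps the tentative values within a word.
-/
theorem run_bsearchP (z : Sizes W n L g) (hpw : 2 ^ L ≤ 2 * (3 * n + 1)) {V : ℕ → ℝ} {s : State}
    (hC : Consts n L g s) (hV : s.rmem 6 = V) {w q : ℕ} (hw : 0 < w)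
    (h22 : s.ivar 22 = q * w) (h26 : s.ivar 26 = w - (q * w + w - 3 * n))
    (hs : ∀ i < 3 * n, s.imem 25 (place (sortKey V) (3 * n) w i) = i) :
    Run W bsearchP s (L * 60 + 20) fun s' => Same 23 ∅ s s' ∧ s'.rmem = s.rmem ∧
      s'.ivar 24 = rankIn (sortKey V) (block (3 * n) w q) (s.ivar 21) := by
  set B := block (3 * n) w q with hB
  set C := rankIn (sortKey V) B (s.ivar 21) with hCdef
  have hcard : B.card = w - (q * w + w - 3 * n) := card_block hw
  have hCle : C ≤ B.card := Finset.card_filter_le _ _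
  have hbn : B.card ≤ 3 * n := by
    refine (Finset.card_filter_le _ _).trans (by simp)
  have hlt := z.lt_pow
  have hSW : 4 * (3 * n + 3) ≤ W := by
    refine le_trans ?_ (z.pow_le_W (j := 2) (by omega)); nlinarith [z.n_pos]
  -- The item of rank `k - 1` stands at offset `k - 1` in its block, and it precedes the searched
  -- item exactly if `k - 1 < C`.
  have key : ∀ k, 0 < k → k ≤ B.card →
      (sortKey V (s.imem 25 (q * w + k - 1)) < sortKey V (s.ivar 21) ↔ k ≤ C) := by
    intro k hk hkc
    obtain ⟨x, hx, hxk⟩ := exists_rankIn_eq (sortKey_injective V) (show k - 1 < B.card by omega)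
    obtain ⟨hx1, hx2⟩ := mem_block.1 hx
    have := hs x hx1
    rw [place, hx2, ← hB, hxk, ← Nat.add_sub_assoc hk] at this
    rw [this, lt_iff_rankIn_lt hx, hxk]; omega
  refine Run.mono (Run.seq' (Run.setI (x := 24) (by simp [IExpr.eval])
    (Q := fun s' => s' = s.setI 24 0) rfl) fun s₁ h₁ =>
    (Run.for (T := 50) (fun j s' => Same 23 ∅ s s' ∧ s'.rmem = s.rmem ∧ s'.ivar 26 = s.ivar 26 ∧
      s'.ivar 24 ≤ C ∧ C < s'.ivar 24 + 2 ^ (L - j)) L (by have := z.L_le; have := z.S_le; omega)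
      ?_ ?_ ?_).mono le_rfl fun s' ⟨_, h⟩ => ⟨h.1, h.2.1, ?_⟩) ?_ fun _ h => h
  · subst h₁
    refine ⟨(Same.setI (k := 23) (A := ∅)).then_setI, rfl, by simp,
      by simp, ?_⟩
    simp; omega
  · rintro j hj s' h23 ⟨hsame, hr, h26', hle, hlt'⟩
    have hC' := hC.same hsame
    have hp : s'.imem 22 (L - 1 - j) = 2 ^ (L - (j + 1)) := by
      rw [hC'.pw _ (by omega)]; congr 1; omega
    have hpl : 2 ^ (L - (j + 1)) ≤ 2 ^ L := Nat.pow_le_pow_right (by omega) (by omega)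
    have hpd : 2 ^ (L - j) = 2 * 2 ^ (L - (j + 1)) := by
      rw [← pow_succ']; congr 1; omega
    have hpp : 0 < 2 ^ (L - (j + 1)) := by positivity
    set u := 2 ^ (L - (j + 1)) with hu
    have heu : (IExpr.add (.var 24) (.load 22 (.sub (.sub (.var 6) (.const 1)) (.var 23)))).eval s'
        = s'.ivar 24 + u := by
      simp only [IExpr.eval, hC'.v6, h23, hp]
    refine Run.mono (Run.seq' (Run.setI (x := 25) (by rw [heu]; omega)
      (Q := fun s₂ => s₂ = s'.setI 25 (s'.ivar 24 + u)) (by rw [heu])) fun s₂ h₂ =>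
      Run.cond (T₁ := 2) (T₂ := 1) (fun hb => ?_) fun hb => ?_) ?_ fun _ h => h
    · subst h₂
      rw [Test.Holds, holds_beforeE (V := V) (by simp [hr, hV])] at hb
      simp only [Test.Holds, IExpr.eval, ivar_setI, imem_setI, if_true] at hb
      norm_num at hb
      rw [h26', h26, hsame.1 22 (by omega), hsame.1 21 (by omega), hsame.2 25 (by simp), h22,
        ← hcard] at hb
      rw [key _ (by omega) hb.1] at hb
      refine Run.setI (by simp [IExpr.eval]; omega) ?_
      simp only [IExpr.eval, ivar_setI, if_true]
      norm_num
      exact ⟨h23, ((hsame.then_setI).then_setI).then_setI, hr, h26', hb.2, by omega⟩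
    · subst h₂
      rw [Test.Holds, holds_beforeE (V := V) (by simp [hr, hV])] at hb
      simp only [Test.Holds, IExpr.eval, ivar_setI, imem_setI, if_true] at hb
      norm_num at hb
      rw [h26', h26, hsame.1 22 (by omega), hsame.1 21 (by omega), hsame.2 25 (by simp), h22,
        ← hcard] at hb
      have : C < s'.ivar 24 + u := by
        by_cases hc : s'.ivar 24 + u ≤ B.card
        · have h2 := hb hc
          rw [← not_lt, key _ (by omega) hc] at h2
          omega
        · omega
      refine Run.skip ?_
      simp only [ivar_setI]
      norm_num
      exact ⟨h23, ((hsame.then_setI).then_setI), hr, h26', hle, this⟩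
    · simp only [Test.cost, beforeE, IExpr.cost, RExpr.cost]; omega
  · rintro j hj s' h23 ⟨hsame, -⟩
    exact (hC.same hsame).v6
  · simp only [IExpr.cost]; omega
  · have := h.2.2.2
    simp at this
    omega

end ThreeCover

/-! ### Merge sort by adding ranks -/

namespace ThreeCover
open RealRAM

/-- The block length of the current level. -/
def lenE : IExpr := .load 22 (.var 20)

/-- Add to the rank of the item in variable `21` its rank in the sibling block. -/
def addRankP : Program :=
  .seq (.setI 22 (.mul (.sub (.add (.div (.var 21) lenE) (.const 1))
      (.mul (.const 2) (.mod (.div (.var 21) lenE) (.const 2)))) lenE))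
    (.seq (.setI 26 (.sub lenE (.sub (.add (.var 22) lenE) (.sub (.var 5) (.const 1)))))
      (.seq bsearchP (.storeI 24 (.var 21) (.add (.load 24 (.var 21)) (.var 24)))))

/-- Move the item in variable `21` to its place in the blocks of double length. -/
def moveP : Program :=
  .storeI 25 (.add (.mul (.div (.var 21) (.mul lenE (.const 2))) (.mul lenE (.const 2)))
    (.load 24 (.var 21))) (.var 21)

/-- Merge pairs of blocks. -/
def levelP : Program :=
  .seq (forLoop 21 (.sub (.var 5) (.const 1)) addRankP)
    (forLoop 21 (.sub (.var 5) (.const 1)) moveP)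

/-- Compute the ranks of all items. -/
def sortP : Program :=
  .seq (forLoop 21 (.sub (.var 5) (.const 1))
      (.seq (.storeI 24 (.var 21) (.const 0)) (.storeI 25 (.var 21) (.var 21))))
    (forLoop 20 (.var 6) levelP)

variable {W n L g : ℕ}

/-- The blocks of length `w` are sorted. -/
structure BlocksSorted (n w : ℕ) (V : ℕ → ℝ) (s : State) : Prop where
  rank : ∀ i < 3 * n, s.imem 24 i = rankIn (sortKey V) (block (3 * n) w (i / w)) i
  item : ∀ i < 3 * n, s.imem 25 (place (sortKey V) (3 * n) w i) = i

theorem sibling_mul_le {i w : ℕ} : sibling (i / w) * w ≤ i + w := by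
  have h : sibling (i / w) ≤ i / w + 1 := Nat.sub_le _ _
  refine (Nat.mul_le_mul_right w h).trans ?_
  rw [Nat.succ_mul]
  have := Nat.div_mul_le_self i w
  omega

theorem run_addRankP (z : Sizes W n L g) (hpw : 2 ^ L ≤ 2 * (3 * n + 1)) {V : ℕ → ℝ} {s : State}
    (hC : Consts n L g s) (hV : s.rmem 6 = V) (hl : s.ivar 20 < L) (hi : s.ivar 21 < 3 * n)
    (hrk : s.imem 24 (s.ivar 21) ≤ 3 * n)
    (hs : ∀ i < 3 * n, s.imem 25 (place (sortKey V) (3 * n) (2 ^ s.ivar 20) i) = i) :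
    Run W addRankP s (L * 60 + 100) fun s' => ∃ s₁, Same 22 ∅ s s₁ ∧ s'.rmem = s.rmem ∧
      s' = s₁.storeI 24 (s.ivar 21) (s.imem 24 (s.ivar 21) + rankIn (sortKey V)
        (block (3 * n) (2 ^ s.ivar 20) (sibling (s.ivar 21 / 2 ^ s.ivar 20))) (s.ivar 21)) := by
  have hw : 0 < 2 ^ s.ivar 20 := by positivity
  have hp := hC.pw _ hl
  have hwL : 2 ^ s.ivar 20 ≤ 2 ^ L := Nat.pow_le_pow_right (by omega) hl.le
  have hSW : 4 * (3 * n + 3) ≤ W := by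
    refine le_trans ?_ (z.pow_le_W (j := 2) (by omega)); nlinarith [z.n_pos]
  set w := 2 ^ s.ivar 20 with hwdef
  set i := s.ivar 21 with hidef
  have hsib := sibling_mul_le (i := i) (w := w)
  have hR : rankIn (sortKey V) (block (3 * n) w (sibling (i / w))) i ≤ 3 * n :=
    (Finset.card_filter_le _ _).trans ((Finset.card_filter_le _ _).trans (by simp))
  have e1 : ∀ s', (IExpr.mul (.sub (.add (.div (.var 21) lenE) (.const 1))
      (.mul (.const 2) (.mod (.div (.var 21) lenE) (.const 2)))) lenE).eval s' =
      sibling (s'.ivar 21 / s'.imem 22 (s'.ivar 20)) * s'.imem 22 (s'.ivar 20) := fun _ => rfl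
  refine Run.mono (Run.seq' (Run.setI (by rw [e1, hp, ← hidef]; omega)
    (Q := fun s₁ => s₁ = s.setI 22 (sibling (i / w) * w)) (by rw [e1, hp])) fun s₁ h₁ =>
    Run.seq' (Run.setI (by simp only [IExpr.eval, h₁, lenE, imem_setI, ivar_setI]; norm_num
                           rw [hp]; clear * - hwL hpw hSW hsib; omega)
    (Q := fun s₂ => s₂ = s₁.setI 26 (w - (sibling (i / w) * w + w - 3 * n))) ?_) fun s₂ h₂ =>
    Run.seq' (run_bsearchP z hpw (V := V) (w := w) (q := sibling (i / w))
      (hC.same (show Same 22 ∅ s s₂ by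
        rw [h₂, h₁]; exact (Same.setI (k := 22) (A := ∅)).then_setI)) (h₂ ▸ h₁ ▸ hV) hw
      (by simp [h₂, h₁]) (by simp [h₂]) (by simpa [h₂, h₁] using hs))
    fun s₃ ⟨h₃, hr, hv⟩ => Run.storeI ?_ ?_) ?_ fun _ h => h
  · subst h₁
    simp only [IExpr.eval, lenE, imem_setI, ivar_setI]; norm_num
    rw [hp, hC.v5]; rfl
  · have h13 : Same 22 ∅ s s₃ := (h₂ ▸ h₁ ▸ (Same.setI (k := 22) (A := ∅)).then_setI).trans h₃
    have h31 : s₃.ivar 21 = i := h13.1 _ (by omega)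
    have h21 : s₂.ivar 21 = i := by simp [h₂, h₁, hidef]
    simp only [IExpr.eval, h31, hv, h21, h13.2 24 (by simp)]; omega
  · have h13 : Same 22 ∅ s s₃ := (h₂ ▸ h₁ ▸ (Same.setI (k := 22) (A := ∅)).then_setI).trans h₃
    have h31 : s₃.ivar 21 = i := h13.1 _ (by omega)
    have h21 : s₂.ivar 21 = i := by simp [h₂, h₁, hidef]
    simp only [IExpr.eval, h31, hv, h21, h13.2 24 (by simp)]
    exact ⟨s₃, h13, by rw [rmem_storeI, hr, h₂, h₁]; rfl, rfl⟩
  · simp only [IExpr.cost, lenE]; omega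

/-- Updating the ranks in place is safe, because each search reads the old order in array `25` and
only its own entry of array `24`. The new order is written once all ranks are known, and `place_inj`
prevents overwriting. -/
theorem run_levelP (z : Sizes W n L g) (hpw : 2 ^ L ≤ 2 * (3 * n + 1)) {V : ℕ → ℝ} {s : State}
    (hC : Consts n L g s) (hV : s.rmem 6 = V) (hl : s.ivar 20 < L)
    (hs : BlocksSorted n (2 ^ s.ivar 20) V s) :
    Run W levelP s (3 * n * (L * 60 + 200) + 50) fun s' => Same 21 {24, 25} s s' ∧
      s'.rmem = s.rmem ∧ BlocksSorted n (2 ^ (s.ivar 20 + 1)) V s' := by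
  have hw : 0 < 2 ^ s.ivar 20 := by positivity
  set w := 2 ^ s.ivar 20 with hwdef
  have hSW : 4 * (3 * n + 3) ≤ W := by
    refine le_trans ?_ (z.pow_le_W (j := 2) (by omega)); nlinarith [z.n_pos]
  have hcard : ∀ q i, rankIn (sortKey V) (block (3 * n) w q) i ≤ 3 * n := fun q i =>
    (Finset.card_filter_le _ _).trans ((Finset.card_filter_le _ _).trans (by simp))
  have hwle : w * 2 ≤ 2 ^ L := by
    rw [hwdef, ← pow_succ]; exact Nat.pow_le_pow_right (by omega) hl
  have he : ∀ s', Same 21 {24, 25} s s' → (IExpr.sub (.var 5) (.const 1)).eval s' = 3 * n :=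
    fun s' h => by simp [IExpr.eval, h.1 5 (by omega), hC.v5]
  have hlt := fun i (hi : i < 3 * n) => rankIn_block_lt (κ := sortKey V) (w := w * 2) (by omega) hi
  refine Run.mono (Run.seq' (Run.for (T := L * 60 + 100) (fun i s' => Same 21 {24, 25} s s' ∧
      s'.rmem = s.rmem ∧ s'.imem 25 = s.imem 25 ∧
      ∀ j < 3 * n, s'.imem 24 j = if j < i then
        rankIn (sortKey V) (block (3 * n) (w * 2) (j / (w * 2))) j else s.imem 24 j) (3 * n)
      (by omega) ?_ ?_ ?_) fun s₁ ⟨_, h₁, hr₁, h25, h24⟩ =>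
    (Run.for (T := 20) (fun i s' => Same 21 {24, 25} s s' ∧
      s'.rmem = s.rmem ∧ s'.imem 24 = s₁.imem 24 ∧
      ∀ j < i, s'.imem 25 (place (sortKey V) (3 * n) (w * 2) j) = j) (3 * n)
      (by omega) ?_ ?_ ?_).mono le_rfl fun s' ⟨_, h, hr, h24', h25'⟩ => ⟨h, hr, ?_⟩)
    ?_ fun _ h => h
  · exact ⟨Same.setI, rfl, rfl, by simp⟩
  · rintro i hi s' h21 ⟨hsame, hr, h25, h24⟩
    have h20 := hsame.1 20 (by omega)
    have h24i : s'.imem 24 i = rankIn (sortKey V) (block (3 * n) w (i / w)) i := by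
      rw [h24 i hi, if_neg (lt_irrefl _), hs.rank i hi]
    refine Run.mono (run_addRankP z hpw (V := V) (hC.same hsame) (by rw [hr, hV]) (by omega)
      (by omega) (by rw [h21, h24i]; exact hcard _ _) (by rw [h20, h25]; exact hs.item))
      le_rfl ?_
    rintro s'' ⟨s₁, h₁, hr', rfl⟩
    refine ⟨(h₁.1 21 (by omega)).trans h21, ((hsame.trans h₁).then_storeI).then_setI,
      hr'.trans hr, ?_, fun j hj => ?_⟩
    · rw [imem_setI, imem_storeI, if_neg (by omega), h₁.2 _ (by simp), h25]
    · rw [imem_setI, imem_storeI_apply, h₁.2 _ (by simp), h21, h24i, h20, ← hwdef,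
        ← rankIn_block_double, h24 j hj]
      rcases eq_or_ne j i with rfl | hne
      · simp
      · rw [if_neg (by tauto)]
        exact if_congr (by omega) rfl rfl
  · rintro i hi s' h21 ⟨hsame, -⟩
    exact he s' hsame
  · exact ⟨h₁.then_setI, hr₁, rfl, by simp⟩
  · rintro i hi s' h21 ⟨hsame, hr, h24', h25'⟩
    have hp := hC.pw _ hl
    have e1 : (IExpr.add (.mul (.div (.var 21) (.mul lenE (.const 2))) (.mul lenE (.const 2)))
        (.load 24 (.var 21))).eval s' = place (sortKey V) (3 * n) (w * 2) i := by
      simp only [IExpr.eval, lenE, h21, hsame.1 20 (by omega), hsame.2 22 (by simp), hp, h24',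
        h24 i hi, if_pos hi, place, ← hwdef]
    refine Run.mono (Run.storeI (by simp only [IExpr.eval, h21]; omega)
      (Q := fun s'' => s'' = s'.storeI 25 (place (sortKey V) (3 * n) (w * 2) i) i)
      (by rw [e1]; simp only [IExpr.eval, h21])) (by simp [IExpr.cost, lenE]) ?_
    rintro _ rfl
    refine ⟨h21, (hsame.then_storeI).then_setI, hr, ?_, fun j hj => ?_⟩
    · rw [imem_setI, imem_storeI, if_neg (by omega), h24']
    · rw [imem_setI, imem_storeI_apply]
      split_ifs with hc
      · exact (place_inj (sortKey_injective V) (by omega) (by omega) hi hc.2).symm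
      · refine h25' j (lt_of_le_of_ne (Nat.lt_succ_iff.1 hj) ?_)
        rintro rfl; exact hc ⟨rfl, rfl⟩
  · rintro i hi s' h21 ⟨hsame, -⟩
    exact he s' hsame
  · simp only [IExpr.cost]; ring_nf; omega
  · rw [pow_succ, ← hwdef]
    exact ⟨fun i hi => by rw [h24', h24 i hi, if_pos hi], h25'⟩

theorem run_sortP (z : Sizes W n L g) (hpw : 2 ^ L ≤ 2 * (3 * n + 1)) {V : ℕ → ℝ} {s : State}
    (hC : Consts n L g s) (hV : s.rmem 6 = V) :
    Run W sortP s (L * (3 * n * (L * 60 + 200) + 60) + 3 * n * 40 + 50) fun s' =>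
      Same 20 {24, 25} s s' ∧ s'.rmem = s.rmem ∧
      ∀ i < 3 * n, s'.imem 24 i = rankIn (sortKey V) (Finset.range (3 * n)) i := by
  have hSW := z.S_le
  have hlt := z.lt_pow
  refine Run.mono (Run.seq' (Run.for (T := 10) (fun i s' => Same 20 {24, 25} s s' ∧
      s'.rmem = s.rmem ∧ ∀ j < i, s'.imem 24 j = 0 ∧ s'.imem 25 j = j) (3 * n)
      (by omega) ?_ ?_ ?_) fun s₁ ⟨_, h₁, hr₁, hj⟩ =>
    (Run.for (T := 3 * n * (L * 60 + 200) + 50) (fun l s' => Same 20 {24, 25} s s' ∧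
      s'.rmem = s.rmem ∧ BlocksSorted n (2 ^ l) V s') L
      (by have := z.L_le; omega) ?_ ?_ ?_).mono le_rfl fun s' ⟨_, h, hr, hb⟩ => ⟨h, hr, ?_⟩)
    ?_ fun _ h => h
  · exact ⟨Same.setI, rfl, by simp⟩
  · rintro i hi s' h21 ⟨hsame, hr, hj⟩
    refine Run.mono (Run.seq (T₁ := 3) (T₂ := 3) (Run.storeI ?_ (Run.storeI ?_ ?_))) (by omega)
      fun _ h => h
    · simp [IExpr.eval]
    · simp only [IExpr.eval, ivar_storeI, h21]; omega
    · simp only [IExpr.eval, ivar_storeI, h21]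
      refine ⟨trivial, ((hsame.then_storeI).then_storeI).then_setI, hr, fun j hj' => ?_⟩
      simp only [imem_setI, imem_storeI_apply]
      norm_num
      rcases eq_or_ne j i with rfl | hne
      · simp
      · simpa [hne] using hj j (by omega)
  · rintro i hi s' h21 ⟨hsame, -⟩
    simp [IExpr.eval, hsame.1 5 (by omega), hC.v5]
  · refine ⟨h₁.then_setI, hr₁, ⟨fun i hi => ?_, fun i hi => ?_⟩⟩
    · rw [pow_zero, rankIn_block_one]; exact (hj i hi).1
    · rw [place, pow_zero, rankIn_block_one]; simpa using (hj i hi).2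
  · rintro i hi s' h20 ⟨hsame, hr, hb⟩
    refine Run.mono (run_levelP z hpw (hC.same hsame) (by rw [hr, hV]) (by omega)
      (by rw [h20]; exact hb)) le_rfl ?_
    rintro s'' ⟨h'', hr'', hb''⟩
    rw [h20] at hb''
    exact ⟨(h''.1 20 (by omega)).trans h20, (hsame.trans h'').then_setI, hr''.trans hr,
      ⟨hb''.rank, hb''.item⟩⟩
  · rintro i hi s' h21 ⟨hsame, -⟩
    simp [IExpr.eval, hsame.1 6 (by omega), hC.v6]
  · simp only [IExpr.cost]; ring_nf; omega
  -- Since `3 * n < 2 ^ L`, the blocks of the last level amount to one block of all items.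
  · intro i hi
    rw [hb.rank i hi]
    congr 1
    ext j
    rw [mem_block, Finset.mem_range, and_iff_left_iff_imp]
    intro hj
    rw [Nat.div_eq_of_lt (by omega), Nat.div_eq_of_lt (by omega)]

end ThreeCover

namespace ThreeCover
open RealRAM

/-! ### Ranks of points and sides of rectangles -/

/-- Array `6` holds the intended values only in its first `3 * n` cells, so ranks must be seen to
depend on the order within `S` alone. -/
theorem rankIn_congr {α β : Type*} [LinearOrder α] [LinearOrder β] {κ : ℕ → α} {κ' : ℕ → β}
    {S : Finset ℕ} {x : ℕ} (h : ∀ j ∈ S, κ j < κ x ↔ κ' j < κ' x) :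
    rankIn κ S x = rankIn κ' S x :=
  congrArg Finset.card (Finset.filter_congr h)

/-- The rank among the low sides, the points and the high sides along one axis. -/
noncomputable def axisRank (n : ℕ) (V : ℕ → ℝ) (i : ℕ) : ℕ :=
  rankIn (sortKey V) (Finset.range (3 * n)) i

theorem axisRank_lt {n : ℕ} {V : ℕ → ℝ} {i : ℕ} (hi : i < 3 * n) : axisRank n V i < 3 * n := by
  simpa [axisRank] using rankIn_lt_card (κ := sortKey V) (Finset.mem_range.2 hi)

theorem axisRank_inj {n : ℕ} {V : ℕ → ℝ} {i j : ℕ} (hi : i < 3 * n) (hj : j < 3 * n)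
    (h : axisRank n V i = axisRank n V j) : i = j :=
  rankIn_inj (sortKey_injective V) (Finset.mem_range.2 hi) (Finset.mem_range.2 hj) h

theorem axisRank_lt_iff {n : ℕ} {V : ℕ → ℝ} {i j : ℕ} (hi : i < 3 * n) :
    axisRank n V i < axisRank n V j ↔ V i < V j ∨ V i = V j ∧ i < j := by
  rw [← sortKey_lt, lt_iff_rankIn_lt (κ := sortKey V) (Finset.mem_range.2 hi)]; rfl

/-- The position of a point in a direction. -/
noncomputable def posOf (n : ℕ) (V : ℕ → ℕ → ℝ) (d : Fin 4) (i : ℕ) : ℕ :=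
  if (d : ℕ) % 2 = 0 then axisRank n (V (d / 2)) (n + i) + 1
  else 3 * n - axisRank n (V (d / 2)) (n + i)

/-- The extent of a rectangle in a direction. -/
noncomputable def extOf (n : ℕ) (V : ℕ → ℕ → ℝ) (d : Fin 4) (i : ℕ) : ℕ :=
  if (d : ℕ) % 2 = 0 then axisRank n (V (d / 2)) (2 * n + i) + 1
  else 3 * n - axisRank n (V (d / 2)) i

/-- Even directions count ranks from below, odd ones from above. The shift by one makes everything
positive and opposite positions add up to `3 * n + 1`. Points and sides are different items of one
sorted family, hence never level. -/
theorem ranks_posOf (n : ℕ) (V : ℕ → ℕ → ℝ) :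
    Ranks n (3 * n + 1) (posOf n V) (extOf n V) := by
  constructor
  · intro d i hi
    have := axisRank_lt (V := V (d / 2)) (show n + i < 3 * n by omega)
    unfold posOf; split_ifs <;> omega
  · intro d i hi
    have := axisRank_lt (V := V (d / 2)) (show n + i < 3 * n by omega)
    unfold posOf; split_ifs <;> omega
  · intro d i hi
    have := axisRank_lt (V := V (d / 2)) (show i < 3 * n by omega)
    unfold extOf; split_ifs <;> omega
  · intro d i hi
    have := axisRank_lt (V := V (d / 2)) (show 2 * n + i < 3 * n by omega)
    unfold extOf; split_ifs <;> omega
  · intro d i hi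
    have h0 := axisRank_lt (V := V 0) (show n + i < 3 * n by omega)
    have h1 := axisRank_lt (V := V 1) (show n + i < 3 * n by omega)
    fin_cases d <;> simp [posOf, opp] <;> omega
  · intro d i hi j hj
    have h0 := axisRank_lt (V := V (d / 2)) (show n + i < 3 * n by omega)
    have h1 := axisRank_lt (V := V (d / 2)) (show j < 3 * n by omega)
    unfold posOf extOf
    split_ifs with hd
    · intro h
      have := axisRank_inj (V := V (d / 2)) (show n + i < 3 * n by omega)
        (show 2 * n + j < 3 * n by omega) (by omega)
      omega
    · intro h
      have := axisRank_inj (V := V (d / 2)) (show n + i < 3 * n by omega)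
        (show j < 3 * n by omega) (by omega)
      omega
  · intro d i hi j hj
    have h0 := axisRank_lt (V := V (d / 2)) (show i < 3 * n by omega)
    have h1 := axisRank_lt (V := V (d / 2)) (show j < 3 * n by omega)
    unfold extOf
    split_ifs with hd
    · intro h
      have := axisRank_inj (V := V (d / 2)) (show 2 * n + i < 3 * n by omega)
        (show 2 * n + j < 3 * n by omega) (by omega)
      omega
    · intro h
      exact axisRank_inj (V := V (d / 2)) (show i < 3 * n by omega)
        (show j < 3 * n by omega) (by omega)

/-- Ties are broken by item number, and low sides are numbered before points and points before high
sides. Hence the strict order of ranks expresses the weak inequalities of closed rectangles. -/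
theorem in_iff {n : ℕ} {V : ℕ → ℕ → ℝ} {p r : ℕ} (hp : p < n) (hr : r < n) :
    In (posOf n V) (extOf n V) p r ↔ ∀ a < 2, V a r ≤ V a (n + p) ∧ V a (n + p) ≤ V a (2 * n + r) := by
  have even : ∀ a, axisRank n (V a) (n + p) + 1 < axisRank n (V a) (2 * n + r) + 1 ↔
      V a (n + p) ≤ V a (2 * n + r) := fun a => by
    rw [Nat.add_lt_add_iff_right, axisRank_lt_iff (by omega), le_iff_lt_or_eq]
    simp [show n + p < 2 * n + r by omega]
  have odd : ∀ a, 3 * n - axisRank n (V a) (n + p) < 3 * n - axisRank n (V a) r ↔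
      V a r ≤ V a (n + p) := fun a => by
    have h1 := axisRank_lt (V := V a) (show n + p < 3 * n by omega)
    have h2 := axisRank_lt (V := V a) (show r < 3 * n by omega)
    rw [show (3 * n - axisRank n (V a) (n + p) < 3 * n - axisRank n (V a) r) ↔
      axisRank n (V a) r < axisRank n (V a) (n + p) by omega, axisRank_lt_iff (by omega),
      le_iff_lt_or_eq]
    simp [show r < n + p by omega]
  unfold In
  constructor
  · intro h a ha
    have h0 := h 0
    have h1 := h 1
    have h2 := h 2
    have h3 := h 3
    simp [posOf, extOf] at h0 h1 h2 h3
    interval_cases a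
    · exact ⟨(odd 0).1 h1, (even 0).1 (by omega)⟩
    · exact ⟨(odd 1).1 h3, (even 1).1 (by omega)⟩
  · intro h d
    have h0 := h 0 (by omega)
    have h1 := h 1 (by omega)
    fin_cases d
    · simpa [posOf, extOf] using (even 0).2 h0.2
    · simpa [posOf, extOf] using (odd 0).2 h0.1
    · simpa [posOf, extOf] using (even 1).2 h1.2
    · simpa [posOf, extOf] using (odd 1).2 h1.1

/-- The position of the point in variable `21` in the direction `d`. -/
def posE (d : ℕ) : IExpr :=
  if d % 2 = 0 then .add (.load 24 (.add (.var 4) (.var 21))) (.const 1)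
  else .sub (.sub (.var 5) (.const 1)) (.load 24 (.add (.var 4) (.var 21)))

/-- The extent of the rectangle in variable `21` in the direction `d`. -/
def extE (d : ℕ) : IExpr :=
  if d % 2 = 0 then .add (.load 24 (.add (.mul (.const 2) (.var 4)) (.var 21))) (.const 1)
  else .sub (.sub (.var 5) (.const 1)) (.load 24 (.var 21))

/-- Store the positions and extents in the direction `d`. -/
def dirP (d : ℕ) : Program :=
  forLoop 21 (.var 4) (.seq (.storeI (10 + d) (.var 21) (posE d))
    (.seq (.storeI (14 + d) (.var 21) (extE d))
      (.storeI (18 + d) (extE d) (.add (.var 21) (.const 1)))))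

/-- Positions and extents in the direction `d` are stored. -/
structure DirTab (n : ℕ) (pos ext : ℕ → ℕ) (d : ℕ) (s : State) : Prop where
  posA : ∀ i < n, s.imem (10 + d) i = pos i
  extA : ∀ i < n, s.imem (14 + d) i = ext i
  invA : ∀ i < n, s.imem (18 + d) (ext i) = i + 1
  inv_le : ∀ k, s.imem (18 + d) k ≤ n

theorem DirTab.same {n k d : ℕ} {A : Set ℕ} {pos ext : ℕ → ℕ} {s s' : State}
    (h : DirTab n pos ext d s) (hs : Same k A s s') (h1 : 10 + d ∉ A) (h2 : 14 + d ∉ A)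
    (h3 : 18 + d ∉ A) : DirTab n pos ext d s' := by
  constructor
  · rw [hs.2 _ h1]; exact h.posA
  · rw [hs.2 _ h2]; exact h.extA
  · rw [hs.2 _ h3]; exact h.invA
  · rw [hs.2 _ h3]; exact h.inv_le

variable {W n L g : ℕ}

theorem run_dirP (z : Sizes W n L g) {V : ℕ → ℕ → ℝ} {s : State} (d : Fin 4)
    (hC : Consts n L g s) (hrk : ∀ i < 3 * n, s.imem 24 i = axisRank n (V (d / 2)) i)
    (h0 : ∀ k, s.imem (18 + d) k = 0) :
    Run W (dirP d) s (n * 70 + 10) fun s' => Same 20 {10 + (d : ℕ), 14 + (d : ℕ), 18 + (d : ℕ)} s s' ∧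
      s'.rmem = s.rmem ∧ DirTab n (posOf n V d) (extOf n V d) d s' := by
  have hSW := z.S_le
  have R := ranks_posOf n V
  have hd : (d : ℕ) < 4 := d.2
  refine Run.mono (Run.for (T := 50) (fun i s' =>
    Same 20 {10 + (d : ℕ), 14 + (d : ℕ), 18 + (d : ℕ)} s s' ∧ s'.rmem = s.rmem ∧
    (∀ j < i, s'.imem (10 + d) j = posOf n V d j) ∧ (∀ j < i, s'.imem (14 + d) j = extOf n V d j) ∧
    (∀ j < i, s'.imem (18 + d) (extOf n V d j) = j + 1) ∧ ∀ k, s'.imem (18 + d) k ≤ n) n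
    (by omega) ?_ ?_ ?_) ?_ fun s' ⟨_, h1, h2, h3, h4, h5, h6⟩ => ⟨h1, h2, h3, h4, h5, h6⟩
  · exact ⟨Same.setI, rfl, by simp, by simp, by simp, by simp [h0]⟩
  · rintro i hi s' h21 ⟨hsame, hr, hp, he, hv, hle⟩
    have hpE : ∀ s'', Same 20 {10 + (d : ℕ), 14 + (d : ℕ), 18 + (d : ℕ)} s s'' → s''.ivar 21 = i →
        (posE d).eval s'' = posOf n V d i := by
      intro s'' hs h21
      have := hs.2 24 (by simp; omega)
      unfold posE posOf
      split_ifs <;>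
      simp [IExpr.eval, h21, hs.1 4 (by omega), hs.1 5 (by omega), hC.v4, hC.v5, this,
        hrk (n + i) (by omega)]
    have heE : ∀ s'', Same 20 {10 + (d : ℕ), 14 + (d : ℕ), 18 + (d : ℕ)} s s'' → s''.ivar 21 = i →
        (extE d).eval s'' = extOf n V d i := by
      intro s'' hs h21
      have := hs.2 24 (by simp; omega)
      unfold extE extOf
      split_ifs <;>
      simp [IExpr.eval, h21, hs.1 4 (by omega), hs.1 5 (by omega), hC.v4, hC.v5, this,
        hrk i (by omega), hrk (2 * n + i) (by omega)]
    have hpW := R.pos_lt d i hi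
    have heW := R.ext_lt d i hi
    have s1 : Same 20 {10 + (d : ℕ), 14 + (d : ℕ), 18 + (d : ℕ)} s
      (s'.storeI (10 + d) i (posOf n V d i)) := hsame.then_storeI
    have s2 := s1.then_storeI (a := 14 + d) (i := i) (v := extOf n V d i)
    have s3 := s2.then_storeI (a := 18 + d) (i := extOf n V d i) (v := i + 1)
    refine Run.mono (Run.seq' (Run.storeI (by rw [hpE _ hsame h21]; omega)
      (Q := fun s₁ => s₁ = s'.storeI (10 + d) i (posOf n V d i))
      (by rw [hpE _ hsame h21]; simp [IExpr.eval, h21])) fun s₁ h₁ =>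
      Run.seq' (Run.storeI (by rw [heE _ (h₁ ▸ s1) (h₁ ▸ h21)]; omega)
      (Q := fun s₂ => s₂ = s₁.storeI (14 + d) i (extOf n V d i))
      (by rw [heE _ (h₁ ▸ s1) (h₁ ▸ h21)]; simp [IExpr.eval, h21, h₁])) fun s₂ h₂ =>
      Run.storeI ?_ ?_) ?_ fun _ h => h
    · simp only [IExpr.eval, h₁, h₂, ivar_storeI, h21]; omega
    · subst h₁
      subst h₂
      rw [heE _ s2 h21]
      simp only [IExpr.eval, ivar_storeI, h21]
      refine ⟨trivial, s3.then_setI, hr, fun j hj => ?_, fun j hj => ?_, fun j hj => ?_, fun k => ?_⟩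
      · simp only [imem_setI, imem_storeI_apply]
        rw [if_neg (by omega), if_neg (by omega)]
        by_cases hc : j = i
        · rw [if_pos ⟨trivial, hc⟩, hc]
        · rw [if_neg (by tauto)]
          exact hp j (by omega)
      · simp only [imem_setI, imem_storeI_apply]
        rw [if_neg (by omega)]
        by_cases hc : j = i
        · rw [if_pos ⟨trivial, hc⟩, hc]
        · rw [if_neg (by tauto), if_neg (by omega)]
          exact he j (by omega)
      · simp only [imem_setI, imem_storeI_apply]
        by_cases hc : j = i
        · rw [if_pos ⟨trivial, by rw [hc]⟩, hc]
        -- Distinct rectangles have distinct extents, so an entry of the inverse array is never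
        -- overwritten.
        · rw [if_neg fun h => hc (R.inj d j (by omega) i hi h.2), if_neg (by omega),
            if_neg (by omega)]
          exact hv j (by omega)
      · simp only [imem_setI, imem_storeI_apply]
        by_cases hc : k = extOf n V d i
        · rw [if_pos ⟨trivial, hc⟩]; omega
        · rw [if_neg (by tauto), if_neg (by omega), if_neg (by omega)]
          exact hle k
    · have h1 : (posE d).cost ≤ 8 := by unfold posE; split_ifs <;> simp [IExpr.cost]
      have h2 : (extE d).cost ≤ 8 := by unfold extE; split_ifs <;> simp [IExpr.cost]
      simp only [IExpr.cost]; omega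
  · rintro i hi s' h21 ⟨hsame, -⟩
    exact (hsame.1 4 (by omega)).trans hC.v4
  · simp only [IExpr.cost]; omega

/-- Collect the coordinates along an axis in one array. -/
def copyP (pt lo hi : ℕ) : Program :=
  forLoop 21 (.var 4) (.seq (.storeR 6 (.var 21) (.load lo (.var 21)))
    (.seq (.storeR 6 (.add (.var 4) (.var 21)) (.load pt (.var 21)))
      (.storeR 6 (.add (.mul (.const 2) (.var 4)) (.var 21)) (.load hi (.var 21)))))

/-- The low sides, the points, and the high sides. -/
def axisVal (n : ℕ) (pt lo hi : ℕ → ℝ) (j : ℕ) : ℝ :=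
  if j < n then lo j else if j < 2 * n then pt (j - n) else hi (j - 2 * n)

theorem run_copyP (z : Sizes W n L g) {s : State} (hC : Consts n L g s) {pt lo hi : ℕ}
    (hpt : pt < 6) (hlo : lo < 6) (hhi : hi < 6) :
    Run W (copyP pt lo hi) s (n * 40 + 10) fun s' => Same 20 ∅ s s' ∧
      (∀ b < 6, s'.rmem b = s.rmem b) ∧
      ∀ j < 3 * n, s'.rmem 6 j = axisVal n (s.rmem pt) (s.rmem lo) (s.rmem hi) j := by
  have hSW := z.S_le
  refine Run.mono (Run.for (T := 30) (fun i s' => Same 20 ∅ s s' ∧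
    (∀ b < 6, s'.rmem b = s.rmem b) ∧ ∀ j < i, s'.rmem 6 j = s.rmem lo j ∧
      s'.rmem 6 (n + j) = s.rmem pt j ∧ s'.rmem 6 (2 * n + j) = s.rmem hi j) n (by omega) ?_ ?_ ?_)
    ?_ fun s' ⟨_, h1, h2, h3⟩ => ⟨h1, h2, fun j hj => ?_⟩
  · exact ⟨Same.setI, fun _ _ => rfl, by simp⟩
  · rintro i hi' s' h21 ⟨hsame, hr, hj⟩
    have h4 := (hsame.1 4 (by omega)).trans hC.v4
    refine Run.mono (Run.seq (T₁ := 4) (T₂ := 6 + 8) (Run.storeR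
      (Run.seq (T₁ := 6) (T₂ := 8) (Run.storeR (Run.storeR ?_)))))
      (by omega) fun _ h => h
    have hne : ∀ (s'' : State) i v b, b < 6 → (s''.storeR 6 i v).rmem b = s''.rmem b := by
      intro s'' i v b hb
      simp [State.storeR, show b ≠ 6 by omega]
    simp only [IExpr.eval, RExpr.eval, ivar_storeR, h21, h4, hne _ _ _ _ hpt, hne _ _ _ _ hhi, hr _ hpt, hr _ hlo, hr _ hhi]
    refine ⟨trivial, ⟨fun x hx => ?_, fun a _ => ?_⟩, fun b hb => ?_, fun j hj' => ?_⟩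
    · simp [show x ≠ 21 by omega, hsame.1 x hx]
    · simp [hsame.2 a]
    · rw [rmem_setI, hne _ _ _ _ hb, hne _ _ _ _ hb, hne _ _ _ _ hb, hr b hb]
    · simp only [rmem_setI, rmem_storeR_apply]
      rcases eq_or_ne j i with rfl | hne'
      · refine ⟨?_, ?_, ?_⟩
        · rw [if_neg (by omega), if_neg (by omega), if_pos ⟨trivial, rfl⟩]
        · rw [if_neg (by omega), if_pos ⟨trivial, rfl⟩]
        · rw [if_pos ⟨trivial, rfl⟩]
      · obtain ⟨h1, h2, h3⟩ := hj j (by omega)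
        refine ⟨?_, ?_, ?_⟩
        · rw [if_neg (by omega), if_neg (by omega), if_neg (by omega), h1]
        · rw [if_neg (by omega), if_neg (by omega), if_neg (by omega), h2]
        · rw [if_neg (by omega), if_neg (by omega), if_neg (by omega), h3]
  · rintro i hi s' h21 ⟨hsame, -⟩
    exact (hsame.1 4 (by omega)).trans hC.v4
  · simp only [IExpr.cost]; omega
  · unfold axisVal
    split_ifs with c1 c2
    · exact (h3 j c1).1
    · have := (h3 (j - n) (by omega)).2.1
      rwa [show n + (j - n) = j by omega] at this
    · have := (h3 (j - 2 * n) (by omega)).2.2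
      rwa [show 2 * n + (j - 2 * n) = j by omega] at this

/-- Compute positions and extents along an axis. -/
def axisP (a pt lo hi : ℕ) : Program :=
  .seq (copyP pt lo hi) (.seq sortP (.seq (dirP (2 * a)) (dirP (2 * a + 1))))

/-- The time for one axis. -/
def axisT (n L : ℕ) : ℕ := L * (3 * n * (L * 60 + 200) + 60) + n * 300 + 100

theorem run_axisP (z : Sizes W n L g) (hpw : 2 ^ L ≤ 2 * (3 * n + 1)) {s : State}
    (hC : Consts n L g s) {a pt lo hi : ℕ} (hpt : pt < 6) (hlo : lo < 6) (hhi : hi < 6)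
    {V : ℕ → ℕ → ℝ} (hV : V a = axisVal n (s.rmem pt) (s.rmem lo) (s.rmem hi)) {d e : Fin 4}
    (hd : (d : ℕ) = 2 * a) (he : (e : ℕ) = 2 * a + 1)
    (hd0 : ∀ k, s.imem (18 + d) k = 0) (he0 : ∀ k, s.imem (18 + e) k = 0) :
    Run W (axisP a pt lo hi) s (axisT n L) fun s' =>
      Same 20 {24, 25, 10 + (d : ℕ), 14 + (d : ℕ), 18 + (d : ℕ), 10 + (e : ℕ), 14 + (e : ℕ),
        18 + (e : ℕ)} s s' ∧ (∀ b < 6, s'.rmem b = s.rmem b) ∧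
      DirTab n (posOf n V d) (extOf n V d) d s' ∧ DirTab n (posOf n V e) (extOf n V e) e s' := by
  unfold axisP
  rw [← he, ← hd]
  have hda : (d : ℕ) / 2 = a := by omega
  have hea : (e : ℕ) / 2 = a := by omega
  refine Run.mono (Run.seq' (run_copyP z hC hpt hlo hhi) fun s₁ ⟨h₁, hr₁, hv₁⟩ =>
    Run.seq' (run_sortP z hpw (hC.same h₁) rfl) fun s₂ ⟨h₂, hr₂, hk⟩ =>
    Run.seq' (run_dirP z (V := V) d ((hC.same h₁).same h₂) ?_ ?_) fun s₃ ⟨h₃, hr₃, ht⟩ =>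
    Run.mono (run_dirP z (V := V) e (((hC.same h₁).same h₂).same h₃ (by omega) ?_) ?_ ?_)
    le_rfl fun s₄ ⟨h₄, hr₄, ht'⟩ => ⟨?_, ?_, ?_, ht'⟩) ?_ fun _ h => h
  · intro i hi
    rw [hk i hi, axisRank]
    refine rankIn_congr fun j hj => ?_
    rw [Finset.mem_range] at hj
    rw [sortKey_lt, sortKey_lt, hv₁ j hj, hv₁ i hi, hda, hV]
  · intro k
    rw [h₂.2 _ (by simp; omega), h₁.2 _ (by simp), hd0]
  · simp; omega
  · intro i hi
    rw [h₃.2 _ (by simp; omega), hk i hi, axisRank]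
    refine rankIn_congr fun j hj => ?_
    rw [Finset.mem_range] at hj
    rw [sortKey_lt, sortKey_lt, hv₁ j hj, hv₁ i hi, hea, hV]
  · intro k
    rw [h₃.2 _ (by simp; omega), h₂.2 _ (by simp; omega), h₁.2 _ (by simp), he0]
  · unfold axisT; ring_nf; omega
  · constructor
    · intro x hx
      rw [h₄.1 x hx, h₃.1 x hx, h₂.1 x hx, h₁.1 x hx]
    · intro b hb
      simp only [Set.mem_insert_iff, Set.mem_singleton_iff, not_or] at hb
      rw [h₄.2 b (by simp; tauto), h₃.2 b (by simp; tauto), h₂.2 b (by simp; tauto),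
        h₁.2 b (by simp)]
  · intro b hb
    rw [hr₄, hr₃, hr₂, hr₁ b hb]
  · exact ht.same h₄ (by simp; omega) (by simp; omega) (by simp; omega)

/-- Compute all positions and extents. -/
def ranksP : Program := .seq (axisP 0 0 2 3) (axisP 1 1 4 5)

/-- The coordinates of the input along the two axes. -/
def inputVal (n : ℕ) (s : State) (a : ℕ) : ℕ → ℝ :=
  if a = 0 then axisVal n (s.rmem 0) (s.rmem 2) (s.rmem 3)
  else axisVal n (s.rmem 1) (s.rmem 4) (s.rmem 5)

theorem run_ranksP (z : Sizes W n L g) (hpw : 2 ^ L ≤ 2 * (3 * n + 1)) {s : State}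
    (hC : Consts n L g s) (h0 : ∀ a ≠ 22, s.imem a = fun _ => 0) :
    Run W ranksP s (2 * axisT n L) fun s' =>
      Env n L g (posOf n (inputVal n s)) (extOf n (inputVal n s)) s' ∧
      ∀ a ≥ 100, s'.imem a = fun _ => 0 := by
  set V := inputVal n s with hVdef
  refine Run.mono (Run.seq' (run_axisP z hpw hC (a := 0) (pt := 0) (lo := 2) (hi := 3) (V := V)
      (d := 0) (e := 1) (by omega) (by omega) (by omega) rfl rfl rfl ?_ ?_)
    fun s₁ ⟨h₁, hr₁, t0, t1⟩ => Run.mono (run_axisP z hpw (hC.same h₁) (a := 1) (pt := 1) (lo := 4)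
      (hi := 5) (V := V) (d := 2) (e := 3) (by omega) (by omega) (by omega) ?_ rfl rfl
      ?_ ?_) le_rfl fun s₂ ⟨h₂, _, t2, t3⟩ => ⟨?_, ?_⟩) (by omega) fun _ h => h
  · simp [h0]
  · simp [h0]
  · rw [hr₁ _ (by omega), hr₁ _ (by omega), hr₁ _ (by omega)]; rfl
  · intro k; rw [h₁.2 _ (by simp), h0 _ (by simp)]
  · intro k; rw [h₁.2 _ (by simp), h0 _ (by simp)]
  · have t0' := t0.same h₂ (by simp) (by simp) (by simp)
    have t1' := t1.same h₂ (by simp) (by simp) (by simp)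
    have T : ∀ d : Fin 4, DirTab n (posOf n V d) (extOf n V d) d s₂ := by
      intro d; fin_cases d
      · exact t0'
      · exact t1'
      · exact t2
      · exact t3
    exact ⟨(hC.same h₁).same h₂, fun d => (T d).posA, fun d => (T d).extA, fun d => (T d).invA,
      fun d => (T d).inv_le⟩
  · intro a ha
    rw [h₂.2 _ (by simp; omega), h₁.2 _ (by simp; omega), h0 _ (by omega)]

end ThreeCover

namespace ThreeCover
open RealRAM

/-! ### Constants -/

/-- The number of levels. -/
def levels (n : ℕ) : ℕ := Nat.log 2 (3 * n + 1) + 1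

/-- Describing the slab size by `n ^ 2 ≤ g ^ 3` lets the machine find it by counting up, with
integer arithmetic only. -/
theorem exists_slabSize (n : ℕ) : ∃ g, n ^ 2 ≤ g ^ 3 :=
  ⟨n, by rcases n.eq_zero_or_pos with rfl | h
         · simp
         · exact Nat.pow_le_pow_right h (by omega)⟩

/-- The slab size, which is `n ^ (2 / 3)` rounded up. -/
def slabSize (n : ℕ) : ℕ := Nat.find (exists_slabSize n)

theorem pow_levels_le (n : ℕ) : 2 ^ levels n ≤ 2 * (3 * n + 1) := by
  rw [levels, pow_succ, mul_comm]
  exact Nat.mul_le_mul_left 2 (Nat.pow_log_le_self 2 (by omega))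

theorem sizes_levels {n : ℕ} (hn : 0 < n) : Sizes ((n + 2) ^ 10) n (levels n) (slabSize n) where
  n_pos := hn
  lt_pow := Nat.lt_pow_succ_log_self (by omega) _
  L_le := Nat.log_lt_self 2 (by omega)
  g_pos := Nat.pos_of_ne_zero fun h => by
    have := Nat.find_spec (exists_slabSize n)
    rw [← slabSize, h] at this
    have := Nat.pow_pos (n := 2) hn
    omega
  g_le := Nat.find_min' _ (Nat.pow_le_pow_right hn (by omega))
  le_W := by
    -- The exponent `10` comes from `3 * n + 3 ≤ (n + 2) ^ 2`, raised to the fifth power.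
    rw [show (n + 2) ^ 10 = ((n + 2) ^ 2) ^ 5 by ring]
    exact Nat.pow_le_pow_left (by nlinarith) 5

/-- Compute the powers of two and the number of levels. -/
def levelsP : Program :=
  .seq (.setI 6 (.const 0)) (.seq (.setI 20 (.const 1)) (.loop (.ile (.var 20) (.var 5))
    (.seq (.storeI 22 (.var 6) (.var 20)) (.seq (.setI 6 (.add (.var 6) (.const 1)))
      (.setI 20 (.mul (.var 20) (.const 2)))))))

/-- Compute the slab size. -/
def slabSizeP : Program :=
  .seq (.setI 9 (.const 0)) (.loop (.not (.ile (.mul (.var 4) (.var 4))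
    (.mul (.mul (.var 9) (.var 9)) (.var 9)))) (.setI 9 (.add (.var 9) (.const 1))))

/-- Compute the constants. -/
def constsP : Program :=
  .seq (.setI 4 (.var 0)) (.seq (.setI 5 (.add (.mul (.const 3) (.var 0)) (.const 1)))
    (.seq (.setI 8 (.add (.mul (.const 3) (.var 0)) (.const 3))) (.seq levelsP
      (.seq (.setI 7 (.mul (.mul (.var 6) (.var 6)) (.mul (.var 6) (.var 6))))
        (.seq slabSizeP (.setI 10 (.add (.div (.mul (.const 3) (.var 4)) (.var 9)) (.const 1))))))))

variable {W n L g : ℕ}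

theorem run_levelsP (hW : (3 * n + 3) ^ 5 ≤ W) {s : State} (h5 : s.ivar 5 = 3 * n + 1) :
    Run W levelsP s (levels n * 20 + 20) fun s' => (∀ x, x ≠ 6 → x ≠ 20 → s'.ivar x = s.ivar x) ∧
      s'.ivar 6 = levels n ∧ (∀ l < levels n, s'.imem 22 l = 2 ^ l) ∧
      (∀ a ≠ 22, s'.imem a = s.imem a) ∧ s'.rmem = s.rmem := by
  have hW' : 2 * (3 * n + 3) ≤ W := by
    refine le_trans ?_ ((Nat.pow_le_pow_right (show 0 < 3 * n + 3 by omega)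
      (show 2 ≤ 5 by omega)).trans hW)
    nlinarith
  have hlog : levels n ≤ 3 * n + 1 := Nat.log_lt_self 2 (by omega)
  refine Run.mono (Run.seq (T₁ := 2) (Run.setI ?_ (Run.seq (T₁ := 2) (Run.setI ?_
    (Run.mono (Run.loop (T := 12) (fun i s' => (∀ x, x ≠ 6 → x ≠ 20 → s'.ivar x = s.ivar x) ∧
      s'.ivar 6 = i ∧ s'.ivar 20 = 2 ^ i ∧ (∀ l < i, s'.imem 22 l = 2 ^ l) ∧
      (∀ a ≠ 22, s'.imem a = s.imem a) ∧ s'.rmem = s.rmem) (levels n) ?_ ?_ ?_) le_rfl ?_)))))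
    ?_ fun _ h => h
  · simp [IExpr.eval]
  · simp [IExpr.eval]; omega
  · simp +contextual [IExpr.eval]
  · rintro i hi s' ⟨hx, h6, h20, h22, ha, hr⟩
    have hle : 2 ^ i ≤ 3 * n + 1 := Nat.pow_le_of_le_log (by omega) (Nat.lt_succ_iff.1 hi)
    refine ⟨by simp [Test.Holds, IExpr.eval, h20, hx 5 (by omega) (by omega), h5, hle],
      Run.mono (Run.seq (T₁ := 3) (T₂ := 4 + 4) (Run.storeI ?_ (Run.seq (T₁ := 4) (T₂ := 4)
        (Run.setI ?_ (Run.setI ?_ ?_))))) (by omega) fun _ h => h⟩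
    · simp [IExpr.eval, h20]; omega
    · simp [IExpr.eval, h6]; omega
    · simp [IExpr.eval, h20]; omega
    · simp only [IExpr.eval, ivar_setI, imem_setI, ivar_storeI, rmem_setI, rmem_storeI, h6, h20]
      refine ⟨fun x h1 h2 => by simp [h1, h2, hx], by simp, by simp [pow_succ], fun l hl => ?_,
        fun a h => ?_, hr⟩
      · rw [imem_storeI_apply]
        rcases eq_or_ne l i with rfl | hne
        · simp
        · simp [hne, h22 l (by omega)]
      · rw [imem_storeI, if_neg h, ha a h]
  · rintro s' ⟨hx, h6, h20, -⟩
    have := Nat.lt_pow_succ_log_self (b := 2) (by omega) (3 * n + 1)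
    simp only [Test.Holds, IExpr.eval, h20, hx 5 (by omega) (by omega), h5, not_le]
    exact this
  · exact fun s' ⟨h1, h2, _, h3⟩ => ⟨h1, h2, h3⟩
  · simp only [Test.cost, IExpr.cost]; omega

theorem run_slabSizeP (hn : n ≤ W) {s : State} (h4 : s.ivar 4 = n) (hg : slabSize n ≤ n) :
    Run W slabSizeP s (slabSize n * 20 + 20) fun s' => (∀ x, x ≠ 9 → s'.ivar x = s.ivar x) ∧
      s'.ivar 9 = slabSize n ∧ s'.imem = s.imem ∧ s'.rmem = s.rmem := by
  refine Run.mono (Run.seq (T₁ := 2) (Run.setI ?_ (Run.loop (T := 4) (fun i s' =>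
      (∀ x, x ≠ 9 → s'.ivar x = s.ivar x) ∧ s'.ivar 9 = i ∧ s'.imem = s.imem ∧ s'.rmem = s.rmem)
      (slabSize n) ?_ ?_ ?_))) ?_ fun _ h => h
  · simp [IExpr.eval]
  · simp +contextual [IExpr.eval]
  · rintro i hi s' ⟨hx, h9, hm, hr⟩
    have := Nat.find_min (exists_slabSize n) hi
    refine ⟨?_, Run.setI ?_ ?_⟩
    · simp only [Test.Holds, IExpr.eval, hx 4 (by omega), h4, h9]
      rwa [← pow_two, ← pow_two, ← pow_succ]
    · simp only [IExpr.eval, h9]; omega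
    · exact ⟨fun x h => by simp [h, hx], by simp [IExpr.eval, h9], hm, hr⟩
  · rintro s' ⟨hx, h9, hm, hr⟩
    have := Nat.find_spec (exists_slabSize n)
    simp only [Test.Holds, IExpr.eval, hx 4 (by omega), h4, h9, not_not]
    rwa [← pow_two, ← pow_two, ← pow_succ]
  · simp only [Test.cost, IExpr.cost]; omega

theorem run_constsP (z : Sizes W n (levels n) (slabSize n)) {s : State} (h0 : s.ivar 0 = n) :
    Run W constsP s (levels n * 20 + slabSize n * 20 + 100) fun s' =>
      Consts n (levels n) (slabSize n) s' ∧ (∀ a ≠ 22, s'.imem a = s.imem a) ∧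
      s'.rmem = s.rmem := by
  have hSW := z.S_le
  have hL4 := z.L4_le
  have e1 : 3 * n / slabSize n ≤ 3 * n := Nat.div_le_self _ _
  refine Run.mono (Run.seq (T₁ := 2) (Run.setI ?_ (Run.seq (T₁ := 6) (Run.setI ?_ (Run.seq (T₁ := 6)
    (Run.setI ?_ (Run.seq' (run_levelsP z.le_W ?_) fun s₁ ⟨a1, a2, a3, a4, a5⟩ =>
    Run.seq (T₁ := 8) (Run.setI ?_ (Run.seq' (run_slabSizeP (n := n) (by omega) ?_ z.g_le)
    fun s₂ ⟨b1, b2, b3, b4⟩ => Run.setI ?_ ?_)))))))))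
    ?_ fun _ h => h
  · simp [IExpr.eval, h0]; omega
  · simp [IExpr.eval, h0]; omega
  · simp [IExpr.eval, h0]; omega
  · simp [IExpr.eval, h0]
  · simp only [IExpr.eval, a2]
    convert hL4 using 1; ring
  · simp [IExpr.eval, h0, a1]
  · simp [IExpr.eval, h0, a1, b1, b2]; omega
  · refine ⟨⟨?_, ?_, ?_, ?_, ?_, ?_, ?_, ?_⟩, ?_, ?_⟩
    · simp [IExpr.eval, h0, a1, b1]
    · simp [IExpr.eval, h0, a1, b1]
    · simp [a2, b1]
    · simp [IExpr.eval, a2, b1]; ring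
    · simp [IExpr.eval, h0, a1, b1]
    · simp [b2]
    · simp [IExpr.eval, h0, a1, b1, b2]
    · simpa [b3] using a3
    · intro a ha; simp [b3, a4 a ha]
    · simp [b4, a5]
  · simp only [IExpr.cost]; omega

/-! ### Output -/

/-- Equality of two integers. -/
def eqE (e f : IExpr) : Test := .and (.ile e f) (.ile f e)

theorem holds_eqE {s : State} {e f : IExpr} : (eqE e f).Holds s ↔ e.eval s = f.eval s := by
  simp only [eqE, Test.Holds]; omega

/-- Make the three indices in the variables `31`, `32`, `33` different. -/
def distinctP : Program :=
  .seq (.cond (eqE (.var 31) (.var 32)) (.setI 32 (.sub (.const 1) (.var 31))) .skip)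
    (.cond (.or (eqE (.var 33) (.var 31)) (eqE (.var 33) (.var 32)))
      (.cond (.and (.ile (.const 1) (.var 31)) (.ile (.const 1) (.var 32))) (.setI 33 (.const 0))
        (.cond (eqE (.add (.var 31) (.var 32)) (.const 1)) (.setI 33 (.const 2))
          (.setI 33 (.const 1)))) .skip)

/-- Write the output. -/
def outP : Program :=
  .cond (.ile (.const 1) (.var 30))
    (.seq distinctP (.seq (.setI 0 (.const 1)) (.seq (.setI 1 (.var 31)) (.seq (.setI 2 (.var 32))
      (.setI 3 (.var 33)))))) (.setI 0 (.const 0))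

variable {pos ext : Fin 4 → ℕ → ℕ}

/-- The search may report repeated indices. Replacing a repetition by an unused index preserves the
cover, and `0`, `1`, `2` always include an unused one. The truncated difference `1 - x` is an index
different from `x`. -/
theorem run_distinctP (hn : 3 ≤ n) (hW : n ≤ W) {s : State} (h1 : s.ivar 31 < n)
    (h2 : s.ivar 32 < n) (h3 : s.ivar 33 < n)
    (hc : Cover n pos ext (s.ivar 31) (s.ivar 32) (s.ivar 33)) :
    Run W distinctP s 60 fun s' => s'.ivar 31 < n ∧ s'.ivar 32 < n ∧ s'.ivar 33 < n ∧
      Cover n pos ext (s'.ivar 31) (s'.ivar 32) (s'.ivar 33) ∧ s'.ivar 31 ≠ s'.ivar 32 ∧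
      s'.ivar 31 ≠ s'.ivar 33 ∧ s'.ivar 32 ≠ s'.ivar 33 := by
  refine Run.mono (Run.seq' (Q₁ := fun s' => s'.ivar 31 < n ∧ s'.ivar 32 < n ∧ s'.ivar 33 < n ∧
      Cover n pos ext (s'.ivar 31) (s'.ivar 32) (s'.ivar 33) ∧ s'.ivar 31 ≠ s'.ivar 32)
    (Run.cond (T₁ := 4) (T₂ := 1) (fun hb => Run.setI ?_ ?_) fun hb => Run.skip ?_)
    fun s₁ ⟨g1, g2, g3, gc, gne⟩ => Run.cond (T₂ := 1) (fun hb => Run.cond (T₁ := 2)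
      (fun hb' => Run.setI ?_ ?_) fun hb' => Run.cond (T₁ := 2) (T₂ := 2)
      (fun hb'' => Run.setI ?_ ?_) fun hb'' => Run.setI ?_ ?_) fun hb => Run.skip ?_) ?_
    fun _ h => h
  · simp only [IExpr.eval]; omega
  · rw [holds_eqE] at hb
    simp only [IExpr.eval, ivar_setI] at hb ⊢
    norm_num
    refine ⟨h1, by omega, h3, fun p hp => ?_, by omega⟩
    have := hc p hp
    rw [← hb] at this; tauto
  · rw [holds_eqE] at hb
    exact ⟨h1, h2, h3, hc, hb⟩
  all_goals try simp only [IExpr.eval, Test.Holds, holds_eqE, ivar_setI] at hb ⊢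
  all_goals try simp only [IExpr.eval, Test.Holds] at hb'
  all_goals try simp only [IExpr.eval, holds_eqE] at hb''
  · omega
  · norm_num
    refine ⟨g1, g2, by omega, fun p hp => ?_, gne, by omega, by omega⟩
    have := gc p hp
    rcases hb with h | h <;> rw [h] at this <;> tauto
  · omega
  · norm_num
    refine ⟨g1, g2, by omega, fun p hp => ?_, gne, by omega, by omega⟩
    have := gc p hp
    rcases hb with h | h <;> rw [h] at this <;> tauto
  · omega
  · norm_num
    refine ⟨g1, g2, by omega, fun p hp => ?_, gne, by omega, by omega⟩
    have := gc p hp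
    rcases hb with h | h <;> rw [h] at this <;> tauto
  · exact ⟨g1, g2, g3, gc, gne, by omega, by omega⟩
  · simp [Test.cost, eqE, IExpr.cost]

theorem run_outP (hn : 3 ≤ n) (hW : n ≤ W) {s : State} (hG : Good n pos ext s) :
    Run W outP s 90 fun s' => s'.ivar 0 = 1 ∧ s'.ivar 1 < n ∧ s'.ivar 2 < n ∧ s'.ivar 3 < n ∧
      Cover n pos ext (s'.ivar 1) (s'.ivar 2) (s'.ivar 3) ∧ s'.ivar 1 ≠ s'.ivar 2 ∧
      s'.ivar 1 ≠ s'.ivar 3 ∧ s'.ivar 2 ≠ s'.ivar 3 ∨ s'.ivar 0 = 0 ∧ s.ivar 30 ≠ 1 := by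
  refine Run.mono (Run.cond (T₁ := 68) (T₂ := 2) (fun hb => ?_) fun hb => ?_)
    (by simp [Test.cost, IExpr.cost]) fun _ h => h
  · simp only [Test.Holds, IExpr.eval] at hb
    obtain h | ⟨-, h1, h2, h3, hc⟩ := hG
    · omega
    refine Run.seq' (run_distinctP hn hW h1 h2 h3 hc) fun s₁ ⟨g1, g2, g3, gc, gne⟩ =>
      Run.seq (T₁ := 2) (T₂ := 2 + (2 + 2)) (Run.setI ?_ (Run.seq (T₁ := 2) (T₂ := 2 + 2)
        (Run.setI ?_ (Run.seq (T₁ := 2) (T₂ := 2) (Run.setI ?_ (Run.setI ?_ ?_))))))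
    all_goals simp [IExpr.eval]
    · omega
    · omega
    · omega
    · omega
    · exact ⟨g1, g2, g3, gc, gne⟩
  · simp only [Test.Holds, IExpr.eval] at hb
    exact Run.setI (by simp [IExpr.eval]) (.inr ⟨by simp [IExpr.eval], by omega⟩)

end ThreeCover

namespace ThreeCover
open RealRAM

/-! ### The algorithm -/

/-- The algorithm. -/
def mainP : Program :=
  .cond (.ile (.var 0) (.const 2)) (.setI 0 (.const 0)) (.seq constsP (.seq ranksP (.seq tabsP
    (.seq (.setI 30 (.const 0)) (.seq searchP outP)))))

/-- The running time in terms of the number of levels and the slab size. -/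
def timeBound (n L g : ℕ) : ℕ :=
  L * 20 + g * 20 + 2 * axisT n L + tabsT n L + searchT n L g + 300

theorem cover_iff {n : ℕ} (P : Fin n → ℝ × ℝ) (R : Fin n → Rect) (i j k : Fin n) :
    Cover n (posOf n (inputVal n (inputState P R))) (extOf n (inputVal n (inputState P R))) i j k ↔
      Set.range P ⊆ (R i).toSet ∪ (R j).toSet ∪ (R k).toSet := by
  have key : ∀ p r : Fin n, In (posOf n (inputVal n (inputState P R)))
      (extOf n (inputVal n (inputState P R))) p r ↔ P p ∈ (R r).toSet := by
    intro p r
    rw [in_iff p.2 r.2]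
    have v : ∀ a < 2, inputVal n (inputState P R) a = if a = 0 then
        axisVal n ((inputState P R).rmem 0) ((inputState P R).rmem 2) ((inputState P R).rmem 3)
        else axisVal n ((inputState P R).rmem 1) ((inputState P R).rmem 4)
          ((inputState P R).rmem 5) := fun a _ => rfl
    have hr : ((r : ℕ) : ℕ) < n := r.2
    have hp : ((p : ℕ) : ℕ) < n := p.2
    have e1 : ∀ pt lo hi : ℕ → ℝ, axisVal n pt lo hi r = lo r := fun _ _ _ => if_pos hr
    have e2 : ∀ pt lo hi : ℕ → ℝ, axisVal n pt lo hi (n + p) = pt p := fun _ _ _ => by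
      rw [axisVal, if_neg (by omega), if_pos (by omega), Nat.add_sub_cancel_left]
    have e3 : ∀ pt lo hi : ℕ → ℝ, axisVal n pt lo hi (2 * n + r) = hi r := fun _ _ _ => by
      rw [axisVal, if_neg (by omega), if_neg (by omega), Nat.add_sub_cancel_left]
    have f : (∀ a < 2, inputVal n (inputState P R) a r ≤ inputVal n (inputState P R) a (n + p) ∧
        inputVal n (inputState P R) a (n + p) ≤ inputVal n (inputState P R) a (2 * n + r)) ↔
        ((R r).xmin ≤ (P p).1 ∧ (P p).1 ≤ (R r).xmax) ∧
          ((R r).ymin ≤ (P p).2 ∧ (P p).2 ≤ (R r).ymax) := by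
      constructor
      · intro h
        have h0 := h 0 (by omega)
        have h1 := h 1 (by omega)
        rw [v 0 (by omega), if_pos rfl, e1, e2, e3] at h0
        rw [v 1 (by omega), if_neg (by omega), e1, e2, e3] at h1
        simpa [inputState] using And.intro h0 h1
      · rintro ⟨h0, h1⟩ a ha
        rw [v a ha]
        interval_cases a
        · rw [if_pos rfl, e1, e2, e3]; simpa [inputState] using h0
        · rw [if_neg (by omega), e1, e2, e3]; simpa [inputState] using h1
    rw [f]
    simp only [Rect.toSet, Set.mem_prod, Set.mem_Icc]
  constructor
  · rintro h _ ⟨p, rfl⟩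
    have := h p p.2
    rw [key, key, key] at this
    simpa [or_assoc] using this
  · intro h p hp
    have := h ⟨⟨p, hp⟩, rfl⟩
    have k1 := key ⟨p, hp⟩ i
    have k2 := key ⟨p, hp⟩ j
    have k3 := key ⟨p, hp⟩ k
    simp only at k1 k2 k3
    rw [k1, k2, k3]
    simpa [or_assoc] using this

theorem run_mainP {n : ℕ} (P : Fin n → ℝ × ℝ) (R : Fin n → Rect) :
    Run ((n + 2) ^ 10) mainP (inputState P R) (timeBound n (levels n) (slabSize n))
      (CorrectOutput P R) := by
  refine Run.mono (Run.cond (T₁ := 2) (T₂ := timeBound n (levels n) (slabSize n) - 10)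
    (fun hb => ?_) fun hb => ?_) ?_ fun _ h => h
  · simp only [Test.Holds, IExpr.eval] at hb
    have hn : n ≤ 2 := hb
    refine Run.setI (by simp [IExpr.eval]) (.inr ⟨by simp [IExpr.eval], ?_⟩)
    rintro ⟨i, j, k, hij, hik, hjk, -⟩
    have := i.2
    have := j.2
    have := k.2
    simp only [ne_eq, Fin.ext_iff] at hij hik hjk
    omega
  · simp only [Test.Holds, IExpr.eval] at hb
    have hn : ¬ n ≤ 2 := hb
    have z := sizes_levels (n := n) (by omega)
    have hW := z.S_le
    refine Run.mono (Run.seq' (run_constsP z (s := inputState P R) rfl) fun s₁ ⟨h₁, m₁, r₁⟩ =>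
      Run.seq' (run_ranksP z (pow_levels_le n) h₁ ?_) fun s₂ ⟨h₂, m₂⟩ =>
      Run.seq' (run_tabsP z (ranks_posOf _ _) h₂ m₂) fun s₃ h₃ =>
      Run.seq (T₁ := 2) (Run.setI ?_ (Run.seq' (run_searchP z (ranks_posOf _ _)
        (h₃.same (Same.setI (k := 30))) ?_) fun s₄ ⟨g₄, h₄⟩ =>
      Run.mono (run_outP (by omega) (by omega) g₄) le_rfl fun s' h' => ?_))) ?_ fun _ h => h
    · intro a ha
      rw [m₁ a ha]; rfl
    · simp [IExpr.eval]
    · exact .inl (by simp [IExpr.eval])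
    · have e : inputVal n s₁ = inputVal n (inputState P R) := by
        unfold inputVal; rw [r₁]
      rw [e] at h' h₄
      rcases h' with ⟨h0, l1, l2, l3, hc, n12, n13, n23⟩ | ⟨h0, hne⟩
      · refine .inl ⟨h0, ⟨_, l1⟩, ⟨_, l2⟩, ⟨_, l3⟩, rfl, rfl, rfl, ?_, ?_, ?_, ?_⟩
        · simpa [Fin.ext_iff] using n12
        · simpa [Fin.ext_iff] using n13
        · simpa [Fin.ext_iff] using n23
        · exact (cover_iff P R _ _ _).1 hc
      · refine .inr ⟨h0, ?_⟩
        rintro ⟨i, j, k, -, -, -, hc⟩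
        exact hne (h₄ ⟨i, i.2, j, j.2, k, k.2, (cover_iff P R i j k).2 hc⟩)
    · unfold timeBound; omega
  · simp only [Test.cost, IExpr.cost, timeBound]; omega

/-! ### The running time -/

/-- Each tested pair costs `O(L ^ 4)`. The coarse pairs give `n * r ^ 2` with `r = 3 * n / g + 1`,
the slab pairs `n * g`; sorting, tables and sweeps cost `O(L ^ 4 * n)` and are absorbed. The
constant is generous. -/
theorem timeBound_le {n L g : ℕ} (hn : 0 < n) (hL : 0 < L) (hg : 0 < g) :
    timeBound n L g ≤ 10 ^ 8 * (L ^ 4 * (n * (3 * n / g + 1) ^ 2 + n * g)) := by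
  have hr : 0 < 3 * n / g + 1 := Nat.succ_pos _
  have ax : axisT n L ≤ 1400 * (L ^ 4 * n) := by
    have h1 : L ^ 2 * n ≤ L ^ 4 * n := Nat.mul_le_mul_right n (Nat.pow_le_pow_right hL (by omega))
    have h2 : L * n ≤ L ^ 4 * n := Nat.mul_le_mul_right n (Nat.le_self_pow (by omega) L)
    have h3 : L ≤ L * n := Nat.le_mul_of_pos_right L hn
    have h4 : 1 * n ≤ L * n := Nat.mul_le_mul_right n hL
    unfold axisT
    linarith
  have hLL : L ≤ L ^ 4 := Nat.le_self_pow (by omega) L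
  unfold timeBound searchT coarseT slabT tabsT checkT bboxT opT
  generalize 3 * n / g + 1 = r at hr
  have hΛ : 0 < L ^ 4 := by positivity
  generalize L ^ 4 = Λ at *
  have hn2 : n * 1 ≤ n * r ^ 2 := Nat.mul_le_mul_left n (Nat.pow_pos hr)
  have hng : n * 1 ≤ n * g := Nat.mul_le_mul_left n hg
  have hr2 : 1 * r ^ 2 ≤ n * r ^ 2 := Nat.mul_le_mul_right _ hn
  have hrr : r ≤ r ^ 2 := Nat.le_self_pow (by omega) r
  have hgg : 1 * g ≤ n * g := Nat.mul_le_mul_right _ hn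
  have f : ∀ x, 1 * x ≤ Λ * x := fun x => Nat.mul_le_mul_right x hΛ
  have f0 := f n
  have f1 := f (n * r ^ 2)
  have f2 := f (n * g)
  have m1 := Nat.mul_le_mul_left Λ hn2
  have m2 := Nat.mul_le_mul_left Λ hr2
  have m3 := Nat.mul_le_mul_left Λ hrr
  have m4 := Nat.mul_le_mul_left Λ hn
  nlinarith

/-- For `n ≥ 3` one has `3 * n + 1 ≤ n ^ 3`, so with `log 2 ≥ 2 / 3` the integer logarithm is at
most `9 / 2 * log n`. The extra `1` is at most `log n`, as `n` exceeds `e`. -/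
theorem levels_le {n : ℕ} (hn : 3 ≤ n) : (levels n : ℝ) ≤ 6 * Real.log n := by
  have hn' : (3 : ℝ) ≤ n := by exact_mod_cast hn
  have h1 : 1 ≤ Real.log n := by
    rw [Real.le_log_iff_exp_le (by linarith)]
    linarith [Real.exp_one_lt_d9]
  have h2 : (2 : ℝ) / 3 ≤ Real.log 2 := by linarith [Real.log_two_gt_d9]
  have h3 : 2 ^ Nat.log 2 (3 * n + 1) ≤ n ^ 3 :=
    (Nat.pow_log_le_self 2 (by omega)).trans (by nlinarith [sq_nonneg (n : ℤ)])
  have h4 : (Nat.log 2 (3 * n + 1) : ℝ) * Real.log 2 ≤ 3 * Real.log n := by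
    rw [← Real.log_pow, show (3 : ℝ) * Real.log n = Real.log ((n : ℝ) ^ 3) by
      rw [Real.log_pow]; norm_num]
    exact Real.log_le_log (by positivity) (by exact_mod_cast h3)
  have h5 : (Nat.log 2 (3 * n + 1) : ℝ) * (2 / 3) ≤ 3 * Real.log n :=
    (mul_le_mul_of_nonneg_left h2 (Nat.cast_nonneg _)).trans h4
  rw [levels]
  push_cast
  linarith

/-- With `y = n ^ (1 / 3)` the slab size is between `y ^ 2` and `y ^ 2 + 1 ≤ 2 * y ^ 2`, so there
are at most `4 * y` slabs. The two terms are then at most `16 * y ^ 5` and `2 * y ^ 5`. -/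
theorem slabSize_bounds {n : ℕ} (hn : 1 ≤ n) :
    ((n * (3 * n / slabSize n + 1) ^ 2 + n * slabSize n : ℕ) : ℝ) ≤ 18 * (n : ℝ) ^ (5 / 3 : ℝ) := by
  obtain ⟨y, hy, hyn⟩ : ∃ y : ℝ, 1 ≤ y ∧ y ^ 3 = n :=
    ⟨(n : ℝ) ^ (1 / 3 : ℝ), Real.one_le_rpow (by exact_mod_cast hn) (by norm_num), by
      rw [← Real.rpow_natCast, ← Real.rpow_mul (Nat.cast_nonneg _)]; norm_num⟩
  have h5 : (n : ℝ) ^ (5 / 3 : ℝ) = y ^ 5 := by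
    rw [← hyn, ← Real.rpow_natCast, ← Real.rpow_natCast, ← Real.rpow_mul (by linarith)]
    norm_num
  have z := sizes_levels (n := n) (by omega)
  have hle : y ^ 2 ≤ slabSize n := by
    have := Nat.find_spec (exists_slabSize n)
    refine le_of_pow_le_pow_left₀ (n := 3) (by omega) (Nat.cast_nonneg _) ?_
    rw [← pow_mul, show 2 * 3 = 3 * 2 by omega, pow_mul, hyn]
    exact_mod_cast this
  have hlt : (slabSize n : ℝ) ≤ y ^ 2 + 1 := by
    obtain ⟨k, hk⟩ := Nat.exists_eq_succ_of_ne_zero z.g_pos.ne'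
    have := Nat.find_min (exists_slabSize n) (m := k) (by rw [← slabSize]; omega)
    have : (k : ℝ) ≤ y ^ 2 := by
      refine le_of_pow_le_pow_left₀ (n := 3) (by omega) (by positivity) ?_
      rw [← pow_mul, show 2 * 3 = 3 * 2 by omega, pow_mul, hyn]
      exact_mod_cast (not_le.1 this).le
    rw [hk]
    push_cast
    linarith
  have hdiv : ((3 * n / slabSize n : ℕ) : ℝ) ≤ 3 * y := by
    refine Nat.cast_div_le.trans ?_
    rw [div_le_iff₀ (by exact_mod_cast z.g_pos)]
    push_cast
    rw [← hyn]
    nlinarith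
  have hr : ((3 * n / slabSize n : ℕ) : ℝ) + 1 ≤ 4 * y := by linarith
  have hr2 : (((3 * n / slabSize n : ℕ) : ℝ) + 1) ^ 2 ≤ (4 * y) ^ 2 :=
    pow_le_pow_left₀ (by positivity) hr 2
  have hg : (slabSize n : ℝ) ≤ 2 * y ^ 2 := by nlinarith
  rw [h5, Nat.cast_add, Nat.cast_mul, Nat.cast_mul, Nat.cast_pow, Nat.cast_add, Nat.cast_one, ← hyn]
  calc _ ≤ y ^ 3 * (4 * y) ^ 2 + y ^ 3 * (2 * y ^ 2) := by gcongr
    _ = 18 * y ^ 5 := by ring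

theorem isSoftO_timeBound :
    IsSoftO (fun n => (timeBound n (levels n) (slabSize n) : ℝ)) fun n => (n : ℝ) ^ (5 / 3 : ℝ) := by
  refine ⟨4, Asymptotics.IsBigO.of_bound (10 ^ 8 * 6 ^ 4 * 18) ?_⟩
  filter_upwards [Filter.eventually_ge_atTop 3] with n hn
  have z := sizes_levels (n := n) (by omega)
  have h0 : 0 ≤ Real.log n := Real.log_natCast_nonneg n
  rw [Real.norm_of_nonneg (by positivity), Real.norm_of_nonneg (by positivity)]
  have h1 : (timeBound n (levels n) (slabSize n) : ℝ) ≤ 10 ^ 8 * ((levels n : ℝ) ^ 4 *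
      ((n * (3 * n / slabSize n + 1) ^ 2 + n * slabSize n : ℕ) : ℝ)) := by
    exact_mod_cast timeBound_le z.n_pos z.L_pos z.g_pos
  calc _ ≤ _ := h1
    _ ≤ 10 ^ 8 * ((6 * Real.log n) ^ 4 * (18 * (n : ℝ) ^ (5 / 3 : ℝ))) := by
      gcongr
      · exact levels_le hn
      · exact slabSize_bounds (by omega)
    _ = _ := by ring

end ThreeCover

/-- There is a single real-RAM program (with `O(log n)`-bit integer words) that, given `n` points
and `n` axis-aligned rectangles in the plane, finds three of the rectangles that cover all the
points, or reports that there are none, in worst-case time `Õ(n^(5/3))`. -/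
theorem mainTheorem12 :
    ∃ (prog : RealRAM.Program) (c : ℕ) (T : ℕ → ℕ),
      IsSoftO (fun n => (T n : ℝ)) (fun n => (n : ℝ) ^ (5 / 3 : ℝ)) ∧
      ∀ (n : ℕ) (P : Fin n → ℝ × ℝ) (R : Fin n → Rect),
        ∃ (t : ℕ) (s : RealRAM.State),
          RealRAM.Exec ((n + 2) ^ c) prog (inputState P R) t s ∧
          t ≤ T n ∧
          CorrectOutput P R s :=
  ⟨ThreeCover.mainP, 10, fun n => ThreeCover.timeBound n (ThreeCover.levels n)
    (ThreeCover.slabSize n), ThreeCover.isSoftO_timeBound, fun _ P R => ThreeCover.run_mainP P R⟩
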